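/- **Conventions.** An elliptic curve $E$ over $\mathbf Q$ is a nonsingular curve given by an equation $y^2+a_1xy+a_3y=x^3+a_2x^2+a_4x+a_6$ with integers $a_i$; for a prime $q$, $\#E(\mathbf F_q)$ is the number of solutions of this equation in $\mathbf F_q$, including the point at infinity. An *eigenform* is a cusp form $f=\sum_{n\ge1}a_ne^{2\pi inz}$ of weight two for some $\Gamma_0(N)$, $N\ge1$, with $a_1=1$, which is an eigenfunction of all the Hecke operators $T_mf=\sum_{n\ge1}\bigl(\sum_{d\mid(n,m),\,(d,N)=1}d\,a_{nm/d^2}\bigr)e^{2\pi inz}$, $m\ge1$; $\mathcal O_f$ denotes the ring of integers of $\mathbf Q(a_2,a_3,\dots)$. Let $G_{\mathbf Q}=\mathrm{Gal}(\overline{\mathbf Q}/\mathbf Q)$. * $E$ is *modular* if there is an eigenform $\sum a_ne^{2\pi inz}$ with $a_q=q+1-\#E(\mathbf F_q)$ for all but finitely many primes $q$. * Let $A$ be a commutative topological ring. A continuous homomorphism $\rho:G_{\mathbf Q}\to\mathrm{GL}_2(A)$ is *modular* if there are an eigenform $f=\sum a_ne^{2\pi inz}$, a commutative ring $A'$ containing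 $A$ and a ring homomorphism $\iota:\mathcal O_f\to A'$ such that, for all but finitely many primes $q$, $\rho$ is unramified at $q$ and $\mathrm{trace}(\rho(\mathrm{Frob}_q))=\iota(a_q)$. (Here $\mathrm{Frob}_q$ is any $\sigma\in G_{\mathbf Q}$ such that, for some prime $\mathfrak q$ above $q$ of the ring of integers of $\overline{\mathbf Q}$, $\sigma x\equiv x^q\pmod{\mathfrak q}$ for all algebraic integers $x$.) * For a prime $p$, $\rho_{E,p}:G_{\mathbf Q}\to\mathrm{GL}_2(\mathbf Z_p)$ is the continuous representation, defined up to isomorphism, that gives the action of $G_{\mathbf Q}$ on the Tate module $T_p(E)=\varprojlim_n E[p^n]\cong\mathbf Z_p^2$, where $E[p^n]\subset E(\overline{\mathbf Q})$. **Theorem.** Let $E$ be an elliptic curve over $\mathbf Q$. Then the following are equivalent: 1. $E$ is modular; 2. $\rho_{E,p}$ is modular for every prime $p$; 3. $\rho_{E,p}$ is modular for some prime $p$. -/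

import Mathlib

open scoped NumberField MatrixGroups UpperHalfPlane

universe u

noncomputable section

/-! ### Eigenforms of weight two -/

/-- The `n`-th Fourier coefficient of `T_m f`, where `f = ∑ a_n e^{2πinz}` is a cusp form of weight
two for `Γ₀(N)`: the sum of `d * a_{nm/d²}` over the `d ∣ (n, m)` with `(d, N) = 1`. -/
def heckeCoeff (N m : ℕ) (a : ℕ → ℂ) (n : ℕ) : ℂ :=
  ∑ d ∈ (Nat.gcd n m).divisors with Nat.Coprime d N, (d : ℂ) * a (n * m / d ^ 2)

/-- The Hecke operator `T_m` on cusp forms of weight two for `Γ₀(N)`, given by its effect on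
Fourier expansions; the value is regarded as a function on the upper half plane. -/
def heckeOperator (N m : ℕ) (f : CuspForm (CongruenceSubgroup.Gamma0 N : Subgroup (GL (Fin 2) ℝ)) 2)
    (z : ℍ) : ℂ :=
  ∑' n : ℕ+, heckeCoeff N m (fun k => (UpperHalfPlane.qExpansion 1 f).coeff k) n *
    Complex.exp (2 * Real.pi * Complex.I * n * (z : ℂ))

/-- An eigenform: a normalized cusp form of weight two for some `Γ₀(N)`, `N ≥ 1`, which is an
eigenfunction of all the Hecke operators. -/
structure Eigenform where
  level : ℕ
  level_pos : 0 < level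
  form : CuspForm (CongruenceSubgroup.Gamma0 level : Subgroup (GL (Fin 2) ℝ)) 2
  normalized : (UpperHalfPlane.qExpansion 1 form).coeff 1 = 1
  eigen : ∀ m : ℕ, 1 ≤ m → ∃ c : ℂ, ∀ z : ℍ, heckeOperator level m form z = c * form z

namespace Eigenform

/-- The Fourier coefficients `a_n` of an eigenform `f(z) = ∑ a_n e^{2πinz}`. -/
def coeff (f : Eigenform) (n : ℕ) : ℂ := (UpperHalfPlane.qExpansion 1 f.form).coeff n

/-- The field `ℚ(a₂, a₃, …) ⊆ ℂ`. -/
def field (f : Eigenform) : IntermediateField ℚ ℂ :=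
  IntermediateField.adjoin ℚ {x | ∃ n : ℕ, 2 ≤ n ∧ x = f.coeff n}

/-- `𝓞_f`, the ring of integers of `ℚ(a₂, a₃, …)`. -/
abbrev integers (f : Eigenform) : Type := 𝓞 f.field

end Eigenform

/-! ### Representations of the absolute Galois group of `ℚ` -/

/-- An algebraic closure of `ℚ`. -/
abbrev QBar : Type := AlgebraicClosure ℚ

/-- The group `G_ℚ = Gal(ℚ̄/ℚ)`, with its Krull topology. -/
abbrev GQ : Type := QBar ≃ₐ[ℚ] QBar

/-- `𝔮` is a prime ideal dividing `q` in the ring of integers of `ℚ̄`. -/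
def IsPrimeAbove (q : ℕ) (𝔮 : Ideal (𝓞 QBar)) : Prop :=
  𝔮.IsPrime ∧ (q : 𝓞 QBar) ∈ 𝔮

/-- `σ` is a Frobenius element `Frob_q`: for some prime `𝔮` of the ring of integers of `ℚ̄` above
`q`, it satisfies `σ x ≡ x ^ q (mod 𝔮)` for all algebraic integers `x`. (Such a `σ` automatically
lies in the decomposition group of `𝔮`, since `x ^ q ∈ 𝔮 ↔ x ∈ 𝔮`.) -/
def IsFrobenius (q : ℕ) (σ : GQ) : Prop :=
  ∃ 𝔮 : Ideal (𝓞 QBar), IsPrimeAbove q 𝔮 ∧ ∀ x : 𝓞 QBar, σ • x - x ^ q ∈ 𝔮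

section Representations

variable {A : Type u} [CommRing A] [TopologicalSpace A]

/-- The representation `ρ` is trivial on the inertia groups of the primes above `q`. -/
def IsUnramifiedAtPrime (ρ : GQ →ₜ* GL (Fin 2) A) (q : ℕ) : Prop :=
  ∀ 𝔮 : Ideal (𝓞 QBar), IsPrimeAbove q 𝔮 → ∀ σ ∈ 𝔮.inertia GQ, ρ σ = 1

/-- `trace(ρ(Frob_q))` is defined (that is, `ρ` is unramified at `q`), and its image under
`j : A → A'` is equal to `t`, whatever the choice of the Frobenius element. -/
def TraceFrobEq {A' : Type u} [CommRing A'] (ρ : GQ →ₜ* GL (Fin 2) A) (q : ℕ)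
    (j : A →+* A') (t : A') : Prop :=
  IsUnramifiedAtPrime ρ q ∧
    ∀ σ : GQ, IsFrobenius q σ → j (Matrix.trace (ρ σ : Matrix (Fin 2) (Fin 2) A)) = t

/-- A (continuous) representation `ρ : G_ℚ → GL₂(A)` is modular if there are an eigenform
`f = ∑ a_n e^{2πinz}`, a ring `A'` containing `A` (via the injective homomorphism `j`) and a
homomorphism `ι : 𝓞_f → A'` such that `trace(ρ(Frob_q)) = ι(a_q)` for all but finitely many
primes `q`. -/
def IsModularRep (ρ : GQ →ₜ* GL (Fin 2) A) : Prop :=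
  ∃ (f : Eigenform) (A' : Type u) (_ : CommRing A') (j : A →+* A') (ι : f.integers →+* A'),
    Function.Injective j ∧
    ∃ S : Finset ℕ, ∀ q : ℕ, q.Prime → q ∉ S →
      ∃ a : f.integers, ((a : f.field) : ℂ) = f.coeff q ∧ TraceFrobEq ρ q j (ι a)

end Representations

/-! ### Elliptic curves over `ℚ`

An elliptic curve over `ℚ` is given by a Weierstrass equation with integer coefficients,
`E : WeierstrassCurve ℤ`, which is nonsingular over `ℚ`. -/

/-- `#E(𝔽_q)`: the number of solutions of the equation of `E` in `𝔽_q`, including the point at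
infinity. -/
def numPoints (E : WeierstrassCurve ℤ) (q : ℕ) : ℕ :=
  Nat.card {P : ZMod q × ZMod q // (E.map (Int.castRingHom (ZMod q))).toAffine.Equation P.1 P.2} + 1

/-- `E` is modular: there is an eigenform `∑ a_n e^{2πinz}` such that `a_q = q + 1 - #E(𝔽_q)` for
all but finitely many primes `q`. -/
def IsModularCurve (E : WeierstrassCurve ℤ) : Prop :=
  ∃ f : Eigenform, ∃ S : Finset ℕ, ∀ q : ℕ, q.Prime → q ∉ S →
    f.coeff q = (q : ℂ) + 1 - (numPoints E q : ℂ)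

instance : DecidableEq QBar := Classical.decEq _

/-- The Weierstrass curve over `ℚ` defined by the equation of `E`. -/
abbrev overQ (E : WeierstrassCurve ℤ) : WeierstrassCurve ℚ := E.map (Int.castRingHom ℚ)

/-- The group `E(ℚ̄)`. -/
abbrev PointsQBar (E : WeierstrassCurve ℤ) : Type :=
  ((overQ E).baseChange QBar).toAffine.Point

/-- The action of `σ ∈ G_ℚ` on `E(ℚ̄)`, through the coordinates. -/
def galPoint (E : WeierstrassCurve ℤ) (σ : GQ) : PointsQBar E →+ PointsQBar E :=
  WeierstrassCurve.Affine.Point.map (W' := overQ E) (S := ℚ) (σ : QBar →ₐ[ℚ] QBar)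

section TateModule

variable (M : Type) [AddCommGroup M] (p : ℕ)

/-- The `p`-adic Tate module of an abelian group `M`: the inverse limit of the groups `M[p^n]` with
respect to multiplication by `p`. -/
def tateModule : AddSubgroup (ℕ → M) where
  carrier := {x | ∀ n, p ^ n • x n = 0 ∧ p • x (n + 1) = x n}
  zero_mem' n := by simp
  add_mem' {x y} hx hy n := by
    simp only [Pi.add_apply, smul_add, (hx n).1, (hx n).2, (hy n).1, (hy n).2, add_zero, and_self]
  neg_mem' {x} hx n := by
    simp only [Pi.neg_apply, smul_neg, (hx n).1, (hx n).2, neg_zero, and_self]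

variable {M}

theorem nsmul_eq_of_cast_eq {N : ℕ} {P : M} (hP : N • P = 0)
    {a b : ℕ} (h : (a : ZMod N) = (b : ZMod N)) : a • P = b • P := by
  have h' : a ≡ b [MOD addOrderOf P] :=
    ((ZMod.natCast_eq_natCast_iff a b N).1 h).of_dvd (addOrderOf_dvd_of_nsmul_eq_zero hP)
  exact nsmul_eq_nsmul_iff_modEq.2 h'

variable [Fact p.Prime]

/-- A `p`-adic integer acts on the component in `M[p^n]` through its residue modulo `p^n`. -/
instance : SMul ℤ_[p] (tateModule M p) where
  smul a x := ⟨fun n => (PadicInt.toZModPow n a).val • x.1 n, fun n => by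
    refine ⟨by rw [smul_comm, (x.2 n).1, smul_zero], ?_⟩
    dsimp only
    rw [smul_comm, (x.2 n).2]
    refine nsmul_eq_of_cast_eq (x.2 n).1 ?_
    rw [ZMod.natCast_val, ZMod.natCast_val, PadicInt.cast_toZModPow n (n + 1) (Nat.le_succ n) a,
      ZMod.cast_id]⟩

theorem tate_smul_apply (a : ℤ_[p]) (x : tateModule M p) (n : ℕ) :
    (a • x).1 n = (PadicInt.toZModPow n a).val • x.1 n := rfl

instance : Module ℤ_[p] (tateModule M p) where
  one_smul x := Subtype.ext <| funext fun n => by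
    rw [tate_smul_apply]
    exact (nsmul_eq_of_cast_eq (b := 1) (x.2 n).1 (by simp)).trans (one_smul ℕ _)
  mul_smul a b x := Subtype.ext <| funext fun n => by
    rw [tate_smul_apply, tate_smul_apply, tate_smul_apply, smul_smul]
    exact nsmul_eq_of_cast_eq (x.2 n).1 (by simp)
  smul_zero a := Subtype.ext <| funext fun n => smul_zero (PadicInt.toZModPow n a).val
  smul_add a x y := Subtype.ext <| funext fun n =>
    smul_add (PadicInt.toZModPow n a).val (x.1 n) (y.1 n)
  add_smul a b x := Subtype.ext <| funext fun n => by
    change _ = (a • x).1 n + (b • x).1 n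
    rw [tate_smul_apply, tate_smul_apply, tate_smul_apply, ← add_smul]
    exact nsmul_eq_of_cast_eq (x.2 n).1 (by simp)
  zero_smul x := Subtype.ext <| funext fun n => by
    rw [tate_smul_apply, map_zero, ZMod.val_zero, zero_smul]; rfl

/-- The `ℤ_p`-linear endomorphism of the Tate module of `M` induced by an endomorphism of `M`. -/
def tateMap (g : M →+ M) : tateModule M p →ₗ[ℤ_[p]] tateModule M p where
  toFun x := ⟨fun n => g (x.1 n), fun n => by
    rw [← map_nsmul, ← map_nsmul, (x.2 n).1, (x.2 n).2, map_zero]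
    exact ⟨rfl, rfl⟩⟩
  map_add' x y := Subtype.ext <| funext fun n => map_add g (x.1 n) (y.1 n)
  map_smul' a x := Subtype.ext <| funext fun n =>
    map_nsmul g (PadicInt.toZModPow n a).val (x.1 n)

end TateModule

section Tate

variable (E : WeierstrassCurve ℤ) (p : ℕ) [Fact p.Prime]

/-- `ρ : G_ℚ → GL₂(ℤ_p)` is (a member of the isomorphism class of) `ρ_{E,p}`: it is the action of
`G_ℚ` on the Tate module `T_p(E)` of the group `E(ℚ̄)`, written as matrices with respect to some `ℤ_p`-basis of `T_p(E)` with two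
elements. -/
def IsTateRep (ρ : GQ →ₜ* GL (Fin 2) ℤ_[p]) : Prop :=
  ∃ b : Module.Basis (Fin 2) ℤ_[p] (tateModule (PointsQBar E) p), ∀ σ : GQ,
    (ρ σ : Matrix (Fin 2) (Fin 2) ℤ_[p]) = LinearMap.toMatrix b b (tateMap p (galPoint E σ))

/-- The representation `ρ_{E,p}` exists, and it is modular. (Modularity only depends on the
isomorphism class of a representation.) -/
def TateRepIsModular : Prop :=
  ∃ ρ : GQ →ₜ* GL (Fin 2) ℤ_[p], IsTateRep E p ρ ∧ IsModularRep ρ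

end Tate

end

/-!
The equivalence rests on one fact: for a prime `q` not dividing `6 p Δ`, the representation on the
Tate module `T_p(E)` is unramified at `q` and the trace of a Frobenius element is the integer
`q + 1 - #E(𝔽_q)` (`IsTateRep.isUnramifiedAtPrime`, `IsTateRep.trace_frobenius`). Granting this, an
eigenform that witnesses the modularity of `E` witnesses that of `ρ_{E,p}`, as `ℤ_p` and `𝓞_f` embed
in an algebraic closure of `ℚ_p`. Conversely a homomorphism `ι` from `𝓞_f` to a ring containing
`ℤ_p` is injective, so that `ι(a_q) = ι(q + 1 - #E(𝔽_q))` forces `a_q = q + 1 - #E(𝔽_q)`; Frobenius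
elements exist for all `q` (`exists_isFrobenius`).

The curve is replaced by a short Weierstrass equation (`shortEquivQBar`). A prime `𝔮` of the ring of
integers of `ℚ̄` gives a valuation ring of `ℚ̄`. Reduction modulo `𝔮` is a homomorphism (`red_add`),
which is injective on torsion of order prime to `q` (`eq_zero_of_red_eq_zero`), because `u = 1 / x`
satisfies `u(nP) ≡ n² u(P)` modulo `u(P)²` on its kernel. So inertia acts trivially on this torsion,
and a Frobenius element acts as the endomorphism `φ : (x, y) ↦ (x^q, y^q)` of the reduced curve.

The endomorphisms of a curve over an algebraically closed field `K` of characteristic other than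
two are handled through their values at the generic point `(t, s)`, which has coordinates in an
algebraic closure of `K(t)`. The degree of an endomorphism is the height of this value, that is,
the degree of its `x`-coordinate as a rational function of `t`. The height satisfies the
parallelogram law (`height_add_add_height_sub`), since `x(P + Q)` and `x(P - Q)` are the roots of
a quadratic polynomial whose coefficients are biquadratic forms in `x(P)` and `x(Q)` without
common zero. The invariant differential `dx / y` is multiplied by an additive character under
endomorphisms (`HasDifferential.add`) that sends `n` to `n` and `φ` to `0`. Where this character
does not vanish, the differential equation for the `x`-coordinate forces all its poles to have the
smallest possible order, and counting them shows that the order of the kernel is the degree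
(`IsEndo.card_ker`). It follows that multiplication by `n` has a kernel of order `n²` if `n` is
invertible in `K` (`card_torsion`), and that `n - φ` has a kernel of order `n² - β n + q` for `n`
prime to `q`, where `φ² - β φ + q = 0` (`exists_frobenius_charpoly`). The points fixed by `φ` are
those over `𝔽_q`, so `β = q + 1 - #E(𝔽_q)`.

The torsion count makes `T_p(E)` free of rank two (`TateModule.nonempty_basis`). An endomorphism
of a module of rank two that is annihilated by `X² - β X + q` has trace `β` unless it is a scalar.
When Frobenius is a scalar `l`, an integer `n ≡ l` modulo `p^k` is such that `n - φ` kills the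
`p^k`-torsion, so that `p^(2k)` divides `n² - β n + q`, and this forces `β = 2 l`
(`TateModule.trace_eq`). No duality on the Tate module is needed.
-/

/-! ### Coordinates of points on short Weierstrass curves -/

namespace ShortWeierstrass

open WeierstrassCurve

section Coordinates

variable {K : Type*} [Field K] {W : WeierstrassCurve.Affine K}

/-- `P` is the affine point with coordinates `(x, y)`. -/
def HasCoords (P : W.Point) (x y : K) : Prop :=
  ∃ h : W.Nonsingular x y, P = .some x y h

theorem exists_hasCoords {P : W.Point} (hP : P ≠ 0) : ∃ x y, HasCoords P x y := by
  match P, hP with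
  | .zero, hP => exact absurd rfl hP
  | .some x y h, _ => exact ⟨x, y, h, rfl⟩

theorem HasCoords.ne_zero {P : W.Point} {x y : K} (h : HasCoords P x y) : P ≠ 0 := by
  obtain ⟨h, rfl⟩ := h
  exact Affine.Point.some_ne_zero h

theorem HasCoords.unique {P : W.Point} {x y x' y' : K} (h : HasCoords P x y)
    (h' : HasCoords P x' y') : x = x' ∧ y = y' := by
  obtain ⟨h, rfl⟩ := h
  obtain ⟨h', e⟩ := h'
  simpa using e

theorem HasCoords.ext {P Q : W.Point} {x y : K} (h : HasCoords P x y)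
    (h' : HasCoords Q x y) : P = Q := by
  obtain ⟨h, rfl⟩ := h
  obtain ⟨h', rfl⟩ := h'
  rfl

theorem HasCoords.eq_or_eq_neg {P Q : W.Point} {x y y' : K} (h : HasCoords P x y)
    (h' : HasCoords Q x y') : P = Q ∨ P = -Q := by
  obtain ⟨h, rfl⟩ := h
  obtain ⟨h', rfl⟩ := h'
  exact Affine.Point.X_eq_iff.1 rfl

theorem exists_point_of_equation (hΔ : WeierstrassCurve.Δ W ≠ 0) {x y : K}
    (h : W.Equation x y) : ∃ P : W.Point, HasCoords P x y :=
  ⟨_, (Affine.equation_iff_nonsingular_of_Δ_ne_zero hΔ).1 h, rfl⟩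

/-- `(A : B)` are projective coordinates of the image of `P` under `x : W → ℙ¹`, the point at
infinity being sent to `(1 : 0)`. -/
def XRep (P : W.Point) (A B : K) : Prop :=
  (P = 0 ∧ A ≠ 0 ∧ B = 0) ∨ ∃ x y, HasCoords P x y ∧ B ≠ 0 ∧ A = x * B

theorem XRep.ne_zero {P : W.Point} {A B : K} (h : XRep P A B) : A ≠ 0 ∨ B ≠ 0 := by
  rcases h with ⟨_, h, _⟩ | ⟨_, _, _, h, _⟩
  exacts [.inl h, .inr h]

theorem XRep.cross {P : W.Point} {A B A' B' : K} (h : XRep P A B) (h' : XRep P A' B') :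
    A * B' = A' * B := by
  rcases h with ⟨h0, _, rfl⟩ | ⟨x, y, h, _, rfl⟩ <;>
  rcases h' with ⟨h0', _, rfl⟩ | ⟨x', y', h', _, rfl⟩
  · simp
  · exact absurd h0 h'.ne_zero
  · exact absurd h0' h.ne_zero
  · rw [(h.unique h').1]; ring

theorem HasCoords.xRep {P : W.Point} {x y : K} (h : HasCoords P x y) : XRep P x 1 :=
  .inr ⟨x, y, h, one_ne_zero, (mul_one x).symm⟩

theorem xRep_zero : XRep (0 : W.Point) 1 0 := .inl ⟨rfl, one_ne_zero, rfl⟩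

theorem XRep.smul {P : W.Point} {A B c : K} (hc : c ≠ 0) (h : XRep P A B) :
    XRep P (c * A) (c * B) := by
  rcases h with ⟨h0, hA, rfl⟩ | ⟨x, y, h, hB, rfl⟩
  · exact .inl ⟨h0, mul_ne_zero hc hA, mul_zero c⟩
  · exact .inr ⟨x, y, h, mul_ne_zero hc hB, by ring⟩

theorem XRep.exists_scalar {P : W.Point} {A B A' B' : K} (h : XRep P A B) (h' : XRep P A' B') :
    ∃ c, c ≠ 0 ∧ A = c * A' ∧ B = c * B' := by
  have hc := h.cross h'
  rcases h' with ⟨rfl, hA', rfl⟩ | ⟨x', y', h', hB', rfl⟩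
  · rcases h with ⟨h0, hA, rfl⟩ | ⟨x, y, h, hB, rfl⟩
    · exact ⟨A / A', div_ne_zero hA hA', by field_simp, by simp⟩
    · exact absurd rfl h.ne_zero
  · rcases h with ⟨h0, hA, rfl⟩ | ⟨x, y, h, hB, rfl⟩
    · exact absurd h0 h'.ne_zero
    · refine ⟨B / B', div_ne_zero hB hB', ?_, by field_simp⟩
      rw [(h.unique h').1]; field_simp

theorem exists_xRep (P : W.Point) : ∃ A B, XRep P A B := by
  by_cases hP : P = 0
  · exact ⟨1, 0, hP ▸ xRep_zero⟩
  · obtain ⟨x, y, h⟩ := exists_hasCoords hP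
    exact ⟨x, 1, h.xRep⟩

theorem XRep.eq_or_eq_neg {P Q : W.Point} {A B A' B' : K} (h : XRep P A B) (h' : XRep Q A' B')
    (hc : A * B' = A' * B) : P = Q ∨ P = -Q := by
  rcases h with ⟨rfl, hA, rfl⟩ | ⟨x, y, h, hB, rfl⟩ <;>
  rcases h' with ⟨rfl, hA', rfl⟩ | ⟨x', y', h', hB', rfl⟩
  · exact .inl rfl
  · simp [hA, hB'] at hc
  · simp [hA', hB] at hc
  · obtain rfl : x = x' := mul_right_cancel₀ (mul_ne_zero hB hB') (by linear_combination hc)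
    exact h.eq_or_eq_neg h'

variable [WeierstrassCurve.IsShortNF W]

theorem equation_short {x y : K} :
    W.Equation x y ↔ y ^ 2 = x ^ 3 + W.a₄ * x + W.a₆ := by
  rw [Affine.equation_iff, a₁_of_isShortNF, a₂_of_isShortNF, a₃_of_isShortNF]
  constructor <;> intro h <;> linear_combination h

theorem negY_short (x y : K) : W.negY x y = -y := by
  simp [Affine.negY]

theorem HasCoords.equation {P : W.Point} {x y : K} (h : HasCoords P x y) :
    y ^ 2 = x ^ 3 + W.a₄ * x + W.a₆ := by
  obtain ⟨h, rfl⟩ := h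
  exact equation_short.1 h.1

theorem HasCoords.neg {P : W.Point} {x y : K} (h : HasCoords P x y) :
    HasCoords (-P) x (-y) := by
  obtain ⟨h, rfl⟩ := h
  have := (Affine.nonsingular_neg x y).2 h
  rw [negY_short] at this
  refine ⟨this, ?_⟩
  rw [Affine.Point.neg_some]
  simp

theorem XRep.neg {P : W.Point} {A B : K} (h : XRep P A B) : XRep (-P) A B := by
  rcases h with ⟨h0, h⟩ | ⟨x, y, h, h'⟩
  · exact .inl ⟨by simp [h0], h⟩
  · exact .inr ⟨x, -y, h.neg, h'⟩

variable [DecidableEq K]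

theorem HasCoords.add_eq_zero {P Q : W.Point} {x y : K} (h : HasCoords P x y)
    (h' : HasCoords Q x (-y)) : P + Q = 0 := by
  rw [h'.ext h.neg, add_neg_cancel]

/-- The addition law. The two equations for the slope `l` hold both for the chord and for the
tangent, and one of them determines `l` when the sum is affine. -/
theorem HasCoords.add {P Q : W.Point} {x₁ y₁ x₂ y₂ : K} (hP : HasCoords P x₁ y₁)
    (hQ : HasCoords Q x₂ y₂) (hne : ¬(x₁ = x₂ ∧ y₁ = -y₂)) {l : K}
    (h₁ : l * (x₁ - x₂) = y₁ - y₂)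
    (h₂ : l * (y₁ + y₂) = x₁ ^ 2 + x₁ * x₂ + x₂ ^ 2 + W.a₄) :
    HasCoords (P + Q) (l ^ 2 - x₁ - x₂) (l * (x₁ - (l ^ 2 - x₁ - x₂)) - y₁) := by
  obtain ⟨hP, rfl⟩ := hP
  obtain ⟨hQ, rfl⟩ := hQ
  have hxy : ¬(x₁ = x₂ ∧ y₁ = W.negY x₂ y₂) := by rwa [negY_short]
  rw [Affine.Point.add_some hxy]
  have hl : W.slope x₁ x₂ y₁ y₂ = l := by
    by_cases hx : x₁ = x₂
    · have hy : y₁ ≠ W.negY x₂ y₂ := fun h => hxy ⟨hx, h⟩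
      rw [Affine.slope_of_Y_ne hx hy]
      subst hx
      rw [sub_self, mul_zero] at h₁
      have h12 : y₁ = y₂ := (sub_eq_zero.1 h₁.symm)
      subst h12
      rw [negY_short] at hy ⊢
      rw [a₁_of_isShortNF, a₂_of_isShortNF, div_eq_iff (by rwa [sub_ne_zero])]
      linear_combination -h₂
    · rw [Affine.slope_of_X_ne hx, div_eq_iff (sub_ne_zero.2 hx)]
      exact h₁.symm
  have hX : W.addX x₁ x₂ (W.slope x₁ x₂ y₁ y₂) = l ^ 2 - x₁ - x₂ := by
    rw [hl]; simp [Affine.addX]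
  have hY : W.addY x₁ x₂ y₁ (W.slope x₁ x₂ y₁ y₂) = l * (x₁ - (l ^ 2 - x₁ - x₂)) - y₁ := by
    rw [hl, Affine.addY, negY_short, Affine.negAddY]
    simp [Affine.addX]
    ring
  have e : ∀ {x y x' y' : K} (h : W.Nonsingular x y), x = x' → y = y' →
      HasCoords (.some x y h) x' y' := by
    rintro x y _ _ h rfl rfl
    exact ⟨h, rfl⟩
  exact e _ hX hY

theorem HasCoords.exists_slope {P Q : W.Point} {x₁ y₁ x₂ y₂ : K} (hP : HasCoords P x₁ y₁)
    (hQ : HasCoords Q x₂ y₂) (hne : ¬(x₁ = x₂ ∧ y₁ = -y₂)) :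
    ∃ l : K, l * (x₁ - x₂) = y₁ - y₂ ∧
      l * (y₁ + y₂) = x₁ ^ 2 + x₁ * x₂ + x₂ ^ 2 + W.a₄ := by
  have e₁ := hP.equation
  have e₂ := hQ.equation
  by_cases hx : x₁ = x₂
  · subst hx
    have hy : y₁ + y₂ ≠ 0 := fun h => hne ⟨rfl, eq_neg_of_add_eq_zero_left h⟩
    have h12 : y₁ = y₂ := by
      have : (y₁ - y₂) * (y₁ + y₂) = 0 := by linear_combination e₁ - e₂
      exact sub_eq_zero.1 ((mul_eq_zero.1 this).resolve_right hy)
    exact ⟨(x₁ ^ 2 + x₁ * x₁ + x₁ ^ 2 + W.a₄) / (y₁ + y₂), by rw [h12]; ring,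
      div_mul_cancel₀ _ hy⟩
  · have hx' := sub_ne_zero.2 hx
    refine ⟨(y₁ - y₂) / (x₁ - x₂), div_mul_cancel₀ _ hx', ?_⟩
    rw [div_mul_eq_mul_div, div_eq_iff hx']
    linear_combination e₁ - e₂

end Coordinates

section Parallelogram

variable {R : Type*} [CommRing R]

/-- The first of three biquadratic forms, with `addSubSum` and `addSubProd`, that give
`(1 : x(P + Q) + x(P - Q) : x(P + Q) x(P - Q))` in terms of projective coordinates `(A₁ : B₁)`
and `(A₂ : B₂)` of `x(P)` and `x(Q)` on the curve `y² = x³ + ax + b`. -/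
def addSubDen (A₁ B₁ A₂ B₂ : R) : R := (A₁ * B₂ - A₂ * B₁) ^ 2

/-- The coordinate `x(P + Q) + x(P - Q)`, up to the factor `addSubDen`. -/
def addSubSum (a b A₁ B₁ A₂ B₂ : R) : R :=
  2 * ((A₁ * B₂ + A₂ * B₁) * (a * B₁ * B₂ + A₁ * A₂) + 2 * b * B₁ ^ 2 * B₂ ^ 2)

/-- The coordinate `x(P + Q) x(P - Q)`, up to the factor `addSubDen`. -/
def addSubProd (a b A₁ B₁ A₂ B₂ : R) : R :=
  (A₁ * A₂ - a * B₁ * B₂) ^ 2 - 4 * b * B₁ * B₂ * (A₁ * B₂ + A₂ * B₁)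

/-- The three forms have no common zero on `ℙ¹ × ℙ¹`: on the diagonal, a common zero would be a
double root of the cubic. -/
theorem addSub_ne_zero {K : Type*} [Field K] {a b : K} (h2 : (2 : K) ≠ 0)
    (hΔ : 4 * a ^ 3 + 27 * b ^ 2 ≠ 0) {A₁ B₁ A₂ B₂ : K} (h₁ : A₁ ≠ 0 ∨ B₁ ≠ 0)
    (h₂ : A₂ ≠ 0 ∨ B₂ ≠ 0) (hD : addSubDen A₁ B₁ A₂ B₂ = 0)
    (hS : addSubSum a b A₁ B₁ A₂ B₂ = 0) (hP : addSubProd a b A₁ B₁ A₂ B₂ = 0) : False := by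
  have hd : A₁ * B₂ = A₂ * B₁ := by
    rw [addSubDen] at hD
    exact sub_eq_zero.1 (pow_eq_zero_iff two_ne_zero |>.1 hD)
  rw [addSubSum] at hS
  rw [addSubProd] at hP
  have hS := (mul_eq_zero.1 hS).resolve_left h2
  by_cases hB₁ : B₁ = 0
  · subst hB₁
    have hA₁ : A₁ ≠ 0 := by simpa using h₁
    have hB₂ : B₂ = 0 := by simpa [hA₁] using hd
    subst hB₂
    have hA₂ : A₂ ≠ 0 := by simpa using h₂
    simp [hA₁, hA₂] at hP
  · have hB₂ : B₂ ≠ 0 := by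
      rintro rfl
      have hA₂ : A₂ ≠ 0 := by simpa using h₂
      simp [hA₂, hB₁] at hd
    obtain ⟨x, hx⟩ : ∃ x, x = A₁ / B₁ := ⟨_, rfl⟩
    have e₁ : A₁ = x * B₁ := by rw [hx]; field_simp
    have e₂ : A₂ = x * B₂ := by
      rw [e₁] at hd
      exact mul_right_cancel₀ hB₁ (by linear_combination -hd)
    subst e₁
    subst e₂
    have hB : (B₁ * B₂) ^ 2 ≠ 0 := pow_ne_zero _ (mul_ne_zero hB₁ hB₂)
    have f0 : x ^ 3 + a * x + b = 0 := by
      have : (2 * (B₁ * B₂) ^ 2) * (x ^ 3 + a * x + b) = 0 := by linear_combination hS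
      exact (mul_eq_zero.1 this).resolve_left (mul_ne_zero h2 hB)
    have f1 : (3 * x ^ 2 + a) ^ 2 = 0 := by
      have : (B₁ * B₂) ^ 2 * (3 * x ^ 2 + a) ^ 2 = 0 := by
        linear_combination hP + 8 * x * (B₁ * B₂) ^ 2 * f0
      exact (mul_eq_zero.1 this).resolve_left hB
    have f1 : 3 * x ^ 2 + a = 0 := pow_eq_zero_iff two_ne_zero |>.1 f1
    apply hΔ
    linear_combination (27 * b - 27 * a * x - 27 * x ^ 3) * f0 +
      (9 * x ^ 4 + 15 * a * x ^ 2 + 4 * a ^ 2) * f1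

theorem symm_prod_ne_zero {K : Type*} [Field K] {A₁ B₁ A₂ B₂ : K} (h₁ : A₁ ≠ 0 ∨ B₁ ≠ 0)
    (h₂ : A₂ ≠ 0 ∨ B₂ ≠ 0) (hD : B₁ * B₂ = 0) (hS : A₁ * B₂ + A₂ * B₁ = 0) (hP : A₁ * A₂ = 0) :
    False := by
  rcases mul_eq_zero.1 hD with rfl | rfl
  · have := h₁.resolve_right (by simp)
    obtain rfl : A₂ = 0 := by simpa [this] using hP
    obtain rfl : B₂ = 0 := by simpa [this] using hS
    simp at h₂
  · have := h₂.resolve_right (by simp)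
    obtain rfl : A₁ = 0 := by simpa [this] using hP
    obtain rfl : B₁ = 0 := by simpa [this] using hS
    simp at h₁

variable {K : Type*} [Field K] {W : WeierstrassCurve.Affine K}
  [WeierstrassCurve.IsShortNF W]

theorem discr_ne_zero (hΔ : WeierstrassCurve.Δ W ≠ 0) :
    4 * W.a₄ ^ 3 + 27 * W.a₆ ^ 2 ≠ 0 ∧ (2 : K) ≠ 0 := by
  rw [Δ_of_isShortNF] at hΔ
  refine ⟨right_ne_zero_of_mul hΔ, fun h => left_ne_zero_of_mul hΔ ?_⟩
  linear_combination (-8) * h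

variable [DecidableEq K]

/-- `x(P + Q)` and `x(P - Q)` are the roots of a quadratic polynomial whose coefficients depend
only on `x(P)` and `x(Q)`; in projective form this holds without exception. -/
theorem xRep_add_sub (h2 : (2 : K) ≠ 0) {P Q : W.Point} {A₁ B₁ A₂ B₂ A₃ B₃ A₄ B₄ : K}
    (h₁ : XRep P A₁ B₁) (h₂ : XRep Q A₂ B₂) (h₃ : XRep (P + Q) A₃ B₃)
    (h₄ : XRep (P - Q) A₄ B₄) :
    ∃ c : K, c ≠ 0 ∧ addSubDen A₁ B₁ A₂ B₂ = c * (B₃ * B₄) ∧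
      addSubSum W.a₄ W.a₆ A₁ B₁ A₂ B₂ = c * (A₃ * B₄ + A₄ * B₃) ∧
      addSubProd W.a₄ W.a₆ A₁ B₁ A₂ B₂ = c * (A₃ * A₄) := by
  simp only [addSubDen, addSubSum, addSubProd]
  -- It suffices to treat one choice of the projective coordinates.
  suffices H : ∃ A₁' B₁' A₂' B₂' A₃' B₃' A₄' B₄' : K, XRep P A₁' B₁' ∧ XRep Q A₂' B₂' ∧
      XRep (P + Q) A₃' B₃' ∧ XRep (P - Q) A₄' B₄' ∧ ∃ c : K, c ≠ 0 ∧
      (A₁' * B₂' - A₂' * B₁') ^ 2 = c * (B₃' * B₄') ∧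
      2 * ((A₁' * B₂' + A₂' * B₁') * (W.a₄ * B₁' * B₂' + A₁' * A₂') +
        2 * W.a₆ * B₁' ^ 2 * B₂' ^ 2) = c * (A₃' * B₄' + A₄' * B₃') ∧
      (A₁' * A₂' - W.a₄ * B₁' * B₂') ^ 2 - 4 * W.a₆ * B₁' * B₂' * (A₁' * B₂' + A₂' * B₁') =
        c * (A₃' * A₄') by
    obtain ⟨A₁', B₁', A₂', B₂', A₃', B₃', A₄', B₄', h₁', h₂', h₃', h₄', c, hc, e₁, e₂, e₃⟩ := H
    obtain ⟨c₁, hc₁, rfl, rfl⟩ := h₁.exists_scalar h₁'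
    obtain ⟨c₂, hc₂, rfl, rfl⟩ := h₂.exists_scalar h₂'
    obtain ⟨c₃, hc₃, rfl, rfl⟩ := h₃'.exists_scalar h₃
    obtain ⟨c₄, hc₄, rfl, rfl⟩ := h₄'.exists_scalar h₄
    refine ⟨c₁ ^ 2 * c₂ ^ 2 * c * c₃ * c₄, by simp [hc, hc₁, hc₂, hc₃, hc₄], ?_, ?_, ?_⟩
    · linear_combination c₁ ^ 2 * c₂ ^ 2 * e₁
    · linear_combination c₁ ^ 2 * c₂ ^ 2 * e₂
    · linear_combination c₁ ^ 2 * c₂ ^ 2 * e₃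
  by_cases hP : P = 0
  · subst hP
    refine ⟨1, 0, A₂, B₂, A₂, B₂, A₂, B₂, xRep_zero, h₂, by rwa [zero_add],
      by rw [zero_sub]; exact h₂.neg, 1, one_ne_zero, by ring, by ring, by ring⟩
  by_cases hQ : Q = 0
  · subst hQ
    refine ⟨A₁, B₁, 1, 0, A₁, B₁, A₁, B₁, h₁, xRep_zero, by rwa [add_zero],
      by rwa [sub_zero], 1, one_ne_zero, by ring, by ring, by ring⟩
  obtain ⟨x₁, y₁, hP⟩ := exists_hasCoords hP
  obtain ⟨x₂, y₂, hQ⟩ := exists_hasCoords hQ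
  have e₁ := hP.equation
  have e₂ := hQ.equation
  by_cases hx : x₁ = x₂
  · -- the sum or the difference vanishes; by symmetry, the difference
    subst hx
    have key : ∀ {x y A B : K} {R : W.Point}, HasCoords R x y → XRep (R + R) A B →
        ∃ c : K, c ≠ 0 ∧ 2 * (x + x) * (W.a₄ + x * x) + 4 * W.a₆ = c * B ∧
          (x * x - W.a₄) ^ 2 - 4 * W.a₆ * (x + x) = c * A := by
      intro x y A B R hR h
      have e := hR.equation
      by_cases hy : y = 0
      · have h0 : R + R = 0 := hR.add_eq_zero (by simpa [hy] using hR)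
        rw [h0] at h
        rcases h with ⟨_, hA, rfl⟩ | ⟨_, _, h, _⟩
        swap; · exact absurd rfl h.ne_zero
        have hns := hR
        obtain ⟨hns, -⟩ := hns
        rw [Affine.nonsingular_iff, a₁_of_isShortNF, a₂_of_isShortNF, a₃_of_isShortNF] at hns
        have hx0 : 3 * x ^ 2 + W.a₄ ≠ 0 := by
          rcases hns.2 with h | h
          · intro h'; apply h; linear_combination -h'
          · simp [hy] at h
        have hf : x ^ 3 + W.a₄ * x + W.a₆ = 0 := by rw [← e, hy]; ring
        have : (x * x - W.a₄) ^ 2 - 4 * W.a₆ * (x + x) = (3 * x ^ 2 + W.a₄) ^ 2 := by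
          linear_combination (-8 * x) * hf
        refine ⟨(3 * x ^ 2 + W.a₄) ^ 2 / A, div_ne_zero (pow_ne_zero _ hx0) hA, ?_, ?_⟩
        · linear_combination 4 * hf
        · rw [this]; field_simp
      · have h2y : 2 * y ≠ 0 := mul_ne_zero h2 hy
        have hadd := hR.add hR (l := (3 * x ^ 2 + W.a₄) / (2 * y))
          (fun h => h2y (by linear_combination h.2)) (by ring) (by field_simp; ring)
        rcases h with ⟨h, _⟩ | ⟨x', y', h, hB, rfl⟩
        · exact absurd h hadd.ne_zero
        obtain ⟨rfl, -⟩ := h.unique hadd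
        refine ⟨(2 * y) ^ 2 / B, div_ne_zero (pow_ne_zero _ h2y) hB, ?_, ?_⟩
        · field_simp
          linear_combination (-4) * e
        · field_simp
          linear_combination (8 * x) * e
    rcases hP.eq_or_eq_neg hQ with rfl | rfl
    · rw [sub_self] at h₄
      obtain ⟨c, hc, h, h'⟩ := key hP h₃
      refine ⟨_, _, _, _, _, _, _, _, hP.xRep, hP.xRep, h₃, by rw [sub_self]; exact xRep_zero, c,
        hc, by ring, ?_, ?_⟩
      · linear_combination h
      · linear_combination h'
    · rw [sub_eq_add_neg] at h₄
      obtain ⟨c, hc, h, h'⟩ := key hP h₄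
      refine ⟨_, _, _, _, _, _, _, _, hP.xRep, hQ.xRep, by rw [neg_add_cancel]; exact xRep_zero,
        by rwa [sub_eq_add_neg], c, hc, by ring, ?_, ?_⟩
      · linear_combination h
      · linear_combination h'
  · have hx' := sub_ne_zero.2 hx
    have h3 := hP.add hQ (l := (y₁ - y₂) / (x₁ - x₂)) (fun h => hx h.1) (by field_simp)
      (by field_simp; linear_combination e₁ - e₂)
    have h4 := hP.add hQ.neg (l := (y₁ + y₂) / (x₁ - x₂)) (fun h => hx h.1)
      (by field_simp; ring) (by field_simp; linear_combination e₁ - e₂)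
    rw [← sub_eq_add_neg] at h4
    refine ⟨_, _, _, _, _, _, _, _, hP.xRep, hQ.xRep, h3.xRep, h4.xRep, (x₁ - x₂) ^ 2,
      pow_ne_zero _ hx', by ring, ?_, ?_⟩
    · field_simp
      linear_combination (-2) * e₁ - 2 * e₂
    · field_simp
      linear_combination (-(y₁ ^ 2 - y₂ ^ 2 + x₁ ^ 3 + W.a₄ * x₁ - x₂ ^ 3 - W.a₄ * x₂) +
        2 * (x₁ + x₂) * (x₁ - x₂) ^ 2) * e₁ +
        ((y₁ ^ 2 - y₂ ^ 2 + x₁ ^ 3 + W.a₄ * x₁ - x₂ ^ 3 - W.a₄ * x₂) +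
        2 * (x₁ + x₂) * (x₁ - x₂) ^ 2) * e₂

end Parallelogram

end ShortWeierstrass

/-! ### Reduction of points modulo a valuation -/

namespace ShortWeierstrass

open WeierstrassCurve

section ReducesTo

variable {L : Type*} [Field L] {O : ValuationSubring L}

/-- `x` belongs to the valuation ring `O`, and its residue class is `ξ`. -/
def ReducesTo (O : ValuationSubring L) (x : L) (ξ : IsLocalRing.ResidueField O) : Prop :=
  ∃ h : x ∈ O, IsLocalRing.residue O ⟨x, h⟩ = ξ

theorem exists_reducesTo {x : L} (h : x ∈ O) : ∃ ξ, ReducesTo O x ξ := ⟨_, h, rfl⟩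

namespace ReducesTo

variable {x y : L} {ξ η : IsLocalRing.ResidueField O}

theorem unique (h : ReducesTo O x ξ) (h' : ReducesTo O x η) : ξ = η := by
  obtain ⟨h, rfl⟩ := h
  obtain ⟨h', rfl⟩ := h'
  rfl

theorem add (h : ReducesTo O x ξ) (h' : ReducesTo O y η) : ReducesTo O (x + y) (ξ + η) := by
  obtain ⟨h, rfl⟩ := h
  obtain ⟨h', rfl⟩ := h'
  exact ⟨add_mem h h', map_add _ (⟨x, h⟩ : O) ⟨y, h'⟩⟩

theorem sub (h : ReducesTo O x ξ) (h' : ReducesTo O y η) : ReducesTo O (x - y) (ξ - η) := by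
  obtain ⟨h, rfl⟩ := h
  obtain ⟨h', rfl⟩ := h'
  exact ⟨sub_mem h h', map_sub _ (⟨x, h⟩ : O) ⟨y, h'⟩⟩

theorem neg (h : ReducesTo O x ξ) : ReducesTo O (-x) (-ξ) := by
  obtain ⟨h, rfl⟩ := h
  exact ⟨neg_mem h, map_neg _ (⟨x, h⟩ : O)⟩

theorem mul (h : ReducesTo O x ξ) (h' : ReducesTo O y η) : ReducesTo O (x * y) (ξ * η) := by
  obtain ⟨h, rfl⟩ := h
  obtain ⟨h', rfl⟩ := h'
  exact ⟨mul_mem h h', map_mul _ (⟨x, h⟩ : O) ⟨y, h'⟩⟩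

theorem pow (h : ReducesTo O x ξ) (n : ℕ) : ReducesTo O (x ^ n) (ξ ^ n) := by
  obtain ⟨h, rfl⟩ := h
  exact ⟨pow_mem h n, map_pow _ (⟨x, h⟩ : O) n⟩

theorem intCast (n : ℤ) : ReducesTo O (n : L) (n : IsLocalRing.ResidueField O) :=
  ⟨by simp, by rw [← map_intCast (IsLocalRing.residue O)]; congr⟩

theorem natCast (n : ℕ) : ReducesTo O (n : L) (n : IsLocalRing.ResidueField O) := by
  simpa using intCast (O := O) (n : ℤ)

theorem zero : ReducesTo O 0 0 := by simpa using intCast (O := O) 0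

theorem one : ReducesTo O 1 1 := by simpa using intCast (O := O) 1

theorem ofNat (n : ℕ) [n.AtLeastTwo] :
    ReducesTo O (OfNat.ofNat n : L) (OfNat.ofNat n : IsLocalRing.ResidueField O) := by
  simpa using natCast (O := O) (OfNat.ofNat n)

theorem ne_zero (h : ReducesTo O x ξ) (hξ : ξ ≠ 0) : x ≠ 0 := by
  rintro rfl
  exact hξ (h.unique zero)

theorem inv (h : ReducesTo O x ξ) (hξ : ξ ≠ 0) : ReducesTo O x⁻¹ ξ⁻¹ := by
  have hx := h.ne_zero hξ
  obtain ⟨h, rfl⟩ := h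
  have hu : IsUnit (⟨x, h⟩ : O) := by
    by_contra hu
    exact hξ ((IsLocalRing.residue_eq_zero_iff _).2 ((IsLocalRing.mem_maximalIdeal _).2 hu))
  obtain ⟨⟨z, hz⟩, hz'⟩ := hu.exists_right_inv
  have hz'' : x * z = 1 := congrArg Subtype.val hz'
  obtain rfl : z = x⁻¹ := eq_inv_of_mul_eq_one_right hz''
  refine ⟨hz, eq_inv_of_mul_eq_one_right ?_⟩
  rw [← map_mul, hz', map_one]

theorem div (h : ReducesTo O x ξ) (h' : ReducesTo O y η) (hη : η ≠ 0) :
    ReducesTo O (x / y) (ξ / η) := by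
  rw [div_eq_mul_inv, div_eq_mul_inv]
  exact h.mul (h'.inv hη)

theorem inv_of_notMem (h : x ∉ O) : ReducesTo O x⁻¹ 0 := by
  have h' : x⁻¹ ∈ O := (O.mem_or_inv_mem x).resolve_left h
  obtain ⟨ξ, hξ⟩ := exists_reducesTo h'
  by_cases h0 : ξ = 0
  · rwa [h0] at hξ
  · have := hξ.inv h0
    rw [inv_inv] at this
    exact absurd this.1 h

theorem inv_notMem (h : ReducesTo O x 0) (hx : x ≠ 0) : x⁻¹ ∉ O := by
  intro h'
  obtain ⟨ξ, hξ⟩ := exists_reducesTo h'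
  have := h.mul hξ
  rw [mul_inv_cancel₀ hx, zero_mul] at this
  exact one_ne_zero (one.unique this)

theorem exists_of_pow {n : ℕ} (hn : n ≠ 0) (h : ReducesTo O (x ^ n) ξ) :
    ∃ η, ReducesTo O x η ∧ η ^ n = ξ := by
  have hx : x ∈ O := by
    by_contra hx
    have h' := (inv_of_notMem hx).pow n
    rw [zero_pow hn, inv_pow] at h'
    have hx0 : x ≠ 0 := by rintro rfl; exact hx O.zero_mem
    apply h'.inv_notMem (inv_ne_zero (pow_ne_zero _ hx0))
    rw [inv_inv]
    exact h.1
  obtain ⟨η, hη⟩ := exists_reducesTo hx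
  exact ⟨η, hη, (hη.pow n).unique h⟩

end ReducesTo

end ReducesTo

section Reduction

variable (S : WeierstrassCurve ℤ)

/-- The base change to the field `L` of a Weierstrass curve with integer coefficients. -/
abbrev curve (L : Type*) [Field L] : WeierstrassCurve L := S.baseChange L

/-- The group of points, with coordinates in `L`, of a Weierstrass curve with integer
coefficients. -/
abbrev Points (L : Type*) [Field L] : Type _ := (curve S L).toAffine.Point

instance [S.IsShortNF] (L : Type*) [Field L] : (curve S L).IsShortNF :=
  ⟨by simp, by simp, by simp⟩

variable {S} {L : Type*} [Field L] {O : ValuationSubring L}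

open Classical in
/-- The reduction of points modulo the maximal ideal of the valuation ring `O`. Points whose
coordinates do not belong to `O` are sent to the point at infinity. -/
noncomputable def red (O : ValuationSubring L) (P : Points S L) :
    Points S (IsLocalRing.ResidueField O) :=
  if h : ∃ Q : Points S (IsLocalRing.ResidueField O), ∃ x y ξ η, HasCoords P x y ∧
    ReducesTo O x ξ ∧ ReducesTo O y η ∧ HasCoords Q ξ η then h.choose else 0

theorem red_zero : red O (0 : Points S L) = 0 := by
  rw [red, dif_neg]
  rintro ⟨_, x, y, _, _, h, -⟩
  exact h.ne_zero rfl

theorem red_eq_zero_of_notMem {P : Points S L} {x y : L} (hP : HasCoords P x y) (hx : x ∉ O) :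
    red O P = 0 := by
  rw [red, dif_neg]
  rintro ⟨_, x', y', _, _, h, h', -⟩
  rw [(h.unique hP).1] at h'
  exact hx h'.1

theorem reducesTo_a₄ : ReducesTo O (curve S L).a₄
    (curve S (IsLocalRing.ResidueField O)).a₄ := by
  simpa using ReducesTo.intCast (O := O) S.a₄

theorem reducesTo_a₆ : ReducesTo O (curve S L).a₆
    (curve S (IsLocalRing.ResidueField O)).a₆ := by
  simpa using ReducesTo.intCast (O := O) S.a₆

variable [S.IsShortNF] (hΔ : (curve S (IsLocalRing.ResidueField O)).Δ ≠ 0)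
include hΔ

theorem hasCoords_red {P : Points S L} {x y : L} {ξ : IsLocalRing.ResidueField O}
    (hP : HasCoords P x y) (hx : ReducesTo O x ξ) :
    ∃ η, ReducesTo O y η ∧ HasCoords (red O P) ξ η := by
  have hy2 := ((hx.pow 3).add ((reducesTo_a₄ (S := S)).mul hx)).add
    (reducesTo_a₆ (S := S))
  rw [← hP.equation] at hy2
  obtain ⟨η, hη, e⟩ := ReducesTo.exists_of_pow two_ne_zero hy2
  obtain ⟨Q, hQ⟩ := exists_point_of_equation (W := curve S _) hΔ
    ((equation_short (W := curve S _)).2 e)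
  refine ⟨η, hη, ?_⟩
  have H : ∃ Q : Points S (IsLocalRing.ResidueField O), ∃ x y ξ η, HasCoords P x y ∧
    ReducesTo O x ξ ∧ ReducesTo O y η ∧ HasCoords Q ξ η := ⟨Q, x, y, ξ, η, hP, hx, hη, hQ⟩
  obtain ⟨x', y', ξ', η', h₁, h₂, h₃, h₄⟩ := H.choose_spec
  obtain ⟨rfl, rfl⟩ := h₁.unique hP
  rw [red, dif_pos H, hx.unique h₂, hη.unique h₃]
  exact h₄

theorem red_neg (P : Points S L) : red O (-P) = -red O P := by
  by_cases hP : P = 0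
  · rw [hP, Affine.Point.neg_zero, red_zero, Affine.Point.neg_zero]
  obtain ⟨x, y, hP⟩ := exists_hasCoords hP
  by_cases hx : x ∈ O
  · obtain ⟨ξ, hξ⟩ := exists_reducesTo hx
    obtain ⟨η, hη, h⟩ := hasCoords_red hΔ hP hξ
    obtain ⟨η', hη', h'⟩ := hasCoords_red hΔ hP.neg hξ
    obtain rfl := hη'.unique hη.neg
    exact h'.ext h.neg
  · rw [red_eq_zero_of_notMem hP hx, red_eq_zero_of_notMem hP.neg hx, Affine.Point.neg_zero]

/-- Primitive projective coordinates of `x(P)` reduce to projective coordinates of `x(red P)`. -/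
theorem exists_xRep_red (P : Points S L) : ∃ A B α β, XRep P A B ∧ ReducesTo O A α ∧
    ReducesTo O B β ∧ XRep (red O P) α β := by
  by_cases hP : P = 0
  · rw [hP, red_zero]
    exact ⟨1, 0, 1, 0, xRep_zero, .one, .zero, xRep_zero⟩
  obtain ⟨x, y, hP⟩ := exists_hasCoords hP
  by_cases hx : x ∈ O
  · obtain ⟨ξ, hξ⟩ := exists_reducesTo hx
    obtain ⟨η, hη, h⟩ := hasCoords_red hΔ hP hξ
    exact ⟨x, 1, ξ, 1, hP.xRep, hξ, .one, h.xRep⟩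
  · rw [red_eq_zero_of_notMem hP hx]
    have hx0 : x ≠ 0 := by rintro rfl; exact hx O.zero_mem
    refine ⟨1, x⁻¹, 1, 0, ?_, .one, .inv_of_notMem hx, xRep_zero⟩
    simpa [hx0] using hP.xRep.smul (inv_ne_zero hx0)

theorem exists_coords_of_red_ne_zero {P : Points S L} (h : red O P ≠ 0) :
    ∃ x y ξ η, HasCoords P x y ∧ ReducesTo O x ξ ∧ ReducesTo O y η ∧
      HasCoords (red O P) ξ η := by
  have hP : P ≠ 0 := by rintro rfl; exact h red_zero
  obtain ⟨x, y, hP⟩ := exists_hasCoords hP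
  have hx : x ∈ O := by
    by_contra hx
    exact h (red_eq_zero_of_notMem hP hx)
  obtain ⟨ξ, hξ⟩ := exists_reducesTo hx
  obtain ⟨η, hη, h⟩ := hasCoords_red hΔ hP hξ
  exact ⟨x, y, ξ, η, hP, hξ, hη, h⟩

variable [DecidableEq L] [DecidableEq (IsLocalRing.ResidueField O)]

theorem red_add_of_ne {P Q : Points S L} (hP : red O P ≠ 0) (hQ : red O Q ≠ 0)
    (h : red O P + red O Q ≠ 0) : red O (P + Q) = red O P + red O Q := by
  obtain ⟨x₁, y₁, ξ₁, η₁, hP, hx₁, hy₁, hP'⟩ := exists_coords_of_red_ne_zero hΔ hP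
  obtain ⟨x₂, y₂, ξ₂, η₂, hQ, hx₂, hy₂, hQ'⟩ := exists_coords_of_red_ne_zero hΔ hQ
  have hne' : ¬(ξ₁ = ξ₂ ∧ η₁ = -η₂) := by
    rintro ⟨rfl, rfl⟩
    exact h (hP'.add_eq_zero (by rwa [neg_neg]))
  have hne : ¬(x₁ = x₂ ∧ y₁ = -y₂) := by
    rintro ⟨rfl, rfl⟩
    exact hne' ⟨hx₁.unique hx₂, hy₁.unique hy₂.neg⟩
  obtain ⟨l, hl₁, hl₂⟩ := hP.exists_slope hQ hne
  -- The slope is integral, one of its two expressions having a unit as denominator.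
  have hsum := (((hx₁.pow 2).add (hx₁.mul hx₂)).add (hx₂.pow 2)).add (reducesTo_a₄ (S := S))
  obtain ⟨m, hm⟩ : ∃ m, ReducesTo O l m := by
    by_cases hξ : ξ₁ = ξ₂
    · have hη : η₁ + η₂ ≠ 0 := fun h => hne' ⟨hξ, eq_neg_of_add_eq_zero_left h⟩
      have := hsum.div (hy₁.add hy₂) hη
      rw [← hl₂, mul_div_cancel_right₀ _ ((hy₁.add hy₂).ne_zero hη)] at this
      exact ⟨_, this⟩
    · have := (hy₁.sub hy₂).div (hx₁.sub hx₂) (sub_ne_zero.2 hξ)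
      rw [← hl₁, mul_div_cancel_right₀ _ ((hx₁.sub hx₂).ne_zero (sub_ne_zero.2 hξ))] at this
      exact ⟨_, this⟩
  have e := hP.add hQ hne hl₁ hl₂
  have e' := hP'.add hQ' hne' (l := m)
    ((by simpa [hl₁] using hm.mul (hx₁.sub hx₂) : ReducesTo O (y₁ - y₂) _).unique (hy₁.sub hy₂))
    ((by simpa only [hl₂] using hm.mul (hy₁.add hy₂) : ReducesTo O (x₁ ^ 2 + _ + _ + _) _).unique
      hsum)
  have hx₃ := ((hm.pow 2).sub hx₁).sub hx₂
  obtain ⟨η, hη, h⟩ := hasCoords_red hΔ e hx₃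
  obtain rfl := hη.unique ((hm.mul (hx₁.sub hx₃)).sub hy₁)
  exact h.ext e'

/-- The reduction of `P + Q` agrees up to sign with the sum or the difference of the reductions,
by reduction of the biquadratic forms of `xRep_add_sub`. -/
theorem red_add_eq_or (P Q : Points S L) :
    (red O (P + Q) = red O P + red O Q ∨ red O (P + Q) = -(red O P + red O Q)) ∨
      (red O (P + Q) = red O P - red O Q ∨ red O (P + Q) = -(red O P - red O Q)) := by
  obtain ⟨hd, h2⟩ := discr_ne_zero (W := curve S (IsLocalRing.ResidueField O)) hΔ
  obtain ⟨A₁, B₁, α₁, β₁, h₁, hA₁, hB₁, h₁'⟩ := exists_xRep_red hΔ P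
  obtain ⟨A₂, B₂, α₂, β₂, h₂, hA₂, hB₂, h₂'⟩ := exists_xRep_red hΔ Q
  obtain ⟨A₃, B₃, α₃, β₃, h₃, hA₃, hB₃, h₃'⟩ := exists_xRep_red hΔ (P + Q)
  obtain ⟨A₄, B₄, α₄, β₄, h₄, hA₄, hB₄, h₄'⟩ := exists_xRep_red hΔ (P - Q)
  obtain ⟨γ₃, δ₃, h₅⟩ := exists_xRep (red O P + red O Q)
  obtain ⟨γ₄, δ₄, h₆⟩ := exists_xRep (red O P - red O Q)
  obtain ⟨c, hc, e₁, e₂, e₃⟩ := xRep_add_sub ((ReducesTo.ofNat 2).ne_zero h2) h₁ h₂ h₃ h₄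
  obtain ⟨c', hc', e₁', e₂', e₃'⟩ := xRep_add_sub h2 h₁' h₂' h₅ h₆
  have hD := ((hA₁.mul hB₂).sub (hA₂.mul hB₁)).pow 2
  have hS := (ReducesTo.ofNat 2).mul ((((hA₁.mul hB₂).add (hA₂.mul hB₁)).mul
    ((((reducesTo_a₄ (S := S)).mul hB₁).mul hB₂).add (hA₁.mul hA₂))).add
    ((((ReducesTo.ofNat 2).mul (reducesTo_a₆ (S := S))).mul (hB₁.pow 2)).mul (hB₂.pow 2)))
  have hP := (((hA₁.mul hA₂).sub (((reducesTo_a₄ (S := S)).mul hB₁).mul hB₂)).pow 2).sub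
    (((((ReducesTo.ofNat 4).mul (reducesTo_a₆ (S := S))).mul hB₁).mul hB₂).mul
      ((hA₁.mul hB₂).add (hA₂.mul hB₁)))
  have gD := hB₃.mul hB₄
  have gS := (hA₃.mul hB₄).add (hA₄.mul hB₃)
  have gP := hA₃.mul hA₄
  rw [← addSubDen, e₁, ← addSubDen] at hD
  rw [← addSubSum, e₂, ← addSubSum] at hS
  rw [← addSubProd, e₃, ← addSubProd] at hP
  -- The scalar `c` is integral, since its multiples by the entries of a primitive triple are.
  obtain ⟨κ, hκ⟩ : ∃ κ, ReducesTo O c κ := by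
    apply exists_reducesTo
    by_contra hcO
    have hi := ReducesTo.inv_of_notMem hcO
    have f₁ := hi.mul hD
    have f₂ := hi.mul hS
    have f₃ := hi.mul hP
    rw [inv_mul_cancel_left₀ hc, zero_mul] at f₁ f₂ f₃
    exact symm_prod_ne_zero h₃'.ne_zero h₄'.ne_zero (gD.unique f₁) (gS.unique f₂) (gP.unique f₃)
  have f₁ := hD.unique (hκ.mul gD)
  have f₂ := hS.unique (hκ.mul gS)
  have f₃ := hP.unique (hκ.mul gP)
  have key : c' * ((α₃ * δ₃ - γ₃ * β₃) * (α₃ * δ₄ - γ₄ * β₃)) = 0 := by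
    linear_combination α₃ ^ 2 * (f₁ - e₁') - α₃ * β₃ * (f₂ - e₂') + β₃ ^ 2 * (f₃ - e₃')
  rcases mul_eq_zero.1 ((mul_eq_zero.1 key).resolve_left hc') with h | h
  · exact .inl (h₃'.eq_or_eq_neg h₅ (sub_eq_zero.1 h))
  · exact .inr (h₃'.eq_or_eq_neg h₆ (sub_eq_zero.1 h))

/-- If the reductions of `P` and `Q` are opposite and not zero, then `P + Q` reduces to `0`: apply
`red_add_of_ne` to `(P + Q) - Q = P` and to `(P + Q) + (P - Q) = 2P`. -/
theorem red_add_of_eq_neg {P Q : Points S L} (hP : red O P ≠ 0) (h : red O P + red O Q = 0) :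
    red O (P + Q) = 0 := by
  by_contra hs
  have hq : red O (-Q) = red O P := by
    rw [red_neg hΔ]; exact (eq_neg_of_add_eq_zero_left h).symm
  have hs' : red O (P + Q) + red O P = 0 := by
    by_contra hne
    have := red_add_of_ne hΔ hs (hq ▸ hP) (hq ▸ hne)
    rw [add_neg_cancel_right, hq, right_eq_add] at this
    exact hs this
  by_cases h2 : red O P + red O P = 0
  · have hpq : red O Q = red O P := add_left_cancel (h.trans h2.symm)
    rcases red_add_eq_or hΔ P Q with (h' | h') | (h' | h') <;>
      · rw [h', hpq] at hs
        simp [h2] at hs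
  · have h₁ := red_add_of_ne hΔ hP (hq ▸ hP) (by rwa [hq])
    rw [hq] at h₁
    have h₂ := red_add_of_ne hΔ hP hP h2
    have h₃ := red_add_of_ne hΔ hs (h₁ ▸ h2) (by rw [h₁, ← add_assoc, hs', zero_add]; exact hP)
    have e : P + Q + (P + -Q) = P + P := by abel
    rw [e, h₁, h₂, ← add_assoc, hs', zero_add] at h₃
    exact hP (by simpa using h₃)

theorem red_add_of_eq_zero {P Q : Points S L} (hP : red O P = 0) : red O (P + Q) = red O Q := by
  by_cases hQ : red O Q = 0
  · rcases red_add_eq_or hΔ P Q with (h' | h') | (h' | h') <;> simp [h', hP, hQ]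
  have hor : red O (P + Q) = red O Q ∨ red O (P + Q) = -red O Q := by
    rcases red_add_eq_or hΔ P Q with (h' | h') | (h' | h') <;> simp [h', hP]
  rcases hor with h | h
  · exact h
  by_cases h2 : red O Q + red O Q = 0
  · rw [h]; exact neg_eq_of_add_eq_zero_left h2
  exfalso
  have h₁ := red_add_of_eq_neg hΔ (P := P + Q) (Q := Q) (by rw [h]; simpa using hQ)
    (by rw [h]; simp)
  have h₂ := red_add_of_ne hΔ hQ hQ h2
  rw [add_assoc] at h₁
  rcases red_add_eq_or hΔ P (Q + Q) with (h' | h') | (h' | h') <;>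
    · rw [h₁, h₂, hP] at h'
      apply h2
      first
        | exact (by simpa using h'.symm)
        | exact neg_eq_zero.1 (by simpa using h'.symm)

theorem red_add (P Q : Points S L) : red O (P + Q) = red O P + red O Q := by
  by_cases hP : red O P = 0
  · rw [red_add_of_eq_zero hΔ hP, hP, zero_add]
  by_cases hQ : red O Q = 0
  · rw [add_comm, red_add_of_eq_zero hΔ hQ, hQ, add_zero]
  by_cases h : red O P + red O Q = 0
  · rw [h, red_add_of_eq_neg hΔ hP h]
  · exact red_add_of_ne hΔ hP hQ h

/-- Reduction modulo the maximal ideal of `O`, as a homomorphism of groups. -/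
noncomputable def redHom : Points S L →+ Points S (IsLocalRing.ResidueField O) where
  toFun := red O
  map_zero' := red_zero
  map_add' := red_add hΔ

theorem redHom_apply (P : Points S L) : redHom hΔ P = red O P := rfl

/-- On the kernel of reduction, the function `u = 1 / x` satisfies `u(nP) ≡ n² u(P)` modulo
`u(P)²`. -/
theorem exists_xRep_nsmul {P : Points S L} {u : L} (hP : XRep P 1 u) (hu : ReducesTo O u 0)
    (hred : red O P = 0) (n : ℕ) :
    ∃ r ∈ O, XRep (n • P) 1 (n ^ 2 * u + u ^ 2 * r) := by
  obtain ⟨hd, h2⟩ := discr_ne_zero (W := curve S (IsLocalRing.ResidueField O)) hΔ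
  suffices H : (∃ r ∈ O, XRep (n • P) 1 (n ^ 2 * u + u ^ 2 * r)) ∧
      ∃ r ∈ O, XRep ((n + 1) • P) 1 ((n + 1 : ℕ) ^ 2 * u + u ^ 2 * r) from H.1
  induction n with
  | zero =>
    refine ⟨⟨0, O.zero_mem, ?_⟩, 0, O.zero_mem, ?_⟩
    · simpa using xRep_zero
    · simpa using hP
  | succ n ih =>
    obtain ⟨⟨r, hr, h⟩, r', hr', h'⟩ := ih
    refine ⟨⟨r', hr', h'⟩, ?_⟩
    have hred' : red O ((n + 1 + 1) • P) = 0 := by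
      rw [← redHom_apply hΔ, map_nsmul, redHom_apply, hred, smul_zero]
    obtain ⟨A, B, α, β, h₁, hA, hB, h₂⟩ := exists_xRep_red hΔ ((n + 1 + 1) • P)
    rw [hred'] at h₂
    rcases h₂ with ⟨-, hα, rfl⟩ | ⟨_, _, h₂, _⟩
    swap; · exact absurd rfl h₂.ne_zero
    have hA0 := hA.ne_zero hα
    have h₁' : XRep ((n + 1 + 1) • P) 1 (A⁻¹ * B) := by
      have := h₁.smul (inv_ne_zero hA0)
      rwa [inv_mul_cancel₀ hA0] at this
    set a := (curve S L).a₄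
    set b := (curve S L).a₆
    have ha : a ∈ O := (reducesTo_a₄ (S := S)).1
    have hb : b ∈ O := (reducesTo_a₆ (S := S)).1
    have huO := hu.1
    have m2 : (2 : L) ∈ O := (ReducesTo.ofNat 2).1
    have m4 : (4 : L) ∈ O := (ReducesTo.ofNat 4).1
    obtain ⟨w, hw, ew⟩ : ∃ w ∈ O, ((n + 1 : ℕ) : L) ^ 2 * u + u ^ 2 * r' = u * w :=
      ⟨(n + 1 : ℕ) ^ 2 + u * r', add_mem (pow_mem (ReducesTo.natCast _).1 _)
        (mul_mem huO hr'), by ring⟩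
    rw [ew] at h'
    obtain ⟨c, hc, e₁, e₂, e₃⟩ := xRep_add_sub ((ReducesTo.ofNat (O := O) 2).ne_zero h2) h' hP
      (A₃ := 1) (B₃ := A⁻¹ * B) (A₄ := 1) (B₄ := n ^ 2 * u + u ^ 2 * r)
      (by rwa [← succ_nsmul]) (by rwa [succ_nsmul, add_sub_cancel_right])
    -- the denominator is `1 + u² d` with `d` integral
    obtain ⟨d, hd, ed⟩ : ∃ d ∈ O, c = 1 + u ^ 2 * d := by
      refine ⟨a ^ 2 * u ^ 2 * w ^ 2 - 2 * a * w - 4 * b * w * (u + u * w), ?_, ?_⟩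
      · apply_rules [add_mem, sub_mem, mul_mem, pow_mem]
      · rw [addSubProd] at e₃
        linear_combination -e₃
    have hdu : ReducesTo O c 1 := by
      have := (ReducesTo.one (O := O)).add ((hu.pow 2).mul (exists_reducesTo hd).choose_spec)
      rw [← ed] at this
      simpa using this
    have hcO : c⁻¹ ∈ O := (hdu.inv one_ne_zero).1
    refine ⟨c⁻¹ * (2 * (1 + w) * (a * u * w) + 4 * b * u ^ 2 * w ^ 2 - 2 * (1 + w) * u * d)
      + 2 * r' - r, ?_, ?_⟩
    · apply_rules [add_mem, sub_mem, mul_mem, pow_mem, one_mem]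
    · convert h₁' using 1
      rw [addSubSum] at e₂
      have : c * (A⁻¹ * B) = c * (2 * (u + u * w) - (n ^ 2 * u + u ^ 2 * r)) + u ^ 2 *
          (2 * (1 + w) * (a * u * w) + 4 * b * u ^ 2 * w ^ 2 - 2 * (1 + w) * u * d) := by
        rw [ed] at e₂ ⊢
        linear_combination -e₂
      have h3 : A⁻¹ * B = (2 * (u + u * w) - (n ^ 2 * u + u ^ 2 * r)) + u ^ 2 * (c⁻¹ *
          (2 * (1 + w) * (a * u * w) + 4 * b * u ^ 2 * w ^ 2 - 2 * (1 + w) * u * d)) := by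
        apply mul_left_cancel₀ hc
        rw [this]
        field_simp
      rw [h3]
      push_cast at ew ⊢
      linear_combination 2 * ew

/-- The kernel of reduction has no torsion of order prime to the residue characteristic. -/
theorem eq_zero_of_red_eq_zero {P : Points S L} (hred : red O P = 0) {n : ℕ}
    (hn : (n : IsLocalRing.ResidueField O) ≠ 0) (hnP : n • P = 0) : P = 0 := by
  obtain ⟨A, B, α, β, h₁, hA, hB, h₂⟩ := exists_xRep_red hΔ P
  rw [hred] at h₂
  rcases h₂ with ⟨-, hα, rfl⟩ | ⟨_, _, h₂, _⟩
  swap; · exact absurd rfl h₂.ne_zero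
  have hA0 := hA.ne_zero hα
  have h₁' : XRep P 1 (A⁻¹ * B) := by
    have := h₁.smul (inv_ne_zero hA0)
    rwa [inv_mul_cancel₀ hA0] at this
  have hu : ReducesTo O (A⁻¹ * B) 0 := by simpa using (hA.inv hα).mul hB
  obtain ⟨r, hr, h⟩ := exists_xRep_nsmul hΔ h₁' hu hred n
  rw [hnP] at h
  rcases h with ⟨-, -, h⟩ | ⟨_, _, h, _⟩
  swap; · exact absurd rfl h.ne_zero
  have hne : (n : L) ^ 2 + A⁻¹ * B * r ≠ 0 := by
    refine ReducesTo.ne_zero (ξ := (n : IsLocalRing.ResidueField O) ^ 2) ?_ (pow_ne_zero _ hn)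
    simpa using ((ReducesTo.natCast (O := O) n).pow 2).add
      (hu.mul (exists_reducesTo hr).choose_spec)
  have h0 : A⁻¹ * B = 0 := by
    have : (A⁻¹ * B) * ((n : L) ^ 2 + A⁻¹ * B * r) = 0 := by linear_combination h
    exact (mul_eq_zero.1 this).resolve_right hne
  rcases h₁' with ⟨h, -⟩ | ⟨_, _, _, h, _⟩
  · exact h
  · exact absurd h0 h

end Reduction

end ShortWeierstrass

/-! ### The invariant differential -/

namespace ShortWeierstrass

open WeierstrassCurve

section InvariantDifferential

variable {F : Type*} [Field F]

/-- The identities behind the additivity of the invariant differential along a chord: `m` is the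
slope, `d` denotes derivatives and `l` is the twisting factor. -/
theorem chord_differential {a l dl X₁ X₂ U₁ U₂ c₁ c₂ dU₁ dU₂ m dm : F} (hX : X₁ - X₂ ≠ 0)
    (e₁ : m * (X₁ - X₂) = U₁ - U₂)
    (e₂ : l * m * (U₁ + U₂) = X₁ ^ 2 + X₁ * X₂ + X₂ ^ 2 + a)
    (h₁ : 2 * l * dU₁ + dl * U₁ = (3 * X₁ ^ 2 + a) * c₁)
    (h₂ : 2 * l * dU₂ + dl * U₂ = (3 * X₂ ^ 2 + a) * c₂)
    (hm : dm * (X₁ - X₂) + m * (c₁ * U₁ - c₂ * U₂) = dU₁ - dU₂) {X₃ U₃ dX₃ dU₃ : F}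
    (hX₃ : X₃ = l * m ^ 2 - X₁ - X₂) (hU₃ : U₃ = m * (X₁ - X₃) - U₁)
    (hdX₃ : dX₃ = dl * m ^ 2 + 2 * l * m * dm - c₁ * U₁ - c₂ * U₂)
    (hdU₃ : dU₃ = dm * (X₁ - X₃) + m * (c₁ * U₁ - dX₃) - dU₁) :
    dX₃ = (c₁ + c₂) * U₃ ∧ 2 * l * dU₃ + dl * U₃ = (3 * X₃ ^ 2 + a) * (c₁ + c₂) := by
  have R₁ : 3 * X₁ ^ 2 + a - 2 * l * m * U₁ = (X₁ - X₂) * (X₁ - X₃) := by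
    rw [hX₃]; linear_combination (-1) * e₂ + l * m * e₁
  have R₂ : 3 * X₂ ^ 2 + a - 2 * l * m * U₂ = -(X₁ - X₂) * (X₂ - X₃) := by
    rw [hX₃]; linear_combination (-1) * e₂ - l * m * e₁
  have R₃ : 3 * X₃ ^ 2 + a + 2 * l * m * U₃ = (X₃ - X₁) * (X₃ - X₂) := by
    rw [hU₃, hX₃]; linear_combination (-1) * e₂ + l * m * e₁
  have hm' : 2 * l * dm * (X₁ - X₂) = (3 * X₁ ^ 2 + a) * c₁ - (3 * X₂ ^ 2 + a) * c₂ -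
      dl * (U₁ - U₂) - 2 * l * m * (c₁ * U₁ - c₂ * U₂) := by
    linear_combination 2 * l * hm + h₁ - h₂
  have hU₃' : U₃ = m * (X₂ - X₃) - U₂ := by rw [hU₃]; linear_combination e₁
  have g₁ : dX₃ = (c₁ + c₂) * U₃ := by
    apply mul_left_cancel₀ hX
    rw [hdX₃]
    linear_combination m * hm' - (X₁ - X₂) * c₁ * hU₃ - (X₁ - X₂) * c₂ * hU₃' +
      m * c₁ * R₁ - m * c₂ * R₂ + dl * m * e₁
  refine ⟨g₁, ?_⟩
  apply mul_left_cancel₀ hX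
  rw [hdU₃, g₁]
  linear_combination (X₁ - X₃) * hm' - (X₁ - X₂) * h₁ + (X₂ - X₃) * c₁ * R₁ -
    (X₁ - X₂) * (c₁ + c₂) * R₃ + (X₁ - X₂) * dl * hU₃ - (X₁ - X₃) * c₂ * R₂ + dl * (X₁ - X₃) * e₁

/-- The same identities along a tangent. -/
theorem tangent_differential {a l dl X U c dU m dm : F} (hU : U ≠ 0)
    (e : l * m * (U + U) = X ^ 2 + X * X + X ^ 2 + a)
    (h : 2 * l * dU + dl * U = (3 * X ^ 2 + a) * c)
    (hm : (dl * m + l * dm) * (U + U) + l * m * (dU + dU) = 6 * X * (c * U)) {X₃ U₃ dX₃ dU₃ : F}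
    (hX₃ : X₃ = l * m ^ 2 - X - X) (hU₃ : U₃ = m * (X - X₃) - U)
    (hdX₃ : dX₃ = dl * m ^ 2 + 2 * l * m * dm - c * U - c * U)
    (hdU₃ : dU₃ = dm * (X - X₃) + m * (c * U - dX₃) - dU) :
    dX₃ = (c + c) * U₃ ∧ 2 * l * dU₃ + dl * U₃ = (3 * X₃ ^ 2 + a) * (c + c) := by
  have R₃ : 3 * X₃ ^ 2 + a + 2 * l * m * U₃ = (X₃ - X) ^ 2 := by
    rw [hU₃, hX₃]; linear_combination (-1) * e
  have g₁ : dX₃ = (c + c) * U₃ := by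
    apply mul_left_cancel₀ hU
    rw [hdX₃, hU₃, hX₃]
    linear_combination m * hm - m ^ 2 * h + m ^ 2 * c * e
  refine ⟨g₁, ?_⟩
  apply mul_left_cancel₀ hU
  rw [hdU₃, g₁]
  linear_combination (X - X₃) * hm - m * (X - X₃) * h + U * dl * hU₃ - U * h -
    3 * c * U * R₃ + c * m * (X - X₃) * e + 2 * U * l * m * c * hU₃

variable {S : WeierstrassCurve ℤ} [S.IsShortNF] {Ω : Type*} [Field Ω]
  (f : F →+* Ω) (D : Derivation ℤ F F) (s : Ω) (l : F)

/-- Let `P` be an `Ω`-point `(X, s U)` with `X, U ∈ F`, where `s² = l ∈ F`. The predicate says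
that the pull-back of the invariant differential `dx / y` along `P`, computed by means of the
derivation `D` of `F`, is `c / s`: that is, `DX = c U`, together with the equation obtained from
this one by differentiating the equation of the curve, which determines `c` when `U = 0`. -/
def HasDifferential (P : Points S Ω) (c : F) : Prop :=
  (P = 0 ∧ c = 0) ∨ ∃ X U : F, HasCoords P (f X) (s * f U) ∧ D X = c * U ∧
    2 * l * D U + D l * U = (3 * X ^ 2 + (S.a₄ : F)) * c

omit [S.IsShortNF] in
theorem curve_a₄ (L : Type*) [Field L] : (curve S L).a₄ = (S.a₄ : L) := by simp

omit [S.IsShortNF] in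
theorem curve_a₆ (L : Type*) [Field L] : (curve S L).a₆ = (S.a₆ : L) := by simp

variable {f D s l}

theorem HasCoords.deriv_ne_zero {P : Points S Ω} {x y : Ω} (h : HasCoords P x y) (hy : y = 0) :
    3 * x ^ 2 + (S.a₄ : Ω) ≠ 0 := by
  obtain ⟨h, -⟩ := h
  rw [Affine.nonsingular_iff, a₁_of_isShortNF, a₂_of_isShortNF, a₃_of_isShortNF, curve_a₄] at h
  rcases h.2 with h | h
  · intro h'; apply h; linear_combination -h'
  · simp [hy] at h

theorem HasDifferential.neg {P : Points S Ω} {c : F} (hP : HasDifferential f D s l P c) :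
    HasDifferential f D s l (-P) (-c) := by
  rcases hP with ⟨rfl, rfl⟩ | ⟨X, U, h, h₁, h₂⟩
  · exact .inl ⟨Affine.Point.neg_zero, neg_zero⟩
  · exact .inr ⟨X, -U, by simpa using h.neg, by rw [h₁]; ring, by
      rw [map_neg]; linear_combination -h₂⟩

theorem HasDifferential.unique (hs : s ≠ 0) {P : Points S Ω} {c c' : F}
    (h : HasDifferential f D s l P c) (h' : HasDifferential f D s l P c') : c = c' := by
  rcases h with ⟨rfl, rfl⟩ | ⟨X, U, h, h₁, h₂⟩ <;>
  rcases h' with ⟨h', rfl⟩ | ⟨X', U', h', h₁', h₂'⟩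
  · rfl
  · exact absurd rfl h'.ne_zero
  · exact absurd h' h.ne_zero
  · obtain ⟨e₁, e₂⟩ := h.unique h'
    obtain rfl := f.injective e₁
    obtain rfl := f.injective (mul_left_cancel₀ hs e₂)
    by_cases hU : U = 0
    · have := h.deriv_ne_zero (by simp [hU])
      have h0 : 3 * X ^ 2 + (S.a₄ : F) ≠ 0 := fun h => this (by
        simpa only [map_add, map_mul, map_pow, map_intCast, map_ofNat, map_zero] using
          congrArg f h)
      exact mul_left_cancel₀ h0 (h₂.symm.trans h₂')
    · exact mul_right_cancel₀ hU (h₁.symm.trans h₁')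

variable [DecidableEq Ω]

/-- The invariant differential is additive. -/
theorem HasDifferential.add (hs : s ≠ 0) (hl : s ^ 2 = f l) {P Q : Points S Ω} {c₁ c₂ : F}
    (hP : HasDifferential f D s l P c₁) (hQ : HasDifferential f D s l Q c₂) :
    HasDifferential f D s l (P + Q) (c₁ + c₂) := by
  have hl0 : l ≠ 0 := by
    rintro rfl
    exact hs (by simpa using hl)
  by_cases hP0 : P = 0
  · obtain rfl : c₁ = 0 := hP.unique hs (.inl ⟨hP0, rfl⟩)
    rwa [hP0, zero_add, zero_add]
  by_cases hQ0 : Q = 0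
  · obtain rfl : c₂ = 0 := hQ.unique hs (.inl ⟨hQ0, rfl⟩)
    rwa [hQ0, add_zero, add_zero]
  by_cases hPQ : P = -Q
  · have : c₁ = -c₂ := hP.unique hs (hPQ ▸ hQ.neg)
    exact .inl ⟨by rw [hPQ, neg_add_cancel], by rw [this, neg_add_cancel]⟩
  rcases id hP with ⟨h, -⟩ | ⟨X₁, U₁, p, p₁, p₂⟩
  · exact absurd h hP0
  rcases id hQ with ⟨h, -⟩ | ⟨X₂, U₂, q, q₁, q₂⟩
  · exact absurd h hQ0
  have hne : ¬(f X₁ = f X₂ ∧ s * f U₁ = -(s * f U₂)) := by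
    rintro ⟨h₁, h₂⟩
    rw [h₁, h₂] at p
    exact hPQ (p.ext q.neg)
  have ep := p.equation
  have eq := q.equation
  rw [mul_pow, hl, curve_a₄, curve_a₆] at ep eq
  have ep' : l * U₁ ^ 2 = X₁ ^ 3 + S.a₄ * X₁ + S.a₆ := f.injective (by simpa using ep)
  have eq' : l * U₂ ^ 2 = X₂ ^ 3 + S.a₄ * X₂ + S.a₆ := f.injective (by simpa using eq)
  -- the slope is `s m` with `m ∈ F`
  obtain ⟨m, e₁, e₂⟩ : ∃ m : F, m * (X₁ - X₂) = U₁ - U₂ ∧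
      l * m * (U₁ + U₂) = X₁ ^ 2 + X₁ * X₂ + X₂ ^ 2 + S.a₄ := by
    by_cases hX : X₁ = X₂
    · subst hX
      have hU : U₁ + U₂ ≠ 0 := fun h => hne ⟨rfl, by
        rw [eq_neg_of_add_eq_zero_left h]; simp⟩
      have h12 : U₁ - U₂ = 0 := by
        have : l * (U₁ + U₂) * (U₁ - U₂) = 0 := by linear_combination ep' - eq'
        exact (mul_eq_zero.1 this).resolve_left (mul_ne_zero hl0 hU)
      exact ⟨(X₁ ^ 2 + X₁ * X₁ + X₁ ^ 2 + S.a₄) / (l * (U₁ + U₂)), by rw [h12]; ring,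
        by field_simp⟩
    · have hX' := sub_ne_zero.2 hX
      refine ⟨(U₁ - U₂) / (X₁ - X₂), div_mul_cancel₀ _ hX', ?_⟩
      field_simp
      linear_combination ep' - eq'
  have hadd := p.add q hne (l := s * f m)
    (by have := congrArg f e₁; simp only [map_mul, map_sub] at this; linear_combination s * this)
    (by
      have := congrArg f e₂
      simp only [map_mul, map_add, map_pow, map_intCast, ← hl] at this
      rw [curve_a₄]
      linear_combination this)
  obtain ⟨X₃, hX₃⟩ : ∃ X₃, X₃ = l * m ^ 2 - X₁ - X₂ := ⟨_, rfl⟩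
  obtain ⟨U₃, hU₃⟩ : ∃ U₃, U₃ = m * (X₁ - X₃) - U₁ := ⟨_, rfl⟩
  have eX : (s * f m) ^ 2 - f X₁ - f X₂ = f X₃ := by
    rw [hX₃]; simp only [map_mul, map_sub, map_pow, ← hl]; ring
  rw [eX] at hadd
  have eU : s * f m * (f X₁ - f X₃) - s * f U₁ = s * f U₃ := by
    rw [hU₃]; simp only [map_mul, map_sub]; ring
  rw [eU] at hadd
  have hdX₃ : D X₃ = D l * m ^ 2 + 2 * l * m * D m - c₁ * U₁ - c₂ * U₂ := by
    rw [hX₃, ← p₁, ← q₁]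
    simp only [map_sub, Derivation.leibniz, Derivation.leibniz_pow, smul_eq_mul, nsmul_eq_mul]
    push_cast
    ring
  have hdU₃ : D U₃ = D m * (X₁ - X₃) + m * (c₁ * U₁ - D X₃) - D U₁ := by
    rw [hU₃, ← p₁]
    simp only [map_sub, Derivation.leibniz, smul_eq_mul]
    ring
  have d₁ := congrArg D e₁
  have d₂ := congrArg D e₂
  simp only [map_sub, map_add, Derivation.leibniz, Derivation.leibniz_pow, smul_eq_mul,
    nsmul_eq_mul, Derivation.map_intCast, p₁, q₁] at d₁ d₂
  refine .inr ⟨X₃, U₃, hadd, ?_⟩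
  by_cases hX : X₁ = X₂
  · subst hX
    have h12 : U₁ = U₂ := by
      rw [sub_self, mul_zero] at e₁
      exact sub_eq_zero.1 e₁.symm
    subst h12
    obtain rfl : c₁ = c₂ := (hP.unique hs ((p.ext q) ▸ hQ))
    have hU : U₁ ≠ 0 := by
      rintro rfl
      exact hne ⟨rfl, by simp⟩
    refine tangent_differential hU e₂ p₂ ?_ hX₃ hU₃ hdX₃ hdU₃
    push_cast at d₂
    linear_combination d₂
  · exact chord_differential (sub_ne_zero.2 hX) e₁ e₂ p₂ q₂ (by linear_combination d₁) hX₃ hU₃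
      hdX₃ hdU₃

end InvariantDifferential

end ShortWeierstrass

/-! ### Points over the algebraic closure of `K(t)` and their heights -/

namespace ShortWeierstrass

open WeierstrassCurve Polynomial

section RatFunc

variable (K : Type*) [Field K]

open TrivSqZeroExt in
/-- The homomorphism `p ↦ p + p' ε` to the dual numbers over `K(t)`, extended to `K(t)`. -/
noncomputable def dualHom : RatFunc K →+* TrivSqZeroExt (RatFunc K) (RatFunc K) :=
  IsLocalization.lift (M := nonZeroDivisors K[X])
    (g := { toFun := fun p => inl (algebraMap K[X] (RatFunc K) p) +
              inr (algebraMap K[X] (RatFunc K) (derivative p))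
            map_one' := by simp
            map_zero' := by simp
            map_mul' := fun p q => by
              ext
              · simp only [fst_mul, fst_add, fst_inl, fst_inr, map_mul, add_zero]
              · simp only [snd_mul, snd_add, snd_inl, snd_inr, fst_add, fst_inl, fst_inr,
                  derivative_mul, map_mul, map_add, smul_eq_mul, MulOpposite.smul_eq_mul_unop,
                  MulOpposite.unop_op, zero_add, add_zero]
                ring
            map_add' := fun p q => by
              ext
              · simp only [fst_add, fst_inl, fst_inr, map_add, add_zero]
              · simp only [snd_add, snd_inl, snd_inr, map_add, zero_add] } ) (fun p => by
      rw [isUnit_iff_isUnit_fst]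
      simp)

theorem dualHom_algebraMap (p : K[X]) : dualHom K (algebraMap K[X] (RatFunc K) p) =
    .inl (algebraMap K[X] (RatFunc K) p) +
      .inr (algebraMap K[X] (RatFunc K) (derivative p)) := by
  rw [dualHom, IsLocalization.lift_eq]
  rfl

theorem fst_dualHom (x : RatFunc K) : (dualHom K x).fst = x := by
  have : ((TrivSqZeroExt.fstHom (RatFunc K) (RatFunc K) (RatFunc K)).toRingHom.comp
      (dualHom K)) = RingHom.id _ := by
    apply IsLocalization.ringHom_ext (nonZeroDivisors K[X])
    refine RingHom.ext fun p => ?_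
    change (dualHom K (algebraMap K[X] (RatFunc K) p)).fst = algebraMap K[X] (RatFunc K) p
    rw [dualHom_algebraMap, TrivSqZeroExt.fst_add, TrivSqZeroExt.fst_inl, TrivSqZeroExt.fst_inr,
      add_zero]
  exact congrArg (fun f => f x) this

/-- The derivation given by a section of the projection from the dual numbers. -/
noncomputable def derivationOfSection {F : Type*} [Field F] (d : F →+* TrivSqZeroExt F F)
    (h : ∀ x, (d x).fst = x) : Derivation ℤ F F :=
  Derivation.mk' ((TrivSqZeroExt.sndHom F F).toAddMonoidHom.comp
    d.toAddMonoidHom).toIntLinearMap (fun a b => by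
      change (d (a * b)).snd = a * (d b).snd + b * (d a).snd
      rw [map_mul, TrivSqZeroExt.snd_mul, h, h, smul_eq_mul, MulOpposite.smul_eq_mul_unop,
        MulOpposite.unop_op, mul_comm b])

theorem derivationOfSection_apply {F : Type*} [Field F] (d : F →+* TrivSqZeroExt F F)
    (h : ∀ x, (d x).fst = x) (x : F) : derivationOfSection d h x = (d x).snd := rfl

theorem derivation_one {F : Type*} [Field F] (D : Derivation ℤ F F) : D 1 = 0 :=
  D.map_one_eq_zero

theorem derivation_mul {F : Type*} [Field F] (D : Derivation ℤ F F) (x y : F) :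
    D (x * y) = x * D y + y * D x := D.leibniz x y

theorem derivation_pow {F : Type*} [Field F] (D : Derivation ℤ F F) (x : F) (n : ℕ) :
    D (x ^ n) = n * (x ^ (n - 1) * D x) := by
  rw [D.leibniz_pow, smul_eq_mul, nsmul_eq_mul]

/-- The derivation `d/dt` of `K(t)`. -/
noncomputable def ratDeriv := derivationOfSection (dualHom K) (fst_dualHom K)

variable {K}

theorem ratDeriv_algebraMap (p : K[X]) : ratDeriv K (algebraMap K[X] (RatFunc K) p) =
    algebraMap K[X] (RatFunc K) (derivative p) := by
  rw [ratDeriv, derivationOfSection_apply, dualHom_algebraMap, TrivSqZeroExt.snd_add,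
    TrivSqZeroExt.snd_inl, TrivSqZeroExt.snd_inr, zero_add]

end RatFunc

section TopCoeff

variable {K : Type*} [Field K]

/-- `p` has degree at most `n`, with `n`-th coefficient `a`. -/
def TopCoeff (p : K[X]) (n : ℕ) (a : K) : Prop := p.natDegree ≤ n ∧ p.coeff n = a

namespace TopCoeff

variable {p q : K[X]} {m n : ℕ} {a b : K}

theorem mul (h : TopCoeff p m a) (h' : TopCoeff q n b) : TopCoeff (p * q) (m + n) (a * b) :=
  ⟨natDegree_mul_le_of_le h.1 h'.1, by rw [coeff_mul_add_eq_of_natDegree_le h.1 h'.1, h.2, h'.2]⟩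

theorem add (h : TopCoeff p n a) (h' : TopCoeff q n b) : TopCoeff (p + q) n (a + b) :=
  ⟨natDegree_add_le_of_degree_le h.1 h'.1, by rw [coeff_add, h.2, h'.2]⟩

theorem sub (h : TopCoeff p n a) (h' : TopCoeff q n b) : TopCoeff (p - q) n (a - b) :=
  ⟨natDegree_sub_le_of_le h.1 h'.1 |>.trans (by simp), by rw [coeff_sub, h.2, h'.2]⟩

theorem pow (h : TopCoeff p n a) (k : ℕ) : TopCoeff (p ^ k) (k * n) (a ^ k) :=
  ⟨natDegree_pow_le_of_le k h.1, by rw [coeff_pow_of_natDegree_le h.1, h.2]⟩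

theorem C_mul (c : K) (h : TopCoeff p n a) : TopCoeff (C c * p) n (c * a) :=
  ⟨(natDegree_C_mul_le c p).trans h.1, by rw [coeff_C_mul, h.2]⟩

theorem congr (h : TopCoeff p m a) (hp : p = q) (hm : m = n) (ha : a = b) : TopCoeff q n b :=
  hp ▸ hm ▸ ha ▸ h

section AddSub

variable {A₁ B₁ A₂ B₂ : K[X]} {α₁ β₁ α₂ β₂ : K} (h₁ : TopCoeff A₁ m α₁) (k₁ : TopCoeff B₁ m β₁)
  (h₂ : TopCoeff A₂ n α₂) (k₂ : TopCoeff B₂ n β₂)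
include h₁ k₁ h₂ k₂

theorem addSubDen : TopCoeff (addSubDen A₁ B₁ A₂ B₂) (2 * m + 2 * n) (addSubDen α₁ β₁ α₂ β₂) :=
  (((h₁.mul k₂).sub ((k₁.mul h₂).congr (mul_comm _ _) rfl (mul_comm _ _))).pow 2).congr rfl
    (by ring) rfl

theorem addSubSum (a b : K) : TopCoeff (addSubSum (C a) (C b) A₁ B₁ A₂ B₂) (2 * m + 2 * n)
    (addSubSum a b α₁ β₁ α₂ β₂) := by
  have hk := k₁.mul k₂
  refine TopCoeff.congr (((((h₁.mul k₂).add ((k₁.mul h₂).congr (mul_comm _ _) rfl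
    (mul_comm _ _))).mul ((hk.C_mul a).add (h₁.mul h₂))).add
      (((hk.mul hk).C_mul b).C_mul 2)).C_mul 2) ?_ (by ring) ?_
  · rw [ShortWeierstrass.addSubSum, C_ofNat]; ring
  · rw [ShortWeierstrass.addSubSum]; ring

theorem addSubProd (a b : K) : TopCoeff (addSubProd (C a) (C b) A₁ B₁ A₂ B₂) (2 * m + 2 * n)
    (addSubProd a b α₁ β₁ α₂ β₂) := by
  have hk := k₁.mul k₂
  have h₀ := (h₁.mul h₂).sub (hk.C_mul a)
  refine TopCoeff.congr ((h₀.mul h₀).sub (((hk.mul ((h₁.mul k₂).add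
    ((k₁.mul h₂).congr (mul_comm _ _) rfl (mul_comm _ _)))).C_mul b).C_mul 4)) ?_ (by ring) ?_
  · rw [ShortWeierstrass.addSubProd, C_ofNat]; ring
  · rw [ShortWeierstrass.addSubProd]; ring

end AddSub

theorem le_natDegree (h : TopCoeff p n a) (ha : a ≠ 0) : n ≤ p.natDegree :=
  le_natDegree_of_ne_zero (by rw [h.2]; exact ha)

end TopCoeff

theorem topCoeff_max_ne_zero {A B : K[X]} (h : IsCoprime A B) :
    A.coeff (max A.natDegree B.natDegree) ≠ 0 ∨ B.coeff (max A.natDegree B.natDegree) ≠ 0 := by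
  by_contra! H
  rcases le_total A.natDegree B.natDegree with h' | h'
  · rw [max_eq_right h'] at H
    have hB : B = 0 := leadingCoeff_eq_zero.1 H.2
    rw [hB, natDegree_zero] at h' H
    have hA : A = 0 := by rw [eq_C_of_natDegree_le_zero h', H.1, C_0]
    exact not_isCoprime_zero_zero (hA ▸ hB ▸ h)
  · rw [max_eq_left h'] at H
    have hA : A = 0 := leadingCoeff_eq_zero.1 H.1
    rw [hA, natDegree_zero] at h' H
    have hB : B = 0 := by rw [eq_C_of_natDegree_le_zero h', H.2, C_0]
    exact not_isCoprime_zero_zero (hA ▸ hB ▸ h)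

theorem eval_ne_zero_of_isCoprime {A B : K[X]} (h : IsCoprime A B) (x : K) :
    A.eval x ≠ 0 ∨ B.eval x ≠ 0 := by
  obtain ⟨u, v, e⟩ := h
  by_contra! H
  simpa [H.1, H.2] using congrArg (eval x) e

end TopCoeff

section Triples

variable {K : Type*} [Field K] [IsAlgClosed K]

theorem exists_bezout_of_no_common_root (g : Fin 3 → K[X]) (h : ∀ x, ∃ i, (g i).eval x ≠ 0) :
    ∃ r : Fin 3 → K[X], ∑ i, r i * g i = 1 := by
  have htop : Ideal.span (Set.range g) = ⊤ := by
    by_contra hne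
    obtain ⟨d, hd⟩ := (IsPrincipalIdealRing.principal (Ideal.span (Set.range g))).principal
    obtain ⟨x, hx⟩ : ∃ x, d.IsRoot x := by
      by_cases hd0 : d = 0
      · exact ⟨0, by simp [hd0]⟩
      · refine IsAlgClosed.exists_root d fun hdeg => hne ?_
        rw [hd]
        exact Ideal.span_singleton_eq_top.2 (isUnit_iff_degree_eq_zero.2 hdeg)
    obtain ⟨i, hi⟩ := h x
    have : g i ∈ Ideal.span (Set.range g) := Ideal.subset_span ⟨i, rfl⟩
    rw [hd] at this
    obtain ⟨e, he⟩ := Ideal.mem_span_singleton.1 this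
    exact hi (by rw [he, eval_mul, hx.eq_zero, zero_mul])
  have h1 : (1 : K[X]) ∈ Ideal.span (Set.range g) := htop ▸ Submodule.mem_top
  obtain ⟨r, hr⟩ := (Ideal.mem_span_range_iff_exists_fun).1 h1
  exact ⟨r, hr⟩

/-- Proportional primitive triples of polynomials have the same degree. -/
theorem degree_eq_of_proportional {f g : Fin 3 → K[X]} (hfg : ∀ i j, f i * g j = f j * g i)
    (hf : ∀ x, ∃ i, (f i).eval x ≠ 0) (hg : ∀ x, ∃ i, (g i).eval x ≠ 0) {m n : ℕ}
    {a b : Fin 3 → K} (ha : ∀ i, TopCoeff (f i) m (a i)) (hb : ∀ i, TopCoeff (g i) n (b i))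
    (ha0 : ∃ i, a i ≠ 0) (hb0 : ∃ i, b i ≠ 0) : m = n := by
  have key : ∀ {f g : Fin 3 → K[X]} (_ : ∀ i j, f i * g j = f j * g i)
      (_ : ∀ x, ∃ i, (g i).eval x ≠ 0), ∃ u, ∀ j, f j = u * g j := by
    intro f g hfg hg
    obtain ⟨r, hr⟩ := exists_bezout_of_no_common_root g hg
    refine ⟨∑ i, r i * f i, fun j => ?_⟩
    rw [Finset.sum_mul]
    calc f j = (∑ i, r i * g i) * f j := by rw [hr, one_mul]
      _ = _ := by
        rw [Finset.sum_mul]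
        exact Finset.sum_congr rfl fun i _ => by linear_combination (-r i) * hfg i j
  obtain ⟨u, hu⟩ := key hfg hg
  obtain ⟨v, hv⟩ := key (fun i j => by linear_combination (-1 : K[X]) * hfg i j) hf
  obtain ⟨i, hi⟩ := hg 0
  have hgi : g i ≠ 0 := by rintro h; simp [h] at hi
  have huv : v * u = 1 := by
    apply mul_right_cancel₀ hgi
    rw [one_mul, mul_assoc, ← hu, ← hv]
  have hu0 : u.natDegree = 0 := natDegree_eq_zero_of_isUnit
    (IsUnit.of_mul_eq_one v (by rw [mul_comm]; exact huv))
  have hv0 : v.natDegree = 0 := natDegree_eq_zero_of_isUnit (IsUnit.of_mul_eq_one u huv)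
  apply le_antisymm
  · obtain ⟨i, hi⟩ := ha0
    calc m ≤ (f i).natDegree := (ha i).le_natDegree hi
      _ ≤ u.natDegree + (g i).natDegree := by rw [hu]; exact natDegree_mul_le
      _ ≤ n := by rw [hu0, zero_add]; exact (hb i).1
  · obtain ⟨i, hi⟩ := hb0
    calc n ≤ (g i).natDegree := (hb i).le_natDegree hi
      _ ≤ v.natDegree + (f i).natDegree := by rw [hv]; exact natDegree_mul_le
      _ ≤ m := by rw [hv0, zero_add]; exact (ha i).1

end Triples

section Height

variable (K : Type*) [Field K]

/-- An algebraic closure of the field `K(t)`. -/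
abbrev RatFuncBar : Type _ := AlgebraicClosure (RatFunc K)

/-- The embedding of `K[t]` into an algebraic closure of `K(t)`. -/
noncomputable def polyHom : K[X] →+* RatFuncBar K :=
  (algebraMap (RatFunc K) (RatFuncBar K)).comp (algebraMap K[X] (RatFunc K))

variable {K}

theorem polyHom_injective : Function.Injective (polyHom K) :=
  (algebraMap (RatFunc K) (RatFuncBar K)).injective.comp (IsFractionRing.injective K[X] (RatFunc K))

variable {S : WeierstrassCurve ℤ}

/-- `(A : B)` are coprime polynomials representing the `x`-coordinate of `P`. -/
def CoprimeXRep (P : Points S (RatFuncBar K)) (A B : K[X]) : Prop :=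
  IsCoprime A B ∧ XRep P (polyHom K A) (polyHom K B)

open Classical in
/-- The height of a point whose `x`-coordinate is a rational function: the degree of this rational
function. It is the degree of the corresponding endomorphism of the curve. -/
noncomputable def height (P : Points S (RatFuncBar K)) : ℕ :=
  if h : ∃ AB : K[X] × K[X], CoprimeXRep P AB.1 AB.2 then
    max h.choose.1.natDegree h.choose.2.natDegree else 0

theorem CoprimeXRep.height_eq {P : Points S (RatFuncBar K)} {A B : K[X]}
    (h : CoprimeXRep P A B) : height P = max A.natDegree B.natDegree := by
  have H : ∃ AB : K[X] × K[X], CoprimeXRep P AB.1 AB.2 := ⟨(A, B), h⟩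
  rw [height, dif_pos H]
  obtain ⟨h₁, h₂⟩ := H.choose_spec
  have hc := h₂.cross h.2
  rw [← map_mul, ← map_mul] at hc
  have hc := polyHom_injective hc
  have hA : Associated H.choose.1 A := by
    apply associated_of_dvd_dvd
    · exact h₁.dvd_of_dvd_mul_right ⟨B, hc.symm⟩
    · exact h.1.dvd_of_dvd_mul_right ⟨H.choose.2, hc⟩
  have hB : Associated H.choose.2 B := by
    apply associated_of_dvd_dvd
    · exact h₁.symm.dvd_of_dvd_mul_left ⟨A, by rw [hc, mul_comm]⟩
    · exact h.1.symm.dvd_of_dvd_mul_left ⟨H.choose.1, by rw [← hc, mul_comm]⟩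
  rw [natDegree_eq_of_degree_eq (degree_eq_degree_of_associated hA),
    natDegree_eq_of_degree_eq (degree_eq_degree_of_associated hB)]

variable [S.IsShortNF] [IsAlgClosed K] [DecidableEq (RatFuncBar K)]

/-- The parallelogram law for the height. -/
theorem height_add_add_height_sub (hΔ : (curve S K).Δ ≠ 0) {P Q : Points S (RatFuncBar K)}
    {A₁ B₁ A₂ B₂ A₃ B₃ A₄ B₄ : K[X]} (h₁ : CoprimeXRep P A₁ B₁) (h₂ : CoprimeXRep Q A₂ B₂)
    (h₃ : CoprimeXRep (P + Q) A₃ B₃) (h₄ : CoprimeXRep (P - Q) A₄ B₄) :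
    height (P + Q) + height (P - Q) = 2 * height P + 2 * height Q := by
  obtain ⟨hd, h2⟩ := discr_ne_zero (W := curve S K) hΔ
  rw [curve_a₄, curve_a₆] at hd
  have h2' : (2 : RatFuncBar K) ≠ 0 := by
    rw [← map_ofNat (polyHom K) 2, ← map_zero (polyHom K)]
    refine polyHom_injective.ne fun h => h2 ?_
    rw [← eval_ofNat 2 (0 : K), h, eval_zero]
  obtain ⟨c, hc, e₁, e₂, e₃⟩ := xRep_add_sub h2' h₁.2 h₂.2 h₃.2 h₄.2
  rw [h₁.height_eq, h₂.height_eq, h₃.height_eq, h₄.height_eq]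
  set n₁ := max A₁.natDegree B₁.natDegree
  set n₂ := max A₂.natDegree B₂.natDegree
  set n₃ := max A₃.natDegree B₃.natDegree
  set n₄ := max A₄.natDegree B₄.natDegree
  have ta : ∀ {A B : K[X]}, TopCoeff A (max A.natDegree B.natDegree)
    (A.coeff (max A.natDegree B.natDegree)) := ⟨le_max_left _ _, rfl⟩
  have tb : ∀ {A B : K[X]}, TopCoeff B (max A.natDegree B.natDegree)
    (B.coeff (max A.natDegree B.natDegree)) := ⟨le_max_right _ _, rfl⟩
  set f : Fin 3 → K[X] := ![addSubDen A₁ B₁ A₂ B₂,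
    addSubSum (C (S.a₄ : K)) (C (S.a₆ : K)) A₁ B₁ A₂ B₂,
    addSubProd (C (S.a₄ : K)) (C (S.a₆ : K)) A₁ B₁ A₂ B₂] with hf
  set g : Fin 3 → K[X] := ![B₃ * B₄, A₃ * B₄ + A₄ * B₃, A₃ * A₄] with hg
  have hfg : ∀ i, polyHom K (f i) = c * polyHom K (g i) := by
    have e4 : polyHom K (C (S.a₄ : K)) = (curve S (RatFuncBar K)).a₄ := by
      rw [curve_a₄, map_intCast, map_intCast]
    have e6 : polyHom K (C (S.a₆ : K)) = (curve S (RatFuncBar K)).a₆ := by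
      rw [curve_a₆, map_intCast, map_intCast]
    intro i
    fin_cases i
    · simpa [hf, hg, addSubDen] using e₁
    · rw [← e4, ← e6] at e₂
      simpa [hf, hg, addSubSum, map_ofNat (polyHom K)] using e₂
    · rw [← e4, ← e6] at e₃
      simpa [hf, hg, addSubProd, map_ofNat (polyHom K)] using e₃
  have := degree_eq_of_proportional (f := f) (g := g) (m := 2 * n₁ + 2 * n₂) (n := n₃ + n₄)
    (a := ![addSubDen (A₁.coeff n₁) (B₁.coeff n₁) (A₂.coeff n₂) (B₂.coeff n₂),
      addSubSum (S.a₄ : K) (S.a₆ : K) (A₁.coeff n₁) (B₁.coeff n₁) (A₂.coeff n₂) (B₂.coeff n₂),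
      addSubProd (S.a₄ : K) (S.a₆ : K) (A₁.coeff n₁) (B₁.coeff n₁) (A₂.coeff n₂) (B₂.coeff n₂)])
    (b := ![B₃.coeff n₃ * B₄.coeff n₄,
      A₃.coeff n₃ * B₄.coeff n₄ + A₄.coeff n₄ * B₃.coeff n₃, A₃.coeff n₃ * A₄.coeff n₄])
    ?_ ?_ ?_ ?_ ?_ ?_ ?_
  · exact this.symm
  · intro i j
    apply polyHom_injective
    rw [map_mul, map_mul, hfg, hfg]
    ring
  · intro x
    by_contra! H
    refine addSub_ne_zero h2 hd (eval_ne_zero_of_isCoprime h₁.1 x)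
      (eval_ne_zero_of_isCoprime h₂.1 x) ?_ ?_ ?_
    · simpa [hf, addSubDen] using H 0
    · simpa [hf, addSubSum] using H 1
    · simpa [hf, addSubProd] using H 2
  · intro x
    by_contra! H
    refine symm_prod_ne_zero (eval_ne_zero_of_isCoprime h₃.1 x)
      (eval_ne_zero_of_isCoprime h₄.1 x) ?_ ?_ ?_
    · rw [← eval_mul]; exact H 0
    · rw [← eval_mul, ← eval_mul, ← eval_add]; exact H 1
    · rw [← eval_mul]; exact H 2
  · intro i
    have a₁ := ta (A := A₁) (B := B₁)
    have b₁ := tb (A := A₁) (B := B₁)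
    have a₂ := ta (A := A₂) (B := B₂)
    have b₂ := tb (A := A₂) (B := B₂)
    fin_cases i
    · exact a₁.addSubDen b₁ a₂ b₂
    · exact a₁.addSubSum b₁ a₂ b₂ _ _
    · exact a₁.addSubProd b₁ a₂ b₂ _ _
  · intro i
    have a₁ := ta (A := A₃) (B := B₃)
    have b₁ := tb (A := A₃) (B := B₃)
    have a₂ := ta (A := A₄) (B := B₄)
    have b₂ := tb (A := A₄) (B := B₄)
    fin_cases i
    · exact b₁.mul b₂
    · exact (a₁.mul b₂).add ((b₁.mul a₂).congr (mul_comm _ _) rfl (mul_comm _ _))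
    · exact a₁.mul a₂
  · by_contra! H
    exact addSub_ne_zero h2 hd (topCoeff_max_ne_zero h₁.1) (topCoeff_max_ne_zero h₂.1)
      (H 0) (H 1) (H 2)
  · by_contra! H
    exact symm_prod_ne_zero (topCoeff_max_ne_zero h₃.1) (topCoeff_max_ne_zero h₄.1)
      (H 0) (H 1) (H 2)

end Height

end ShortWeierstrass

/-! ### Specialization of points over the algebraic closure of `K(t)` -/

namespace ShortWeierstrass

open WeierstrassCurve Polynomial

section MapPoint

variable {S : WeierstrassCurve ℤ} {L L' : Type*} [Field L] [Field L'] [DecidableEq L]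
  [DecidableEq L']

/-- The homomorphism between groups of points induced by a homomorphism of fields. -/
noncomputable def mapPt (f : L →+* L') : Points S L →+ Points S L' :=
  Affine.Point.map (W' := S) (S := ℤ) f.toIntAlgHom

variable (f : L →+* L')

theorem HasCoords.mapPt {P : Points S L} {x y : L} (h : HasCoords P x y) :
    HasCoords (mapPt f P) (f x) (f y) := by
  obtain ⟨h, rfl⟩ := h
  rw [ShortWeierstrass.mapPt, Affine.Point.map_some]
  exact ⟨_, rfl⟩

theorem XRep.mapPt {P : Points S L} {A B : L} (h : XRep P A B) :
    XRep (mapPt f P) (f A) (f B) := by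
  rcases h with ⟨rfl, hA, rfl⟩ | ⟨x, y, h, hB, rfl⟩
  · exact .inl ⟨map_zero _, by simpa using hA, map_zero f⟩
  · exact .inr ⟨f x, f y, h.mapPt f, by simpa using hB, map_mul f _ _⟩

variable {f}

theorem XRep.of_mapPt {P : Points S L} {A B : L}
    (h : XRep (ShortWeierstrass.mapPt f P) (f A) (f B)) :
    XRep P A B := by
  obtain ⟨A', B', h'⟩ := exists_xRep P
  have hc := h.cross (h'.mapPt f)
  rw [← map_mul, ← map_mul] at hc
  have hc := f.injective hc
  have h0 : A ≠ 0 ∨ B ≠ 0 := by simpa using h.ne_zero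
  rcases h' with ⟨rfl, hA', rfl⟩ | ⟨x, y, h', hB', rfl⟩
  · obtain rfl : B = 0 := by simpa [hA'] using hc.symm
    exact .inl ⟨rfl, h0.resolve_right (by simp), rfl⟩
  · have hA : A = x * B := mul_right_cancel₀ hB' (by rw [hc]; ring)
    refine .inr ⟨x, y, h', ?_, hA⟩
    rintro rfl
    simp [hA] at h0

end MapPoint

section Red

variable {S : WeierstrassCurve ℤ} {L : Type*} [Field L] {O : ValuationSubring L} [S.IsShortNF]

theorem XRep.red (hΔ : (curve S (IsLocalRing.ResidueField O)).Δ ≠ 0) {P : Points S L} {A B : L}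
    {α β : IsLocalRing.ResidueField O} (h : XRep P A B) (hA : ReducesTo O A α)
    (hB : ReducesTo O B β) (h0 : α ≠ 0 ∨ β ≠ 0) : XRep (red O P) α β := by
  obtain ⟨A', B', α', β', h', hA', hB', h''⟩ := exists_xRep_red hΔ P
  have hc : α * β' = α' * β := (hA.mul hB').unique (by rw [h.cross h']; exact hA'.mul hB)
  rcases h'' with ⟨hP, hα', rfl⟩ | ⟨x, y, h'', hβ', rfl⟩
  · obtain rfl : β = 0 := by simpa [hα'] using hc.symm
    exact .inl ⟨hP, h0.resolve_right (by simp), rfl⟩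
  · have hA : α = x * β := mul_right_cancel₀ hβ' (by rw [hc]; ring)
    refine .inr ⟨x, y, h'', ?_, hA⟩
    rintro rfl
    simp [hA] at h0

omit [S.IsShortNF] in
theorem discr_eq (L : Type*) [Field L] : (curve S L).Δ = (S.Δ : L) := by
  rw [curve, WeierstrassCurve.baseChange, map_Δ, eq_intCast]

omit [S.IsShortNF] in
theorem discr_ne_zero_of_hom {L L' : Type*} [Field L] [Field L'] (f : L →+* L')
    (h : (curve S L).Δ ≠ 0) : (curve S L').Δ ≠ 0 := by
  rw [discr_eq] at h ⊢
  rw [← map_intCast f]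
  exact (map_ne_zero f).2 h

end Red

section Place

variable {K Ω : Type*} [Field K] [Field Ω]

/-- The homomorphism `j` embeds `K` into the residue field of `O`, in such a way that the value of
`φ p` at the place `O` is the value of the polynomial `p` at `x₀`. -/
def IsPlaceAt (φ : K[X] →+* Ω) (O : ValuationSubring Ω) (j : K →+* IsLocalRing.ResidueField O)
    (x₀ : K) : Prop :=
  ∀ p : K[X], ReducesTo O (φ p) (j (p.eval x₀))

theorem exists_isPlaceAt {φ : K[X] →+* Ω} (hφ : Function.Injective φ) (x₀ : K) :
    ∃ (O : ValuationSubring Ω) (j : K →+* IsLocalRing.ResidueField O), IsPlaceAt φ O j x₀ := by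
  let e : K[X] ≃+* φ.range := RingEquiv.ofLeftInverse (Function.leftInverse_invFun hφ)
  have he : ∀ p, (e p : Ω) = φ p := fun p => rfl
  let I : Ideal φ.range := RingHom.ker ((evalRingHom x₀).comp (e.symm : φ.range →+* K[X]))
  have hI : I ≠ ⊤ := RingHom.ker_ne_top _
  obtain ⟨O, hO, hI⟩ := Ideal.image_subset_nonunits_valuationSubring I hI
  have hmem : ∀ p, φ p ∈ O := fun p => hO ⟨p, rfl⟩
  have hzero : ∀ p : K[X], p.eval x₀ = 0 → ReducesTo O (φ p) 0 := by
    intro p hp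
    have : φ p ∈ O.nonunits := hI ⟨e p, by simpa [I] using hp, rfl⟩
    rcases (ValuationSubring.mem_nonunits_iff_or _).1 this with h | h
    · rw [h]; exact .zero
    · simpa using ReducesTo.inv_of_notMem h
  refine ⟨O, (IsLocalRing.residue O).comp
    ((φ.comp C).codRestrict O.toSubring (fun a => hmem (C a))), fun p => ?_⟩
  have h1 : ReducesTo O (φ (C (p.eval x₀))) _ := ⟨hmem _, rfl⟩
  have h2 := (hzero (p - C (p.eval x₀)) (by simp)).add h1
  rw [← map_add, sub_add_cancel, zero_add] at h2
  exact h2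

end Place

section Compat

open scoped Classical

variable {K : Type*} [Field K] {S : WeierstrassCurve ℤ}

/-- The endomorphisms `αΩ` and `αK` of the groups of points over an algebraic closure of `K(t)`
and over `K` have the same behaviour modulo every place that is trivial on `K`. This stands for
the two of them being given by the same formulas. -/
def Compat (αΩ : Points S (RatFuncBar K) →+ Points S (RatFuncBar K))
    (αK : Points S K →+ Points S K) : Prop :=
  ∀ (O : ValuationSubring (RatFuncBar K)) (j : K →+* IsLocalRing.ResidueField O),
    (∀ a, ReducesTo O (polyHom K (C a)) (j a)) →
    ∃ αk : Points S (IsLocalRing.ResidueField O) →+ Points S (IsLocalRing.ResidueField O),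
      (∀ P, red O (αΩ P) = αk (red O P)) ∧ ∀ P, αk (mapPt j P) = mapPt j (αK P)

namespace Compat

variable {αΩ βΩ : Points S (RatFuncBar K) →+ Points S (RatFuncBar K)}
  {αK βK : Points S K →+ Points S K}

theorem id : Compat (S := S) (K := K) (AddMonoidHom.id _) (AddMonoidHom.id _) :=
  fun _ _ _ => ⟨AddMonoidHom.id _, fun _ => rfl, fun _ => rfl⟩

theorem comp (hα : Compat αΩ αK) (hβ : Compat βΩ βK) : Compat (αΩ.comp βΩ) (αK.comp βK) := by
  intro O j hj
  obtain ⟨αk, h₁, h₂⟩ := hα O j hj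
  obtain ⟨βk, k₁, k₂⟩ := hβ O j hj
  exact ⟨αk.comp βk, fun P => by simp [h₁, k₁], fun P => by simp [h₂, k₂]⟩

variable [S.IsShortNF] (hΔ : (curve S K).Δ ≠ 0)
include hΔ

theorem add (hα : Compat αΩ αK) (hβ : Compat βΩ βK) : Compat (αΩ + βΩ) (αK + βK) := by
  intro O j hj
  obtain ⟨αk, h₁, h₂⟩ := hα O j hj
  obtain ⟨βk, k₁, k₂⟩ := hβ O j hj
  refine ⟨αk + βk, fun P => ?_, fun P => by simp [h₂, k₂]⟩
  rw [AddMonoidHom.add_apply, red_add (discr_ne_zero_of_hom j hΔ), h₁, k₁, AddMonoidHom.add_apply]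

theorem zsmul (hα : Compat αΩ αK) (n : ℤ) : Compat (n • αΩ) (n • αK) := by
  intro O j hj
  obtain ⟨αk, h₁, h₂⟩ := hα O j hj
  refine ⟨n • αk, fun P => ?_, fun P => by simp [h₂]⟩
  rw [AddMonoidHom.smul_apply, ← redHom_apply (discr_ne_zero_of_hom j hΔ), map_zsmul,
    redHom_apply, h₁, AddMonoidHom.smul_apply]

theorem mapPt_frobenius (q : ℕ) [ExpChar K q] [ExpChar (RatFuncBar K) q] :
    Compat (S := S) (mapPt (frobenius (RatFuncBar K) q)) (mapPt (frobenius K q)) := by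
  intro O j hj
  have : ExpChar (IsLocalRing.ResidueField O) q := expChar_of_injective_ringHom j.injective q
  have hΔ' := discr_ne_zero_of_hom j hΔ
  refine ⟨mapPt (frobenius _ q), fun P => ?_, fun P => ?_⟩
  · by_cases hP : P = 0
    · simp [hP, red_zero]
    obtain ⟨x, y, hP⟩ := exists_hasCoords hP
    have hq : q ≠ 0 := (expChar_pos K q).ne'
    by_cases hx : x ∈ O
    · obtain ⟨ξ, hξ⟩ := exists_reducesTo hx
      obtain ⟨η, hη, h⟩ := hasCoords_red hΔ' hP hξ
      obtain ⟨η', hη', h'⟩ := hasCoords_red hΔ' (hP.mapPt (frobenius _ q)) (hξ.pow q)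
      rw [frobenius_def] at hη'
      rw [hη'.unique (hη.pow q)] at h'
      exact h'.ext (h.mapPt (frobenius _ q))
    · have hxq : x ^ q ∉ O := by
        intro h
        obtain ⟨ξ, hξ⟩ := exists_reducesTo h
        obtain ⟨_, h, _⟩ := hξ.exists_of_pow hq
        exact hx h.1
      rw [red_eq_zero_of_notMem hP hx, red_eq_zero_of_notMem (hP.mapPt (frobenius _ q)) hxq,
        map_zero]
  · by_cases hP : P = 0
    · simp [hP]
    obtain ⟨x, y, hP⟩ := exists_hasCoords hP
    have h₁ := (hP.mapPt j).mapPt (frobenius _ q)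
    have h₂ := (hP.mapPt (frobenius _ q)).mapPt j
    simp only [frobenius_def, map_pow] at h₁ h₂
    exact h₁.ext h₂

variable {g : Points S (RatFuncBar K)} {s : RatFuncBar K} (hg : HasCoords g (polyHom K X) s)
include hg

/-- The action of `αΩ` on the generic point of the curve determines the action of `αK` on
`x`-coordinates. -/
theorem xRep_eval (h : Compat αΩ αK) {A B : K[X]} (hAB : CoprimeXRep (αΩ g) A B) {P : Points S K}
    {x y : K} (hP : HasCoords P x y) : XRep (αK P) (A.eval x) (B.eval x) := by
  obtain ⟨O, j, hj⟩ := exists_isPlaceAt (polyHom_injective (K := K)) x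
  obtain ⟨αk, h₁, h₂⟩ := h O j (fun a => by simpa using hj (C a))
  have hΔ' := discr_ne_zero_of_hom j hΔ
  have hx := hj X
  rw [eval_X] at hx
  obtain ⟨η, hη, hr⟩ := hasCoords_red hΔ' hg hx
  have hor : red O (αΩ g) = mapPt j (αK P) ∨ red O (αΩ g) = -mapPt j (αK P) := by
    rw [h₁, ← h₂]
    rcases hr.eq_or_eq_neg (hP.mapPt j) with h | h
    · exact .inl (by rw [h])
    · exact .inr (by rw [h, map_neg])
  have hX : XRep (red O (αΩ g)) (j (A.eval x)) (j (B.eval x)) :=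
    hAB.2.red hΔ' (hj A) (hj B) (by simpa using eval_ne_zero_of_isCoprime hAB.1 x)
  apply XRep.of_mapPt (f := j)
  rcases hor with h | h
  · rwa [← h]
  · rw [← neg_neg (mapPt j (αK P)), ← h]
    exact hX.neg

/-- Non-zero endomorphisms have their poles at infinity in excess of their zeros: this expresses
that they fix the point at infinity. -/
theorem natDegree_lt (h : Compat αΩ αK) {A B : K[X]} (hAB : CoprimeXRep (αΩ g) A B)
    (h0 : αΩ g ≠ 0) : B.natDegree < A.natDegree := by
  by_contra! hle
  let t : RatFuncBar K := polyHom K X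
  have ht : t ≠ 0 := by
    have := polyHom_injective.ne (X_ne_zero (R := K))
    simpa [t] using this
  let : Invertible t := invertibleOfNonzero ht
  -- the place at infinity is the place `0` for the parameter `1 / t`
  let φ : K[X] →+* RatFuncBar K := eval₂RingHom ((polyHom K).comp C) (⅟t)
  have hpoly : ∀ p : K[X], eval₂ ((polyHom K).comp C) t p = polyHom K p := by
    intro p
    have : eval₂RingHom ((polyHom K).comp C) t = polyHom K :=
      ringHom_ext (fun a => by simp) (by simp [t])
    exact congrArg (fun f => f p) this
  have hφ : ∀ (p : K[X]) (n : ℕ), p.natDegree ≤ n → φ (reflect n p) * t ^ n = polyHom K p := by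
    intro p n hp
    rw [← hpoly]
    exact eval₂_reflect_mul_pow _ t n p hp
  have hinj : Function.Injective φ := by
    rw [injective_iff_map_eq_zero]
    intro p hp
    have h1 := hφ (reflect p.natDegree p) p.natDegree ?_
    · rw [reflect_reflect, hp, zero_mul] at h1
      have := polyHom_injective (h1.symm.trans (map_zero _).symm)
      simpa using this
    · exact natDegree_reflect_le.trans (by simp)
  obtain ⟨O, j, hj⟩ := exists_isPlaceAt hinj 0
  obtain ⟨αk, h₁, h₂⟩ := h O j (fun a => by simpa [φ] using hj (C a))
  have hΔ' := discr_ne_zero_of_hom j hΔ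
  have hX : t ∉ O := by
    have := hj X
    simp only [φ, coe_eval₂RingHom, eval₂_X, eval_X, map_zero, invOf_eq_inv] at this
    simpa using this.inv_notMem (inv_ne_zero ht)
  have hred : red O (αΩ g) = 0 := by
    rw [h₁, red_eq_zero_of_notMem hg hX, map_zero]
  have hB : B ≠ 0 := by
    rintro rfl
    rcases hAB.2 with h | ⟨_, _, _, h, _⟩
    · exact h0 h.1
    · simp at h
  have hrep : XRep (αΩ g) (φ (reflect B.natDegree A)) (φ (reflect B.natDegree B)) := by
    have := hAB.2.smul (inv_ne_zero (pow_ne_zero B.natDegree ht))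
    rw [← hφ A _ hle, ← hφ B _ le_rfl] at this
    convert this using 1
    · field_simp
    · field_simp
  have hc : ∀ p : K[X], (reflect B.natDegree p).eval 0 = p.coeff B.natDegree := by
    intro p
    rw [← coeff_zero_eq_eval_zero, coeff_reflect, revAt_le (Nat.zero_le _), Nat.sub_zero]
  have := hrep.red hΔ' (hj _) (hj _) (.inr (by
    rw [hc]
    simpa using hB))
  rw [hred] at this
  rcases this with ⟨-, -, h⟩ | ⟨_, _, h, _⟩
  · rw [hc] at h
    simp [hB] at h
  · exact h.ne_zero rfl

theorem eq_zero (h : Compat αΩ αK) (h0 : αΩ g = 0) : αK = 0 := by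
  ext1 P
  by_cases hP : P = 0
  · simp [hP]
  obtain ⟨x, y, hP⟩ := exists_hasCoords hP
  have hAB : CoprimeXRep (αΩ g) (1 : K[X]) 0 :=
    ⟨isCoprime_one_left, by rw [h0, map_one, map_zero]; exact xRep_zero⟩
  rcases h.xRep_eval hΔ hg hAB hP with ⟨h, -⟩ | ⟨_, _, _, h, _⟩
  · exact h
  · simp at h

theorem surjective [IsAlgClosed K] (h : Compat αΩ αK) {A B : K[X]}
    (hAB : CoprimeXRep (αΩ g) A B) (h0 : αΩ g ≠ 0) : Function.Surjective αK := by
  intro Q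
  by_cases hQ : Q = 0
  · exact ⟨0, by simp [hQ]⟩
  obtain ⟨u, v, hQ⟩ := exists_hasCoords hQ
  have hlt := h.natDegree_lt hΔ hg hAB h0
  obtain ⟨x, hx⟩ : ∃ x, (A - C u * B).IsRoot x := by
    apply IsAlgClosed.exists_root
    intro hdeg
    have h1 : (A - C u * B).natDegree = A.natDegree :=
      natDegree_sub_eq_left_of_natDegree_lt ((natDegree_C_mul_le _ _).trans_lt hlt)
    rw [natDegree_eq_zero_iff_degree_le_zero.2 hdeg.le] at h1
    omega
  obtain ⟨y, hy⟩ := IsAlgClosed.exists_pow_nat_eq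
    (x ^ 3 + (curve S K).a₄ * x + (curve S K).a₆) two_pos
  obtain ⟨P, hP⟩ := exists_point_of_equation hΔ (equation_short.2 hy)
  have hX := h.xRep_eval hΔ hg hAB hP
  rw [IsRoot, eval_sub, eval_mul, eval_C, sub_eq_zero] at hx
  rcases hX.eq_or_eq_neg hQ.xRep (by rw [hx]; ring) with h | h
  · exact ⟨P, h⟩
  · exact ⟨-P, by rw [map_neg, h, neg_neg]⟩

end Compat

end Compat

end ShortWeierstrass

/-! ### The order of the kernel of a separable endomorphism -/

namespace ShortWeierstrass

open WeierstrassCurve Polynomial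

section PolynomialIdentity

variable {K : Type*} [Field K]

open Classical in
/-- If the twisted form `l U² = X³ + a X + b` of a curve has a point whose abscissa `X = A / B` has
a pole at infinity and satisfies `X' = c U`, then the polar divisor of `X` is determined by its
support. -/
theorem rootMultiplicity_and_natDegree_of_differential_identity {A B l : K[X]} {a b c : K}
    (hAB : IsCoprime A B) (hB : B ≠ 0)
    (hlt : B.natDegree < A.natDegree) (hl : l.natDegree = 3) (hc : c ≠ 0)
    (h : l * (derivative A * B - A * derivative B) ^ 2 =
      C (c ^ 2) * (B * (A ^ 3 + C a * A * B ^ 2 + C b * B ^ 3))) :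
    A.natDegree = B.natDegree + 1 ∧
      ∀ x, B.eval x = 0 → B.rootMultiplicity x = if l.eval x = 0 then 1 else 2 := by
  obtain ⟨W, hW⟩ : ∃ W, W = derivative A * B - A * derivative B := ⟨_, rfl⟩
  obtain ⟨G, hG⟩ : ∃ G, G = A ^ 3 + C a * A * B ^ 2 + C b * B ^ 3 := ⟨_, rfl⟩
  rw [← hW, ← hG] at h
  have hdG : G.natDegree = 3 * A.natDegree := by
    have h1 : (C a * A * B ^ 2 + C b * B ^ 3).natDegree < (A ^ 3).natDegree := by
      rw [natDegree_pow]
      refine (natDegree_add_le _ _).trans_lt (max_lt ?_ ?_)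
      · refine (natDegree_mul_le.trans (add_le_add (natDegree_C_mul_le _ _)
          (natDegree_pow_le))).trans_lt ?_
        omega
      · refine ((natDegree_C_mul_le _ _).trans natDegree_pow_le).trans_lt ?_
        omega
    rw [hG, add_assoc, natDegree_add_eq_left_of_natDegree_lt h1, natDegree_pow]
  have hG0 : G ≠ 0 := by
    rintro rfl
    rw [natDegree_zero] at hdG
    omega
  have hc2 : C (c ^ 2) ≠ 0 := C_ne_zero.2 (pow_ne_zero 2 hc)
  have hr0 : C (c ^ 2) * (B * G) ≠ 0 := mul_ne_zero hc2 (mul_ne_zero hB hG0)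
  have hl0 : l ≠ 0 := by rintro rfl; simp at hl
  have hW0 : W ≠ 0 := by
    rintro rfl
    apply hr0
    rw [← h]
    ring
  constructor
  · have hdW : W.natDegree + 1 ≤ A.natDegree + B.natDegree := by
      have h1 : W.natDegree ≤ A.natDegree + B.natDegree - 1 := by
        rw [hW]
        refine (natDegree_sub_le _ _).trans (max_le ?_ ?_)
        · refine natDegree_mul_le.trans ((add_le_add_left (natDegree_derivative_le A) _).trans ?_)
          omega
        · by_cases hB' : B.natDegree = 0
          · rw [derivative_of_natDegree_zero hB', mul_zero, natDegree_zero]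
            exact Nat.zero_le _
          · refine natDegree_mul_le.trans
              ((add_le_add_right (natDegree_derivative_le B) _).trans ?_)
            omega
      omega
    have hd := congrArg natDegree h
    rw [natDegree_mul hl0 (pow_ne_zero 2 hW0), natDegree_pow, hl, natDegree_C_mul
      (pow_ne_zero 2 hc), natDegree_mul hB hG0, hdG] at hd
    omega
  · intro x hx
    have hA : A.eval x ≠ 0 := (eval_ne_zero_of_isCoprime hAB x).resolve_right (by simp [hx])
    have hGx : G.rootMultiplicity x = 0 := by
      apply rootMultiplicity_eq_zero
      rw [IsRoot, hG]
      simpa [hx] using hA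
    have hm := congrArg (rootMultiplicity x) h
    rw [rootMultiplicity_mul (h ▸ hr0), rootMultiplicity_mul hr0,
      rootMultiplicity_mul (mul_ne_zero hB hG0), hGx, rootMultiplicity_C, sq W,
      rootMultiplicity_mul (mul_ne_zero hW0 hW0)] at hm
    have hpos : 0 < B.rootMultiplicity x := (rootMultiplicity_pos hB).2 hx
    have hWx : B.rootMultiplicity x - 1 ≤ W.rootMultiplicity x := by
      rw [le_rootMultiplicity_iff hW0, hW]
      have hd := pow_rootMultiplicity_dvd B x
      exact dvd_sub (((pow_dvd_pow _ (Nat.sub_le _ 1)).trans hd).mul_left _)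
        ((pow_sub_one_dvd_derivative_of_pow_dvd hd).mul_left _)
    split_ifs with hlx
    · have : 0 < l.rootMultiplicity x := (rootMultiplicity_pos hl0).2 hlx
      omega
    · have : l.rootMultiplicity x = 0 := rootMultiplicity_eq_zero hlx
      omega

theorem card_sq_eq [IsAlgClosed K] [DecidableEq K] (h2 : (2 : K) ≠ 0) (v : K) :
    Nat.card {y : K // y ^ 2 = v} = if v = 0 then 1 else 2 := by
  obtain ⟨r, hr⟩ := IsAlgClosed.exists_pow_nat_eq v two_pos
  have hset : {y : K | y ^ 2 = v} = {r, -r} := by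
    ext y
    rw [Set.mem_ofPred_eq, ← hr, sq_eq_sq_iff_eq_or_eq_neg]
    rfl
  change Nat.card {y : K | y ^ 2 = v} = _
  rw [hset, Nat.card_coe_set_eq]
  split_ifs with hv
  · obtain rfl : r = 0 := by simpa [hv] using hr
    simp
  · apply Set.ncard_pair
    intro h
    have : 2 * r = 0 := by linear_combination h
    rcases mul_eq_zero.1 this with h | rfl
    · exact h2 h
    · exact hv (by rw [← hr]; simp)

end PolynomialIdentity

section Points

variable {S : WeierstrassCurve ℤ} {L : Type*} [Field L] [S.IsShortNF]

/-- The points of a curve with `x`-coordinate in a finite set, together with the point at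
infinity. -/
theorem card_points_over [DecidableEq L] [IsAlgClosed L] (hΔ : (curve S L).Δ ≠ 0) (R : Finset L) :
    Nat.card {P : Points S L // P = 0 ∨ ∃ x ∈ R, ∃ y, HasCoords P x y} =
      (∑ x ∈ R, if x ^ 3 + S.a₄ * x + S.a₆ = 0 then 1 else 2) + 1 := by
  obtain ⟨-, h2⟩ := discr_ne_zero (W := curve S L) hΔ
  let T := (x : R) × {y : L // y ^ 2 = (x : L) ^ 3 + S.a₄ * x + S.a₆}
  have hT : ∀ t : T, ∃ P : Points S L, HasCoords P t.1 t.2 := fun t =>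
    exists_point_of_equation hΔ (equation_short.2 (by rw [curve_a₄, curve_a₆]; exact t.2.2))
  choose F hF using hT
  let G : Option T → Points S L := fun t => t.elim 0 F
  have hG : Function.Injective G := by
    rintro (_ | t) (_ | t') h
    · rfl
    · exact absurd h.symm (hF t').ne_zero
    · exact absurd h (hF t).ne_zero
    · have h' : F t = F t' := h
      obtain ⟨e₁, e₂⟩ := (hF t).unique (h' ▸ hF t')
      obtain ⟨⟨x, hx⟩, y, hy⟩ := t
      obtain ⟨⟨x', hx'⟩, y', hy'⟩ := t'
      dsimp only at e₁ e₂
      subst e₁ e₂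
      rfl
  have hrange : Set.range G = {P : Points S L | P = 0 ∨ ∃ x ∈ R, ∃ y, HasCoords P x y} := by
    ext P
    constructor
    · rintro ⟨_ | t, rfl⟩
      · exact .inl rfl
      · exact .inr ⟨t.1, t.1.2, t.2, hF t⟩
    · rintro (rfl | ⟨x, hx, y, h⟩)
      · exact ⟨none, rfl⟩
      · have hy := h.equation
        rw [curve_a₄, curve_a₆] at hy
        exact ⟨some ⟨⟨x, hx⟩, y, hy⟩, (hF _).ext h⟩
  change Nat.card {P : Points S L | P = 0 ∨ ∃ x ∈ R, ∃ y, HasCoords P x y} = _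
  have hfin : ∀ x : R, Finite {y : L // y ^ 2 = (x : L) ^ 3 + S.a₄ * x + S.a₆} := fun x => by
    apply Nat.finite_of_card_ne_zero
    rw [card_sq_eq h2]
    split_ifs <;> simp
  rw [← hrange, ← Nat.card_congr (Equiv.ofInjective G hG), Finite.card_option, Nat.card_sigma,
    ← Finset.sum_coe_sort R]
  simp only [card_sq_eq h2]

end Points

section Endomorphisms

open scoped Classical

variable {K : Type*} [Field K] (S : WeierstrassCurve ℤ)

/-- The right-hand side of the equation of the curve. -/
noncomputable def cubic (K : Type*) [Field K] : K[X] := X ^ 3 + C (S.a₄ : K) * X + C (S.a₆ : K)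

theorem natDegree_cubic : (cubic S K).natDegree = 3 := by
  rw [cubic]
  compute_degree!

variable {S}

theorem eval_cubic (x : K) : (cubic S K).eval x = x ^ 3 + S.a₄ * x + S.a₆ := by
  simp [cubic]

/-- The differential of a point of the curve over the algebraic closure of `K(t)`, relative to the
differential `dt / s` where `s² = t³ + a₄ t + a₆`. -/
abbrev HasGenericDifferential (s : RatFuncBar K) (P : Points S (RatFuncBar K)) (c : RatFunc K) :
    Prop :=
  HasDifferential (algebraMap (RatFunc K) (RatFuncBar K)) (ratDeriv K) s
    (algebraMap K[X] (RatFunc K) (cubic S K)) P c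

/-- `(αΩ, αK)` is an endomorphism of the curve, `g` being the generic point, by which the
invariant differential is multiplied by `c`. -/
structure IsEndo (g : Points S (RatFuncBar K)) (s : RatFuncBar K)
    (αΩ : Points S (RatFuncBar K) →+ Points S (RatFuncBar K))
    (αK : Points S K →+ Points S K) (c : ℤ) : Prop where
  compat : Compat αΩ αK
  differential : HasGenericDifferential s (αΩ g) (c : RatFunc K)

variable {g : Points S (RatFuncBar K)} {s : RatFuncBar K}

theorem HasGenericDifferential.exists_coprimeXRep {P : Points S (RatFuncBar K)} {c : RatFunc K}
    (h : HasGenericDifferential s P c) : ∃ A B, CoprimeXRep P A B := by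
  rcases h with ⟨rfl, -⟩ | ⟨X, U, h, -⟩
  · exact ⟨1, 0, isCoprime_one_left, by rw [map_one, map_zero]; exact xRep_zero⟩
  · refine ⟨X.num, X.denom, RatFunc.isCoprime_num_denom X, .inr ⟨_, _, h, ?_, ?_⟩⟩
    · have := polyHom_injective.ne (RatFunc.denom_ne_zero X)
      simpa using this
    · rw [polyHom, RingHom.comp_apply, RingHom.comp_apply, ← map_mul]
      congr 1
      have hd : algebraMap K[X] (RatFunc K) X.denom ≠ 0 := by
        simpa using RatFunc.denom_ne_zero X
      nth_rw 2 [← RatFunc.num_div_denom X]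
      rw [div_mul_cancel₀ _ hd]

variable [S.IsShortNF] (hg : HasCoords g (polyHom K X) s)
include hg

theorem sq_eq_polyHom_cubic : s ^ 2 = polyHom K (cubic S K) := by
  rw [hg.equation, curve_a₄, curve_a₆, cubic]
  simp

theorem genericRoot_ne_zero : s ≠ 0 := by
  rintro rfl
  have h := sq_eq_polyHom_cubic hg
  rw [zero_pow two_ne_zero, ← map_zero (polyHom K)] at h
  have := natDegree_cubic S (K := K)
  rw [← polyHom_injective h, natDegree_zero] at this
  omega

omit [S.IsShortNF] in
theorem hasGenericDifferential_generic : HasGenericDifferential s g 1 := by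
  refine .inr ⟨algebraMap K[X] _ X, 1, by rw [map_one, mul_one]; exact hg, ?_, ?_⟩
  · rw [ratDeriv_algebraMap, derivative_X, map_one, mul_one]
  · rw [ratDeriv_algebraMap, derivation_one, cubic]
    simp only [derivative_X_pow, derivative_mul, derivative_X, map_add, map_mul, map_pow,
      map_intCast, map_natCast, map_one]
    norm_num

theorem HasGenericDifferential.zsmul {P : Points S (RatFuncBar K)} {c : RatFunc K}
    (h : HasGenericDifferential s P c) (n : ℤ) : HasGenericDifferential s (n • P) (n * c) := by
  have hs := genericRoot_ne_zero hg
  have hl : s ^ 2 = algebraMap (RatFunc K) (RatFuncBar K)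
    (algebraMap K[X] (RatFunc K) (cubic S K)) := sq_eq_polyHom_cubic hg
  induction n with
  | zero => exact .inl ⟨by simp, by simp⟩
  | succ n ih =>
    rw [add_smul, one_smul]
    convert ih.add hs hl h using 1
    push_cast
    ring
  | pred n ih =>
    rw [sub_smul, one_smul, sub_eq_add_neg]
    convert ih.add hs hl h.neg using 1
    push_cast
    ring

/-- The invariant differential vanishes along Frobenius. -/
theorem HasGenericDifferential.frobenius {q : ℕ} (hq : Odd q) [Fact q.Prime] [CharP K q]
    [ExpChar (RatFuncBar K) q] {P : Points S (RatFuncBar K)} {c : RatFunc K}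
    (h : HasGenericDifferential s P c) :
    HasGenericDifferential s (mapPt (_root_.frobenius (RatFuncBar K) q) P) 0 := by
  rcases h with ⟨rfl, -⟩ | ⟨X, U, h, -⟩
  · exact .inl ⟨map_zero _, rfl⟩
  obtain ⟨k, hk⟩ := hq
  set l := algebraMap K[X] (RatFunc K) (cubic S K) with hl
  have hq0 : (q : RatFunc K) = 0 := by
    rw [← map_natCast (algebraMap K (RatFunc K)), CharP.cast_eq_zero, map_zero]
  have hD : ∀ x : RatFunc K, ratDeriv K (x ^ q) = 0 := fun x => by
    rw [derivation_pow, hq0, zero_mul]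
  refine .inr ⟨X ^ q, l ^ k * U ^ q, ?_, ?_, ?_⟩
  · have := h.mapPt (_root_.frobenius (RatFuncBar K) q)
    rw [frobenius_def, frobenius_def, ← map_pow, mul_pow] at this
    convert this using 1
    rw [map_mul, map_pow, map_pow, ← mul_assoc]
    congr 1
    have hs : s ^ 2 = algebraMap (RatFunc K) (RatFuncBar K) l := sq_eq_polyHom_cubic hg
    rw [← hs, ← pow_mul, hk]
    ring
  · rw [hD, zero_mul]
  · rw [derivation_mul, hD, mul_zero, zero_add, derivation_pow, mul_zero]
    have hk' : (2 * k + 1 : RatFunc K) = 0 := by rw [← hq0, hk]; push_cast; ring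
    rcases k with _ | k
    · simp at hk'
    · rw [Nat.add_sub_cancel, pow_succ]
      push_cast at hk' ⊢
      linear_combination (l ^ k * l * U ^ q * ratDeriv K l) * hk'

namespace IsEndo

variable {αΩ βΩ : Points S (RatFuncBar K) →+ Points S (RatFuncBar K)}
  {αK βK : Points S K →+ Points S K} {c d : ℤ}

omit [S.IsShortNF] in
theorem id : IsEndo g s (AddMonoidHom.id _) (AddMonoidHom.id _) 1 :=
  ⟨.id, by simpa using hasGenericDifferential_generic hg⟩

variable (hΔ : (curve S K).Δ ≠ 0)
include hΔ

theorem add (hα : IsEndo g s αΩ αK c) (hβ : IsEndo g s βΩ βK d) :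
    IsEndo g s (αΩ + βΩ) (αK + βK) (c + d) :=
  ⟨hα.compat.add hΔ hβ.compat, by
    rw [Int.cast_add]
    exact hα.differential.add (genericRoot_ne_zero hg) (sq_eq_polyHom_cubic hg) hβ.differential⟩

theorem zsmul (n : ℤ) (hα : IsEndo g s αΩ αK c) : IsEndo g s (n • αΩ) (n • αK) (n * c) :=
  ⟨hα.compat.zsmul hΔ n, by rw [Int.cast_mul]; exact hα.differential.zsmul hg n⟩

theorem frobenius_comp {q : ℕ} (hq : Odd q) [Fact q.Prime] [CharP K q] [ExpChar (RatFuncBar K) q]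
    (hα : IsEndo g s αΩ αK c) :
    IsEndo g s ((mapPt (_root_.frobenius (RatFuncBar K) q)).comp αΩ)
      ((mapPt (_root_.frobenius K q)).comp αK) 0 :=
  ⟨(Compat.mapPt_frobenius hΔ q).comp hα.compat, by
    rw [Int.cast_zero]
    exact hα.differential.frobenius hg hq⟩

omit hΔ in
theorem apply_generic_ne_zero (hα : IsEndo g s αΩ αK c) (hc : (c : K) ≠ 0) : αΩ g ≠ 0 := by
  intro h
  have h1 := hα.differential.unique (genericRoot_ne_zero hg) (.inl ⟨h, rfl⟩)
  rw [← map_intCast (algebraMap K (RatFunc K)), map_eq_zero] at h1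
  exact hc h1

theorem height_eq_zero (hα : IsEndo g s αΩ αK c) (h : height (αΩ g) = 0) : αK = 0 := by
  apply hα.compat.eq_zero hΔ hg
  by_contra h0
  obtain ⟨A, B, hAB⟩ := hα.differential.exists_coprimeXRep
  have := hα.compat.natDegree_lt hΔ hg hAB h0
  rw [hAB.height_eq, max_eq_left this.le] at h
  omega

theorem surjective [IsAlgClosed K] (hα : IsEndo g s αΩ αK c) (hc : (c : K) ≠ 0) :
    Function.Surjective αK := by
  obtain ⟨A, B, hAB⟩ := hα.differential.exists_coprimeXRep
  exact hα.compat.surjective hΔ hg hAB (hα.apply_generic_ne_zero hg hc)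

/-- The order of the kernel of a separable endomorphism is its degree. -/
theorem card_ker [IsAlgClosed K] (hα : IsEndo g s αΩ αK c) (hc : (c : K) ≠ 0) :
    Nat.card αK.ker = height (αΩ g) := by
  have h0 := hα.apply_generic_ne_zero hg hc
  obtain ⟨A, B, hAB⟩ := hα.differential.exists_coprimeXRep
  have hlt := hα.compat.natDegree_lt hΔ hg hAB h0
  have hB : B ≠ 0 := by
    rintro rfl
    rcases hAB.2 with h | ⟨_, _, _, h, _⟩
    · exact h0 h.1
    · simp at h
  have hid : cubic S K * (derivative A * B - A * derivative B) ^ 2 =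
      C ((c : K) ^ 2) * (B * (A ^ 3 + C (S.a₄ : K) * A * B ^ 2 + C (S.a₆ : K) * B ^ 3)) := by
    rcases hα.differential with ⟨h, -⟩ | ⟨X, U, h, h₁, -⟩
    · exact absurd h h0
    have e₁ : X * algebraMap K[X] (RatFunc K) B = algebraMap K[X] (RatFunc K) A := by
      have := (h.xRep).cross hAB.2
      rw [mul_one, polyHom, RingHom.comp_apply, RingHom.comp_apply, ← map_mul] at this
      exact (algebraMap (RatFunc K) (RatFuncBar K)).injective this
    have e₂ : algebraMap K[X] (RatFunc K) (cubic S K) * U ^ 2 = X ^ 3 + S.a₄ * X + S.a₆ := by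
      have := h.equation
      rw [mul_pow, sq_eq_polyHom_cubic hg, curve_a₄, curve_a₆] at this
      apply (algebraMap (RatFunc K) (RatFuncBar K)).injective
      rw [map_mul, map_pow]
      exact this.trans (by simp)
    have e₃ := congrArg (ratDeriv K) e₁
    rw [derivation_mul, ratDeriv_algebraMap, ratDeriv_algebraMap, h₁] at e₃
    apply IsFractionRing.injective K[X] (RatFunc K)
    simp only [map_mul, map_sub, map_pow, map_add, map_intCast]
    rw [← e₃, ← e₁]
    linear_combination (c : RatFunc K) ^ 2 * algebraMap K[X] (RatFunc K) B ^ 4 * e₂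
  obtain ⟨hdeg, hmul⟩ := rootMultiplicity_and_natDegree_of_differential_identity hAB.1 hB hlt
    (natDegree_cubic S) hc hid
  have hker : ∀ P : Points S K, αK P = 0 ↔
      (P = 0 ∨ ∃ x ∈ B.roots.toFinset, ∃ y, HasCoords P x y) := by
    intro P
    by_cases hP : P = 0
    · simp [hP]
    obtain ⟨x, y, hP'⟩ := exists_hasCoords hP
    have hx := hα.compat.xRep_eval hΔ hg hAB hP'
    constructor
    · intro h
      refine .inr ⟨x, ?_, y, hP'⟩
      rw [Multiset.mem_toFinset, mem_roots hB, IsRoot]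
      rcases hx with ⟨_, _, h'⟩ | ⟨_, _, h', _⟩
      · exact h'
      · exact absurd h h'.ne_zero
    · rintro (h | ⟨x', hx', y', h⟩)
      · exact absurd h hP
      · rw [Multiset.mem_toFinset, mem_roots hB, IsRoot, ← (hP'.unique h).1] at hx'
        rcases hx with ⟨h', _⟩ | ⟨_, _, _, h', _⟩
        · exact h'
        · exact absurd hx' h'
  have hcard : Nat.card αK.ker =
      Nat.card {P : Points S K // P = 0 ∨ ∃ x ∈ B.roots.toFinset, ∃ y, HasCoords P x y} :=
    Nat.card_congr (Equiv.subtypeEquivRight hker)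
  rw [hcard, card_points_over hΔ, hAB.height_eq, max_eq_left hlt.le, hdeg]
  congr 1
  rw [← IsAlgClosed.card_roots_eq_natDegree, ← Multiset.toFinset_sum_count_eq]
  refine Finset.sum_congr rfl fun x hx => ?_
  rw [Multiset.mem_toFinset, mem_roots hB] at hx
  rw [count_roots, hmul x hx, eval_cubic]

end IsEndo

end Endomorphisms

end ShortWeierstrass

/-! ### The degree as a quadratic form: torsion points and Frobenius -/

namespace ShortWeierstrass

open WeierstrassCurve Polynomial

section Parallelogram

variable {G : Type*} [AddCommGroup G]

/-- The bilinear form attached to a function satisfying the parallelogram law. -/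
def polar (h : G → ℤ) (x y : G) : ℤ := h (x + y) - h x - h y

variable {h : G → ℤ} (hp : ∀ x y, h (x + y) + h (x - y) = 2 * h x + 2 * h y)

theorem polar_comm (x y : G) : polar h x y = polar h y x := by
  rw [polar, polar, add_comm]
  ring

include hp

theorem polar_add_left (x y z : G) : polar h (x + y) z = polar h x z + polar h y z := by
  have e₁ := hp (x + z) y
  have e₂ := hp x (z - y)
  have e₃ := hp (x + y) z
  have e₄ := hp z y
  rw [show x + z + y = x + y + z by abel] at e₁
  rw [show x + (z - y) = x + z - y by abel, show x - (z - y) = x + y - z by abel] at e₂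
  rw [polar, polar, polar, add_comm y z]
  linarith

/-- The bilinear form attached to a function satisfying the parallelogram law, as a homomorphism. -/
def polarHom : G →+ G →+ ℤ :=
  AddMonoidHom.mk' (fun x => AddMonoidHom.mk' (polar h x) fun y z => by
    rw [polar_comm, polar_add_left hp, polar_comm y, polar_comm z]) fun x y => by
    ext z
    exact polar_add_left hp x y z

theorem polarHom_apply (x y : G) : polarHom hp x y = polar h x y := rfl

theorem polarHom_comm (x y : G) : polarHom hp x y = polarHom hp y x := polar_comm x y

theorem polarHom_self (x : G) : polarHom hp x x = 2 * h x := by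
  have h0 := hp 0 0
  have hx := hp x x
  rw [add_zero, sub_zero] at h0
  rw [sub_self] at hx
  rw [polarHom_apply, polar]
  linarith

theorem map_zsmul_sub (n : ℤ) (x y : G) :
    h (n • x - y) = n ^ 2 * h x - polarHom hp x y * n + h y := by
  have := polarHom_self hp (n • x - y)
  simp only [map_sub, map_zsmul, AddMonoidHom.sub_apply, AddMonoidHom.smul_apply, smul_eq_mul,
    polarHom_self hp, polarHom_comm hp y x] at this
  linarith

theorem map_sub_zsmul_add_zsmul (β q : ℤ) (x y z : G) :
    h (z - β • y + q • x) = h z + β ^ 2 * h y + q ^ 2 * h x - β * polarHom hp y z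
      - β * q * polarHom hp x y + q * polarHom hp x z := by
  have := polarHom_self hp (z - β • y + q • x)
  simp only [map_sub, map_add, map_zsmul, AddMonoidHom.sub_apply, AddMonoidHom.add_apply,
    AddMonoidHom.smul_apply, smul_eq_mul, polarHom_self hp, polarHom_comm hp y x,
    polarHom_comm hp z x, polarHom_comm hp z y] at this
  linarith

theorem polarHom_of_map {f : G → G} (hf : ∀ x y, f (x + y) = f x + f y) {q : ℤ}
    (hq : ∀ x, h (f x) = q * h x) (x y : G) :
    polarHom hp (f x) (f y) = q * polarHom hp x y := by
  rw [polarHom_apply, polarHom_apply, polar, polar, ← hf, hq, hq, hq]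
  ring

end Parallelogram

section Degree

open scoped Classical

variable {K : Type*} [Field K] {S : WeierstrassCurve ℤ} [S.IsShortNF]

theorem exists_genericPoint (hΔ : (curve S K).Δ ≠ 0) :
    ∃ (g : Points S (RatFuncBar K)) (s : RatFuncBar K), HasCoords g (polyHom K X) s := by
  obtain ⟨s, hs⟩ := IsAlgClosed.exists_pow_nat_eq (polyHom K X ^ 3 +
    (curve S (RatFuncBar K)).a₄ * polyHom K X + (curve S (RatFuncBar K)).a₆) two_pos
  obtain ⟨g, hg⟩ := exists_point_of_equation
    (discr_ne_zero_of_hom ((polyHom K).comp C) hΔ) (equation_short.2 hs)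
  exact ⟨g, s, hg⟩

variable {g : Points S (RatFuncBar K)} {s : RatFuncBar K} (hg : HasCoords g (polyHom K X) s)

/-- The group of the points `(X, s U)` with `X, U ∈ K(t)` for which the invariant differential
takes the expected shape. It is the group of the endomorphisms of the curve, through their values
at the generic point. -/
def differentialPoints : AddSubgroup (Points S (RatFuncBar K)) where
  carrier := {P | ∃ c, HasGenericDifferential s P c}
  zero_mem' := ⟨0, .inl ⟨rfl, rfl⟩⟩
  add_mem' := fun ⟨_, h⟩ ⟨_, h'⟩ =>
    ⟨_, h.add (genericRoot_ne_zero hg) (sq_eq_polyHom_cubic hg) h'⟩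
  neg_mem' := fun ⟨_, h⟩ => ⟨_, h.neg⟩

/-- The height as an integer-valued function on the group of endomorphisms. -/
noncomputable def degree (P : differentialPoints hg) : ℤ := height P.1

theorem degree_parallelogram [IsAlgClosed K] (hΔ : (curve S K).Δ ≠ 0)
    (P Q : differentialPoints hg) :
    degree hg (P + Q) + degree hg (P - Q) = 2 * degree hg P + 2 * degree hg Q := by
  obtain ⟨_, hP⟩ := P.2
  obtain ⟨_, hQ⟩ := Q.2
  obtain ⟨_, hPQ⟩ := (P + Q).2
  obtain ⟨_, hPQ'⟩ := (P - Q).2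
  obtain ⟨_, _, hP⟩ := hP.exists_coprimeXRep
  obtain ⟨_, _, hQ⟩ := hQ.exists_coprimeXRep
  obtain ⟨_, _, hPQ⟩ := hPQ.exists_coprimeXRep
  obtain ⟨_, _, hPQ'⟩ := hPQ'.exists_coprimeXRep
  simp only [degree]
  exact_mod_cast height_add_add_height_sub hΔ hP hQ hPQ hPQ'

/-- The generic point, as an element of `differentialPoints`. -/
noncomputable def genericElement : differentialPoints hg :=
  ⟨g, _, hasGenericDifferential_generic hg⟩

theorem degree_genericElement : degree hg (genericElement hg) = 1 := by
  have : CoprimeXRep g (X : K[X]) 1 := ⟨isCoprime_one_right, by rw [map_one]; exact hg.xRep⟩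
  rw [degree, genericElement, this.height_eq]
  simp

theorem degree_zero : degree hg 0 = 0 := by
  have : CoprimeXRep (0 : Points S (RatFuncBar K)) (1 : K[X]) 0 :=
    ⟨isCoprime_one_left, by rw [map_one, map_zero]; exact xRep_zero⟩
  have h : height (0 : Points S (RatFuncBar K)) = 0 := this.height_eq.trans (by simp)
  simp [degree, h]

omit [S.IsShortNF] in
theorem height_frobenius {q : ℕ} [Fact q.Prime] [ExpChar (RatFuncBar K) q]
    {P : Points S (RatFuncBar K)} {c : RatFunc K} (h : HasGenericDifferential s P c) :
    height (mapPt (frobenius (RatFuncBar K) q) P) = q * height P := by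
  obtain ⟨A, B, hAB⟩ := h.exists_coprimeXRep
  have h' : CoprimeXRep (mapPt (frobenius (RatFuncBar K) q) P) (A ^ q) (B ^ q) := by
    refine ⟨hAB.1.pow, ?_⟩
    have := hAB.2.mapPt (frobenius (RatFuncBar K) q)
    rwa [frobenius_def, frobenius_def, ← map_pow, ← map_pow] at this
  rw [hAB.height_eq, h'.height_eq, natDegree_pow, natDegree_pow, Nat.mul_max_mul_left]

/-- The number of points of order dividing `n` over an algebraically closed field in which `n` is
invertible. -/
theorem card_torsion [IsAlgClosed K] (hΔ : (curve S K).Δ ≠ 0) (n : ℕ) (hn : (n : K) ≠ 0) :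
    Nat.card {P : Points S K // n • P = 0} = n ^ 2 := by
  obtain ⟨g, s, hg⟩ := exists_genericPoint hΔ
  have hα := (IsEndo.id hg).zsmul hg hΔ n
  have hcard := hα.card_ker hg hΔ (by simpa using hn)
  have h1 : Nat.card {P : Points S K // n • P = 0} =
      Nat.card ((n : ℤ) • AddMonoidHom.id (Points S K)).ker :=
    Nat.card_congr (Equiv.subtypeEquivRight fun P => by
      rw [AddMonoidHom.mem_ker, AddMonoidHom.smul_apply, AddMonoidHom.id_apply, natCast_zsmul])
  have h2 := map_zsmul_sub (degree_parallelogram hg hΔ) n (genericElement hg) 0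
  rw [sub_zero, map_zero, degree_zero, degree_genericElement] at h2
  rw [h1, hcard]
  zify
  refine Eq.trans ?_ (h2.trans (by ring))
  simp [degree, genericElement]

/-- The kernel of the composite of two homomorphisms, the first of which is surjective. -/
theorem card_ker_comp {G H M : Type*} [AddCommGroup G] [AddCommGroup H] [AddCommGroup M]
    (χ : H →+ M) {ψ : G →+ H} (hψ : Function.Surjective ψ) :
    Nat.card (χ.comp ψ).ker = Nat.card χ.ker * Nat.card ψ.ker := by
  obtain ⟨s, hs⟩ := hψ.hasRightInverse
  rw [← Nat.card_prod]
  exact Nat.card_congr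
    { toFun := fun x => (⟨ψ x, x.2⟩, ⟨x - s (ψ x), by
        rw [AddMonoidHom.mem_ker, map_sub, hs, sub_self]⟩)
      invFun := fun y => ⟨s y.1 + y.2, by
        rw [AddMonoidHom.mem_ker, AddMonoidHom.comp_apply, map_add, hs,
          (AddMonoidHom.mem_ker).1 y.2.2, add_zero]
        exact y.1.2⟩
      left_inv := fun x => Subtype.ext (add_sub_cancel _ _)
      right_inv := fun y => by
        have h : ψ (s y.1 + y.2) = y.1 := by
          rw [map_add, hs, (AddMonoidHom.mem_ker).1 y.2.2, add_zero]
        refine Prod.ext (Subtype.ext h) (Subtype.ext ?_)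
        dsimp only
        rw [h, add_sub_cancel_left] }

/-- The characteristic polynomial of Frobenius: `β` is its trace, and its values at the integers
prime to `q` count the points in the kernels of `n - φ`. -/
theorem exists_frobenius_charpoly [IsAlgClosed K] (hΔ : (curve S K).Δ ≠ 0) {q : ℕ} (hq : Odd q)
    [Fact q.Prime] [CharP K q] (φ : Points S K →+ Points S K)
    (hφ : ∀ P x y, HasCoords P x y → HasCoords (φ P) (x ^ q) (y ^ q)) :
    ∃ β : ℤ, (∀ n : ℤ, ¬ (q : ℤ) ∣ n →
        (Nat.card {P : Points S K // n • P = φ P} : ℤ) = n ^ 2 - β * n + q) ∧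
      ∀ P, φ (φ P) - β • φ P + (q : ℤ) • P = 0 := by
  have : ExpChar K q := ExpChar.prime Fact.out
  have : ExpChar (RatFuncBar K) q :=
    expChar_of_injective_ringHom (f := (polyHom K).comp C)
      ((polyHom_injective (K := K)).comp C_injective) q
  obtain rfl : φ = mapPt (frobenius K q) := by
    ext1 P
    by_cases hP : P = 0
    · simp [hP]
    obtain ⟨x, y, hP⟩ := exists_hasCoords hP
    exact (hφ P x y hP).ext (hP.mapPt (frobenius K q))
  obtain ⟨g, s, hg⟩ := exists_genericPoint hΔ
  set φK := mapPt (S := S) (frobenius K q)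
  set φΩ := mapPt (S := S) (frobenius (RatFuncBar K) q)
  have hp := degree_parallelogram hg hΔ
  have h₀ := IsEndo.id hg
  have h₁ := h₀.frobenius_comp hg hΔ hq
  have h₂ := h₁.frobenius_comp hg hΔ hq
  let F : differentialPoints hg → differentialPoints hg := fun P =>
    ⟨φΩ P.1, 0, P.2.choose_spec.frobenius hg hq⟩
  have hF : ∀ P Q, F (P + Q) = F P + F Q := fun P Q => Subtype.ext (map_add φΩ P.1 Q.1)
  have hFh : ∀ P, degree hg (F P) = q * degree hg P := fun P => by
    have := height_frobenius (q := q) P.2.choose_spec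
    simp only [degree]
    exact_mod_cast this
  let e₀ : differentialPoints hg := genericElement hg
  have he₀ : degree hg e₀ = 1 := degree_genericElement hg
  set β := polarHom hp e₀ (F e₀) with hβ
  have hcast : ∀ n : ℤ, ¬ (q : ℤ) ∣ n → (n : K) ≠ 0 := fun n hn h =>
    hn ((CharP.intCast_eq_zero_iff K q n).1 h)
  -- the degree of `n - φ`, by expansion of the quadratic form
  have hcount : ∀ n : ℤ, ¬ (q : ℤ) ∣ n →
      (Nat.card {P : Points S K // n • P = φK P} : ℤ) = n ^ 2 - β * n + q := by
    intro n hn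
    have hα := (h₀.zsmul hg hΔ n).add hg hΔ (h₁.zsmul hg hΔ (-1))
    have hcard := hα.card_ker hg hΔ (by simpa using hcast n hn)
    refine (congrArg Nat.cast ((Nat.card_congr (Equiv.subtypeEquivRight fun P => ?_)).trans
      hcard)).trans ?_
    · rw [AddMonoidHom.mem_ker, AddMonoidHom.add_apply, AddMonoidHom.smul_apply,
        AddMonoidHom.smul_apply, AddMonoidHom.comp_apply, AddMonoidHom.id_apply, neg_smul,
        one_smul, ← sub_eq_add_neg, sub_eq_zero]
    have h := map_zsmul_sub hp n e₀ (F e₀)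
    rw [hFh, he₀, mul_one, mul_one, ← hβ] at h
    rw [← h]
    simp [degree, genericElement, e₀, F, φΩ, sub_eq_add_neg]
  refine ⟨β, hcount, fun P => ?_⟩
  have hq1 : ¬ (q : ℤ) ∣ 1 := by
    intro h
    have := Int.eq_one_of_dvd_one (by positivity) h
    exact (Fact.out : q.Prime).one_lt.ne' (by exact_mod_cast this)
  -- The product `⟨1, φ²⟩` for the polar form is found by counting the kernel of
  -- `φ² - 1 = (φ - 1) (φ + 1)` in two ways.
  have hm := hcount 1 hq1
  have hm' := hcount (-1) (by simpa using hq1)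
  have hsq : (Nat.card {P : Points S K // P = φK (φK P)} : ℤ) =
      1 - polarHom hp e₀ (F (F e₀)) + q ^ 2 := by
    have hα := h₀.add hg hΔ (h₂.zsmul hg hΔ (-1))
    have hcard := hα.card_ker hg hΔ (by simp)
    refine (congrArg Nat.cast ((Nat.card_congr (Equiv.subtypeEquivRight fun P => ?_)).trans
      hcard)).trans ?_
    · rw [AddMonoidHom.mem_ker, AddMonoidHom.add_apply, AddMonoidHom.smul_apply,
        AddMonoidHom.comp_apply, AddMonoidHom.comp_apply, AddMonoidHom.id_apply, neg_smul,
        one_smul, ← sub_eq_add_neg, sub_eq_zero]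
    have h := map_zsmul_sub hp 1 e₀ (F (F e₀))
    rw [hFh, hFh, he₀, one_pow, mul_one, mul_one, mul_one] at h
    rw [sq (q : ℤ), ← h]
    simp [degree, genericElement, e₀, F, φΩ, sub_eq_add_neg]
  have hprod : (Nat.card {P : Points S K // P = φK (φK P)} : ℤ) =
      Nat.card {P : Points S K // (1 : ℤ) • P = φK P} *
        Nat.card {P : Points S K // (-1 : ℤ) • P = φK P} := by
    have hsurj : Function.Surjective ⇑(φK + AddMonoidHom.id (Points S K)) :=
      (h₁.add hg hΔ h₀).surjective hg hΔ (by simp)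
    have h := card_ker_comp (φK - AddMonoidHom.id _) hsurj
    have k₁ : Nat.card {P : Points S K // P = φK (φK P)} = _ :=
      Nat.card_congr (Equiv.subtypeEquivRight
        (q := (· ∈ ((φK - AddMonoidHom.id _).comp (φK + AddMonoidHom.id _)).ker)) fun P => by
        rw [AddMonoidHom.mem_ker, AddMonoidHom.comp_apply, AddMonoidHom.sub_apply,
          AddMonoidHom.add_apply, AddMonoidHom.id_apply, AddMonoidHom.id_apply, map_add,
          add_comm (φK P), add_sub_add_right_eq_sub, sub_eq_zero, eq_comm])
    have k₂ : Nat.card {P : Points S K // (1 : ℤ) • P = φK P} = _ :=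
      Nat.card_congr (Equiv.subtypeEquivRight
        (q := (· ∈ (φK - AddMonoidHom.id _).ker)) fun P => by
        rw [AddMonoidHom.mem_ker, AddMonoidHom.sub_apply, AddMonoidHom.id_apply, sub_eq_zero,
          one_smul, eq_comm])
    have k₃ : Nat.card {P : Points S K // (-1 : ℤ) • P = φK P} = _ :=
      Nat.card_congr (Equiv.subtypeEquivRight
        (q := (· ∈ (φK + AddMonoidHom.id _).ker)) fun P => by
        rw [AddMonoidHom.mem_ker, AddMonoidHom.add_apply, AddMonoidHom.id_apply,
          neg_smul, one_smul, eq_comm, eq_neg_iff_add_eq_zero])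
    rw [k₁, k₂, k₃]
    exact_mod_cast h
  have hγ : polarHom hp e₀ (F (F e₀)) = β ^ 2 - 2 * q := by
    rw [hsq, hm, hm'] at hprod
    linarith
  -- with all the products known, the degree of `φ² - β φ + q` is zero
  have hα := (h₂.add hg hΔ (h₁.zsmul hg hΔ (-β))).add hg hΔ (h₀.zsmul hg hΔ q)
  have h := map_sub_zsmul_add_zsmul hp β q e₀ (F e₀) (F (F e₀))
  rw [polarHom_of_map hp hF hFh, ← hβ, hγ, hFh, hFh, he₀] at h
  have hzero := hα.height_eq_zero hg hΔ (by
    refine Int.natCast_inj.1 (Eq.trans ?_ (h.trans (by ring)))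
    simp [degree, genericElement, e₀, F, φΩ, sub_eq_add_neg])
  have := DFunLike.congr_fun hzero P
  simpa [sub_eq_add_neg] using this

end Degree

end ShortWeierstrass

/-! ### Primes of the ring of integers of `ℚ̄` -/

namespace ShortWeierstrass

open WeierstrassCurve Polynomial

instance : Algebra.IsAlgebraic ℚ QBar := by
  have h := AlgebraicClosure.isAlgebraic ℚ
  rwa [Subsingleton.elim (AlgebraicClosure.instAlgebra ℚ) (DivisionRing.toRatAlgebra)] at h

instance : IsAlgClosure ℚ QBar := ⟨inferInstance, inferInstance⟩

instance : Normal ℚ QBar := IsAlgClosure.normal ℚ QBar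

instance : IsGalois ℚ QBar := ⟨⟩

section Prufer

variable {L : Type*} [Field L]

/-- A field element which is a root of a polynomial with coefficients in `𝓞 L`, not all of them in
the prime `𝔮`, is, up to inversion, in the localization of `𝓞 L` at `𝔮`. -/
theorem exists_denominator_of_root (𝔮 : Ideal (𝓞 L)) (x : L) (n : ℕ) :
    ∀ p : (𝓞 L)[X], p.natDegree ≤ n → aeval x p = 0 → (∃ i, p.coeff i ∉ 𝔮) →
      ∃ a b : 𝓞 L, algebraMap (𝓞 L) L a = x * algebraMap (𝓞 L) L b ∧ (a ∉ 𝔮 ∨ b ∉ 𝔮) := by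
  induction n with
  | zero =>
    rintro p hp hx ⟨i, hi⟩
    rw [eq_C_of_natDegree_le_zero hp] at hx hi
    rw [aeval_C] at hx
    rw [NumberField.RingOfIntegers.coe_eq_zero_iff.1 hx] at hi
    simp at hi
  | succ n ih =>
    rintro p hp hx ⟨i, hi⟩
    have hint : IsIntegral ℤ (algebraMap (𝓞 L) L (p.coeff (n + 1)) * x) := by
      apply isIntegral_trans (R := ℤ) (A := 𝓞 L)
      by_cases h : p.natDegree = n + 1
      · have := isIntegral_leadingCoeff_smul p x hx
        rwa [leadingCoeff, h, Algebra.smul_def] at this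
      · rw [coeff_eq_zero_of_natDegree_lt (by omega), map_zero, zero_mul]
        exact isIntegral_zero
    let c : 𝓞 L := ⟨_, hint⟩
    have hc : algebraMap (𝓞 L) L c = x * algebraMap (𝓞 L) L (p.coeff (n + 1)) := mul_comm _ _
    by_cases h1 : p.coeff (n + 1) ∉ 𝔮
    · exact ⟨c, _, hc, .inr h1⟩
    by_cases h2 : c ∉ 𝔮
    · exact ⟨c, _, hc, .inl h2⟩
    rw [not_not] at h1 h2
    -- replace the leading term `p_{n+1} X^{n+1}` by `c X^n`
    have hcoeff : ∀ j, (p - C (p.coeff (n + 1)) * X ^ (n + 1) + C c * X ^ n).coeff j =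
        p.coeff j - (if j = n + 1 then p.coeff (n + 1) else 0) + if j = n then c else 0 := by
      intro j
      rw [coeff_add, coeff_sub, coeff_C_mul_X_pow, coeff_C_mul_X_pow]
    refine ih (p - C (p.coeff (n + 1)) * X ^ (n + 1) + C c * X ^ n) ?_ ?_ ⟨i, ?_⟩
    · rw [natDegree_le_iff_coeff_eq_zero]
      intro j hj
      rw [hcoeff, if_neg (by omega : j ≠ n), add_zero]
      split_ifs with h
      · rw [h, sub_self]
      · rw [coeff_eq_zero_of_natDegree_lt (by omega), sub_zero]
    · rw [map_add, map_sub, hx, map_mul, map_mul, aeval_C, aeval_C, map_pow, map_pow, aeval_X, hc]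
      ring
    · have hin : i ≠ n + 1 := by
        rintro rfl
        exact hi h1
      rw [hcoeff, if_neg hin, sub_zero]
      split_ifs
      · intro h
        exact hi (by simpa using sub_mem h h2)
      · rwa [add_zero]

end Prufer

theorem intCast_mem_iff {q : ℕ} (hq : q.Prime) {𝔮 : Ideal (𝓞 QBar)} (h𝔮 : IsPrimeAbove q 𝔮)
    (n : ℤ) : (n : 𝓞 QBar) ∈ 𝔮 ↔ (q : ℤ) ∣ n := by
  constructor
  · intro hn
    by_contra h
    have hco : IsCoprime (q : ℤ) n := (Nat.prime_iff_prime_int.1 hq).coprime_iff_not_dvd.2 h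
    obtain ⟨u, v, e⟩ := hco
    apply h𝔮.1.ne_top
    rw [Ideal.eq_top_iff_one]
    have := 𝔮.add_mem (𝔮.mul_mem_left (u : 𝓞 QBar) h𝔮.2) (𝔮.mul_mem_left (v : 𝓞 QBar) hn)
    have e' := congrArg (Int.cast : ℤ → 𝓞 QBar) e
    push_cast at e'
    rwa [e'] at this
  · rintro ⟨m, rfl⟩
    push_cast
    exact 𝔮.mul_mem_right _ h𝔮.2

/-- The localization at `𝔮` of the ring of integers of `ℚ̄`, as a valuation ring of `ℚ̄`. -/
def localRing {q : ℕ} (hq : q.Prime) {𝔮 : Ideal (𝓞 QBar)} (h𝔮 : IsPrimeAbove q 𝔮) :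
    ValuationSubring QBar where
  carrier := {x | ∃ a b : 𝓞 QBar, b ∉ 𝔮 ∧
    algebraMap (𝓞 QBar) QBar a = x * algebraMap (𝓞 QBar) QBar b}
  mul_mem' := by
    rintro x y ⟨a, b, hb, e⟩ ⟨a', b', hb', e'⟩
    refine ⟨a * a', b * b', fun h => (h𝔮.1.mem_or_mem h).elim hb hb', ?_⟩
    rw [map_mul, map_mul, e, e']
    ring
  one_mem' := ⟨1, 1, h𝔮.1.one_notMem, by simp⟩
  add_mem' := by
    rintro x y ⟨a, b, hb, e⟩ ⟨a', b', hb', e'⟩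
    refine ⟨a * b' + a' * b, b * b', fun h => (h𝔮.1.mem_or_mem h).elim hb hb', ?_⟩
    rw [map_add, map_mul, map_mul, map_mul, e, e']
    ring
  zero_mem' := ⟨0, 1, h𝔮.1.one_notMem, by simp⟩
  neg_mem' := by
    rintro x ⟨a, b, hb, e⟩
    exact ⟨-a, b, hb, by rw [map_neg, e, neg_mul]⟩
  mem_or_inv_mem' := by
    intro x
    by_cases hx : x = 0
    · exact .inl ⟨0, 1, h𝔮.1.one_notMem, by simp [hx]⟩
    have halg : IsAlgebraic ℤ x :=
      (IsFractionRing.isAlgebraic_iff ℤ ℚ QBar).2 (Algebra.IsAlgebraic.isAlgebraic x)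
    obtain ⟨p, hp0, hp⟩ := halg
    have hprim : ∃ i, ¬ (q : ℤ) ∣ p.primPart.coeff i := by
      by_contra! H
      have h1 := p.isPrimitive_primPart (q : ℤ) ((C_dvd_iff_dvd_coeff _ _).2 H)
      rw [Int.isUnit_iff] at h1
      have := hq.two_le
      omega
    obtain ⟨i, hi⟩ := hprim
    obtain ⟨a, b, e, h⟩ := exists_denominator_of_root 𝔮 x _
      (p.primPart.map (Int.castRingHom (𝓞 QBar))) le_rfl (by
        rw [aeval_def, eval₂_map]
        have := aeval_primPart_eq_zero hp0 hp
        rw [aeval_def] at this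
        rw [← this]
        congr 1) ⟨i, by
          rw [coeff_map, eq_intCast, intCast_mem_iff hq h𝔮]
          exact hi⟩
    rcases h with h | h
    · exact .inr ⟨b, a, h, by rw [e, inv_mul_cancel_left₀ hx]⟩
    · exact .inl ⟨a, b, h, e⟩

section LocalRing

variable {q : ℕ} {hq : q.Prime} {𝔮 : Ideal (𝓞 QBar)} {h𝔮 : IsPrimeAbove q 𝔮}

theorem coe_mem_localRing (a : 𝓞 QBar) : algebraMap (𝓞 QBar) QBar a ∈ localRing hq h𝔮 :=
  ⟨a, 1, h𝔮.1.one_notMem, by simp⟩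

theorem reducesTo_zero_of_mem {a : 𝓞 QBar} (ha : a ∈ 𝔮) :
    ReducesTo (localRing hq h𝔮) (algebraMap (𝓞 QBar) QBar a) 0 := by
  by_cases h0 : algebraMap (𝓞 QBar) QBar a = 0
  · rw [h0]; exact .zero
  rw [← inv_inv (algebraMap (𝓞 QBar) QBar a)]
  apply ReducesTo.inv_of_notMem
  rintro ⟨c, b, hb, e⟩
  have : b = a * c := by
    apply NumberField.RingOfIntegers.coe_injective
    rw [map_mul, e, mul_inv_cancel_left₀ h0]
  exact hb (this ▸ 𝔮.mul_mem_right c ha)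

theorem ne_zero_of_notMem {b : 𝓞 QBar} (hb : b ∉ 𝔮) {β : IsLocalRing.ResidueField (localRing hq h𝔮)}
    (h : ReducesTo (localRing hq h𝔮) (algebraMap (𝓞 QBar) QBar b) β) : β ≠ 0 := by
  rintro rfl
  have hb0 : algebraMap (𝓞 QBar) QBar b ≠ 0 := by
    intro h
    exact hb ((NumberField.RingOfIntegers.coe_eq_zero_iff.1 h) ▸ 𝔮.zero_mem)
  exact h.inv_notMem hb0 ⟨1, b, hb, by rw [map_one, inv_mul_cancel₀ hb0]⟩

/-- An automorphism of `ℚ̄` that acts as `a ↦ a ^ e` on the residue classes of algebraic integers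
acts in this way on the residue field of the valuation ring. The exponent is `q` for Frobenius
elements, and `1` for elements of the inertia group. -/
theorem reducesTo_of_smul_sub_pow_mem {σ : GQ} {e : ℕ}
    (hσ : ∀ a : 𝓞 QBar, σ • a - a ^ e ∈ 𝔮) {x : QBar}
    {ξ : IsLocalRing.ResidueField (localRing hq h𝔮)} (h : ReducesTo (localRing hq h𝔮) x ξ) :
    ReducesTo (localRing hq h𝔮) (σ x) (ξ ^ e) := by
  have hint : ∀ (a : 𝓞 QBar) (α : IsLocalRing.ResidueField (localRing hq h𝔮)),
      ReducesTo (localRing hq h𝔮) (algebraMap (𝓞 QBar) QBar a) α →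
        ReducesTo (localRing hq h𝔮) (σ (algebraMap (𝓞 QBar) QBar a)) (α ^ e) := by
    intro a α hα
    have := (reducesTo_zero_of_mem (hq := hq) (h𝔮 := h𝔮) (hσ a)).add (hα.pow e)
    rw [zero_add, map_sub, map_pow, sub_add_cancel] at this
    exact this
  obtain ⟨a, b, hb, hab⟩ := h.1
  have hb0 : algebraMap (𝓞 QBar) QBar b ≠ 0 := by
    intro h
    exact hb ((NumberField.RingOfIntegers.coe_eq_zero_iff.1 h) ▸ 𝔮.zero_mem)
  obtain ⟨α, hα⟩ := exists_reducesTo (coe_mem_localRing (hq := hq) (h𝔮 := h𝔮) a)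
  obtain ⟨β, hβ⟩ := exists_reducesTo (coe_mem_localRing (hq := hq) (h𝔮 := h𝔮) b)
  have hβ0 := ne_zero_of_notMem hb hβ
  have hx : x = algebraMap (𝓞 QBar) QBar a / algebraMap (𝓞 QBar) QBar b := by
    rw [hab, mul_div_cancel_right₀ _ hb0]
  have hξ : ξ = α / β := h.unique (hx ▸ hα.div hβ hβ0)
  rw [hξ, hx, map_div₀, div_pow]
  exact (hint a α hα).div (hint b β hβ) (pow_ne_zero e hβ0)

theorem notMem_of_smul_sub_pow_mem {σ : GQ} {e : ℕ} (he : e ≠ 0)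
    (hσ : ∀ a : 𝓞 QBar, σ • a - a ^ e ∈ 𝔮) {x : QBar} (h : x ∉ localRing hq h𝔮) :
    σ x ∉ localRing hq h𝔮 := by
  have hx : x ≠ 0 := by rintro rfl; exact h (zero_mem _)
  have := reducesTo_of_smul_sub_pow_mem hσ (ReducesTo.inv_of_notMem h)
  rw [zero_pow he, map_inv₀] at this
  simpa using this.inv_notMem (inv_ne_zero (by simpa using hx))

instance : CharP (IsLocalRing.ResidueField (localRing hq h𝔮)) q := by
  have h0 : (q : IsLocalRing.ResidueField (localRing hq h𝔮)) = 0 := by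
    refine (ReducesTo.natCast q).unique ?_
    simpa using reducesTo_zero_of_mem (hq := hq) (h𝔮 := h𝔮) h𝔮.2
  have := CharP.exists (IsLocalRing.ResidueField (localRing hq h𝔮))
  obtain ⟨r, hr⟩ := this
  have hdvd := (CharP.cast_eq_zero_iff _ r q).1 h0
  rcases (Nat.dvd_prime hq).1 hdvd with rfl | rfl
  · exact absurd rfl (CharP.char_ne_one (IsLocalRing.ResidueField (localRing hq h𝔮)) 1)
  · exact hr

end LocalRing

/-- The residue field of a valuation ring of an algebraically closed field is algebraically
closed. -/
theorem isAlgClosed_residueField {L : Type*} [Field L] [IsAlgClosed L] (O : ValuationSubring L) :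
    IsAlgClosed (IsLocalRing.ResidueField O) := by
  apply IsAlgClosed.of_exists_root
  intro p hp hirr
  obtain ⟨P, hP, hdeg, hmon⟩ := lifts_and_natDegree_eq_and_monic
    ((mem_lifts p).2 (map_surjective _ (IsLocalRing.residue_surjective (R := O)) p)) hp
  obtain ⟨x, hx⟩ := IsAlgClosed.exists_aeval_eq_zero L P (by
    rw [degree_eq_natDegree hmon.ne_zero, hdeg]
    exact_mod_cast (hirr.natDegree_pos).ne')
  have hint : IsIntegral O x := ⟨P, hmon, hx⟩
  obtain ⟨y, rfl⟩ := IsIntegrallyClosed.isIntegral_iff.1 hint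
  refine ⟨IsLocalRing.residue O y, ?_⟩
  rw [aeval_algebraMap_apply, coe_aeval_eq_eval] at hx
  have hy : P.eval y = 0 := by
    apply (IsFractionRing.injective O L)
    rw [map_zero]
    exact hx
  rw [← hP, eval_map, eval₂_hom, hy, map_zero]

/-! ### Existence of Frobenius elements -/

theorem exists_int_of_forall_smul_eq {a : 𝓞 QBar} (h : ∀ σ : GQ, σ • a = a) :
    ∃ n : ℤ, (n : 𝓞 QBar) = a := by
  have hmem : algebraMap (𝓞 QBar) QBar a ∈ IntermediateField.fixedField (⊤ : Subgroup GQ) := by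
    rintro ⟨σ, -⟩
    exact congrArg (algebraMap (𝓞 QBar) QBar) (h σ)
  rw [InfiniteGalois.fixedField_bot, IntermediateField.mem_bot] at hmem
  obtain ⟨r, hr⟩ := hmem
  have hint : IsIntegral ℤ r := by
    rw [← isIntegral_algebraMap_iff (algebraMap ℚ QBar).injective, hr]
    exact NumberField.RingOfIntegers.isIntegral_coe a
  obtain ⟨n, hn⟩ := IsIntegrallyClosed.isIntegral_iff.1 hint
  refine ⟨n, NumberField.RingOfIntegers.coe_injective ?_⟩
  rw [map_intCast, ← hr, ← hn]
  simp

theorem exists_isPrimeAbove {q : ℕ} (hq : q.Prime) :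
    ∃ 𝔮 : Ideal (𝓞 QBar), 𝔮.IsMaximal ∧ IsPrimeAbove q 𝔮 := by
  have : Fact q.Prime := ⟨hq⟩
  have hne : Ideal.span {(q : 𝓞 QBar)} ≠ ⊤ := by
    intro h
    obtain ⟨b, hb⟩ := Ideal.mem_span_singleton.1 ((Ideal.eq_top_iff_one _).1 h)
    have hint : IsIntegral ℤ ((q : ℚ)⁻¹) := by
      rw [← isIntegral_algebraMap_iff (algebraMap ℚ QBar).injective]
      have h1 := congrArg (algebraMap (𝓞 QBar) QBar) hb
      rw [map_one, map_mul, map_natCast] at h1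
      have h2 : algebraMap ℚ QBar ((q : ℚ)⁻¹) = algebraMap (𝓞 QBar) QBar b := by
        rw [map_inv₀, map_natCast]
        exact inv_eq_of_mul_eq_one_right h1.symm
      rw [h2]
      exact NumberField.RingOfIntegers.isIntegral_coe b
    obtain ⟨n, hn⟩ := IsIntegrallyClosed.isIntegral_iff.1 hint
    have hq0 : (q : ℚ) ≠ 0 := by exact_mod_cast hq.ne_zero
    have h3 : (q : ℤ) * n = 1 := by
      have : (q : ℚ) * n = 1 := by
        rw [show (n : ℚ) = (q : ℚ)⁻¹ from hn, mul_inv_cancel₀ hq0]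
      exact_mod_cast this
    have := Int.eq_one_of_dvd_one (by positivity) ⟨n, h3.symm⟩
    exact hq.one_lt.ne' (by exact_mod_cast this)
  obtain ⟨𝔮, h𝔮, hle⟩ := Ideal.exists_le_maximal _ hne
  exact ⟨𝔮, h𝔮, h𝔮.isPrime, hle (Ideal.mem_span_singleton_self _)⟩

/-- The decomposition group of a maximal ideal `𝔮` above `q` maps onto the group of automorphisms of
the residue field, by the theory of invariants of profinite groups. -/
theorem exists_isFrobenius {q : ℕ} (hq : q.Prime) : ∃ σ : GQ, IsFrobenius q σ := by
  have : Fact q.Prime := ⟨hq⟩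
  obtain ⟨𝔮, hmax, h𝔮⟩ := exists_isPrimeAbove hq
  let : TopologicalSpace (𝓞 QBar) := ⊥
  have : DiscreteTopology (𝓞 QBar) := ⟨rfl⟩
  have : ContinuousSMul GQ (𝓞 QBar) := by
    rw [continuousSMul_iff_stabilizer_isOpen]
    intro a
    convert stabilizer_isOpen_of_isIntegral (K := ℚ) (algebraMap (𝓞 QBar) QBar a) using 1
    ext σ
    exact (NumberField.RingOfIntegers.coe_injective.eq_iff (a := σ • a)).symm
  have : SMulCommClass GQ ℤ (𝓞 QBar) :=
    ⟨fun σ n a => map_zsmul (DistribSMul.toAddMonoidHom (𝓞 QBar) σ) n a⟩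
  have : Algebra.IsInvariant ℤ (𝓞 QBar) GQ := ⟨fun a h => by
    obtain ⟨n, hn⟩ := exists_int_of_forall_smul_eq h
    exact ⟨n, hn⟩⟩
  have : 𝔮.LiesOver (Ideal.span {(q : ℤ)}) := ⟨by
    ext n
    rw [Ideal.mem_span_singleton, Ideal.mem_comap, eq_intCast, intCast_mem_iff hq h𝔮]⟩
  have : (Ideal.span {(q : ℤ)}).IsMaximal :=
    PrincipalIdealRing.isMaximal_of_irreducible (Nat.prime_iff_prime_int.1 hq).irreducible
  let : Field (ℤ ⧸ Ideal.span {(q : ℤ)}) := Ideal.Quotient.field _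
  let : Field (𝓞 QBar ⧸ 𝔮) := Ideal.Quotient.field _
  have : Finite (ℤ ⧸ Ideal.span {(q : ℤ)}) :=
    .of_equiv (ZMod q) (Int.quotientSpanNatEquivZMod q).symm.toEquiv
  let : Fintype (ℤ ⧸ Ideal.span {(q : ℤ)}) := Fintype.ofFinite _
  have hcard : Fintype.card (ℤ ⧸ Ideal.span {(q : ℤ)}) = q := by
    rw [Fintype.card_eq_nat_card, Nat.card_congr (Int.quotientSpanNatEquivZMod q).toEquiv,
      Nat.card_zmod]
  have : Algebra.IsAlgebraic (ℤ ⧸ Ideal.span {(q : ℤ)}) (𝓞 QBar ⧸ 𝔮) := by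
    have : Algebra.IsIntegral (ℤ ⧸ Ideal.span {(q : ℤ)}) (𝓞 QBar ⧸ 𝔮) := inferInstance
    exact this.isAlgebraic
  obtain ⟨σ, hσ⟩ := Ideal.Quotient.stabilizerHom_surjective_of_profinite (G := GQ)
    (Ideal.span {(q : ℤ)}) 𝔮 (FiniteField.frobeniusAlgEquivOfAlgebraic _ _)
  refine ⟨σ, 𝔮, h𝔮, fun a => ?_⟩
  have h1 := DFunLike.congr_fun hσ (Ideal.Quotient.mk 𝔮 a)
  rw [FiniteField.coe_frobeniusAlgEquivOfAlgebraic, hcard] at h1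
  rw [← Ideal.Quotient.eq, map_pow]
  exact h1

end ShortWeierstrass

/-! ### Frobenius and inertia on the torsion points over `ℚ̄` -/

namespace ShortWeierstrass

open WeierstrassCurve Polynomial

open scoped Classical

section FixedPoints

theorem exists_cast_of_pow_eq {K : Type*} [Field K] {q : ℕ} [Fact q.Prime] [CharP K q] {x : K}
    (h : x ^ q = x) : ∃ a : ZMod q, ZMod.castHom dvd_rfl K a = x := by
  by_contra! H
  let f := ZMod.castHom (dvd_refl q) K
  have hq : 1 < q := (Fact.out : q.Prime).one_lt
  -- otherwise `X ^ q - X` would have more than `q` roots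
  have hsub : insert x (Finset.univ.image f) ⊆ (X ^ q - X : K[X]).roots.toFinset := by
    intro y hy
    rw [Multiset.mem_toFinset, mem_roots (FiniteField.X_pow_card_sub_X_ne_zero K hq), IsRoot,
      eval_sub, eval_pow, eval_X, sub_eq_zero]
    rcases Finset.mem_insert.1 hy with rfl | hy
    · exact h
    · obtain ⟨a, -, rfl⟩ := Finset.mem_image.1 hy
      rw [← map_pow, ZMod.pow_card]
  have hx : x ∉ Finset.univ.image f := by
    intro hx
    obtain ⟨a, -, ha⟩ := Finset.mem_image.1 hx
    exact H a ha
  have hcard := (Finset.card_le_card hsub).trans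
    ((Multiset.toFinset_card_le _).trans (card_roots' _))
  rw [Finset.card_insert_of_notMem hx, Finset.card_image_of_injective _ f.injective,
    Finset.card_univ, ZMod.card, FiniteField.X_pow_card_sub_X_natDegree_eq K hq] at hcard
  omega

variable {S : WeierstrassCurve ℤ} [S.IsShortNF]

theorem numPoints_eq (q : ℕ) : numPoints S q =
    Nat.card {P : ZMod q × ZMod q // P.2 ^ 2 = P.1 ^ 3 + S.a₄ * P.1 + S.a₆} + 1 := by
  rw [numPoints]
  congr 1
  refine Nat.card_congr (Equiv.subtypeEquivRight fun P => ?_)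
  rw [Affine.equation_iff]
  simp

/-- The points fixed by Frobenius are the points with coordinates in the prime field. -/
theorem card_frobenius_fixed {K : Type*} [Field K] {q : ℕ} [Fact q.Prime] [CharP K q]
    (hΔ : (curve S K).Δ ≠ 0) (φ : Points S K →+ Points S K)
    (hφ : ∀ P x y, HasCoords P x y → HasCoords (φ P) (x ^ q) (y ^ q)) :
    Nat.card {P : Points S K // (1 : ℤ) • P = φ P} = numPoints S q := by
  rw [numPoints_eq, ← Finite.card_option]
  let f := ZMod.castHom (dvd_refl q) K
  have hT : ∀ t : {P : ZMod q × ZMod q // P.2 ^ 2 = P.1 ^ 3 + S.a₄ * P.1 + S.a₆},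
      ∃ P : Points S K, HasCoords P (f t.1.1) (f t.1.2) := fun t =>
    exists_point_of_equation hΔ (equation_short.2 (by
      rw [curve_a₄, curve_a₆]
      simpa using congrArg f t.2))
  choose F hF using hT
  let G : Option {P : ZMod q × ZMod q // P.2 ^ 2 = P.1 ^ 3 + S.a₄ * P.1 + S.a₆} → Points S K :=
    fun t => t.elim 0 F
  have hG : Function.Injective G := by
    rintro (_ | t) (_ | t') h
    · rfl
    · exact absurd h.symm (hF t').ne_zero
    · exact absurd h (hF t).ne_zero
    · have h' : F t = F t' := h
      obtain ⟨e₁, e₂⟩ := (hF t).unique (h' ▸ hF t')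
      exact congrArg some (Subtype.ext (Prod.ext (f.injective e₁) (f.injective e₂)))
  have hrange : Set.range G = {P : Points S K | (1 : ℤ) • P = φ P} := by
    ext P
    rw [Set.mem_ofPred_eq, one_smul]
    constructor
    · rintro ⟨_ | t, rfl⟩
      · exact (map_zero φ).symm
      · have := hφ _ _ _ (hF t)
        rw [← map_pow, ← map_pow, ZMod.pow_card, ZMod.pow_card] at this
        exact (hF t).ext this
    · intro h
      by_cases hP : P = 0
      · exact ⟨none, hP.symm⟩
      obtain ⟨x, y, hP⟩ := exists_hasCoords hP
      have hP' := hφ P x y hP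
      rw [← h] at hP'
      obtain ⟨e₁, e₂⟩ := hP.unique hP'
      obtain ⟨a, rfl⟩ := exists_cast_of_pow_eq e₁.symm
      obtain ⟨b, rfl⟩ := exists_cast_of_pow_eq e₂.symm
      have hy := hP.equation
      rw [curve_a₄, curve_a₆] at hy
      refine ⟨some ⟨(a, b), f.injective ?_⟩, (hF _).ext hP⟩
      simpa [f] using hy
  change _ = _
  rw [Nat.card_congr (Equiv.ofInjective G hG), hrange]
  rfl

end FixedPoints

section Galois

variable {S : WeierstrassCurve ℤ} [S.IsShortNF] {q : ℕ} {hq : q.Prime} {𝔮 : Ideal (𝓞 QBar)}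
  {h𝔮 : IsPrimeAbove q 𝔮}

omit [S.IsShortNF] in
theorem discr_residueField_ne_zero (hS : ¬ (q : ℤ) ∣ S.Δ) :
    (curve S (IsLocalRing.ResidueField (localRing hq h𝔮))).Δ ≠ 0 := by
  rw [discr_eq]
  exact fun h => hS ((CharP.intCast_eq_zero_iff _ q _).1 h)

omit [S.IsShortNF] in
theorem discr_QBar_ne_zero (hS : S.Δ ≠ 0) : (curve S QBar).Δ ≠ 0 := by
  rw [discr_eq]
  exact_mod_cast hS

theorem natCard_torsion_QBar (hS : S.Δ ≠ 0) {N : ℕ} (hN : N ≠ 0) :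
    Nat.card {P : Points S QBar // N • P = 0} = N ^ 2 := by
  have := card_torsion (discr_QBar_ne_zero hS) N (by exact_mod_cast hN)
  convert this

theorem hasCoords_red_mapPt (hS : ¬ (q : ℤ) ∣ S.Δ) {σ : GQ} {e : ℕ}
    (hσ : ∀ a : 𝓞 QBar, σ • a - a ^ e ∈ 𝔮) {P : Points S QBar} {ξ η}
    (hP : HasCoords (red (localRing hq h𝔮) P) ξ η) :
    HasCoords (red (localRing hq h𝔮) (mapPt (σ : QBar →+* QBar) P)) (ξ ^ e) (η ^ e) := by
  have hΔ := discr_residueField_ne_zero (hq := hq) (h𝔮 := h𝔮) hS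
  obtain ⟨x, y, ξ', η', h, hx, hy, h'⟩ := exists_coords_of_red_ne_zero hΔ hP.ne_zero
  obtain ⟨rfl, rfl⟩ := hP.unique h'
  obtain ⟨η', hη', h''⟩ := hasCoords_red hΔ (h.mapPt (σ : QBar →+* QBar))
    (reducesTo_of_smul_sub_pow_mem hσ hx)
  rwa [hη'.unique (reducesTo_of_smul_sub_pow_mem hσ hy)] at h''

theorem red_mapPt_eq_zero (hS : ¬ (q : ℤ) ∣ S.Δ) {σ : GQ} {e : ℕ} (he : e ≠ 0)
    (hσ : ∀ a : 𝓞 QBar, σ • a - a ^ e ∈ 𝔮) {P : Points S QBar}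
    (hP : red (localRing hq h𝔮) P = 0) :
    red (localRing hq h𝔮) (mapPt (σ : QBar →+* QBar) P) = 0 := by
  have hΔ := discr_residueField_ne_zero (hq := hq) (h𝔮 := h𝔮) hS
  by_cases h0 : P = 0
  · rw [h0, map_zero, red_zero]
  obtain ⟨x, y, h⟩ := exists_hasCoords h0
  have hx : x ∉ localRing hq h𝔮 := by
    intro hx
    obtain ⟨ξ, hξ⟩ := exists_reducesTo hx
    obtain ⟨_, _, h'⟩ := hasCoords_red hΔ h hξ
    exact h'.ne_zero hP
  exact red_eq_zero_of_notMem (h.mapPt (σ : QBar →+* QBar)) (notMem_of_smul_sub_pow_mem he hσ hx)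

/-- The action of `σ` is compatible with the endomorphism `(x, y) ↦ (x ^ e, y ^ e)` of the group of
points over the residue field. -/
theorem red_mapPt (hS : ¬ (q : ℤ) ∣ S.Δ) {σ : GQ} {e : ℕ} (he : e ≠ 0)
    (hσ : ∀ a : 𝓞 QBar, σ • a - a ^ e ∈ 𝔮)
    {φ : Points S (IsLocalRing.ResidueField (localRing hq h𝔮)) →+
      Points S (IsLocalRing.ResidueField (localRing hq h𝔮))}
    (hφ : ∀ P x y, HasCoords P x y → HasCoords (φ P) (x ^ e) (y ^ e)) (P : Points S QBar) :
    red (localRing hq h𝔮) (mapPt (σ : QBar →+* QBar) P) = φ (red (localRing hq h𝔮) P) := by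
  by_cases h : red (localRing hq h𝔮) P = 0
  · rw [red_mapPt_eq_zero hS he hσ h, h, map_zero]
  · obtain ⟨ξ, η, h⟩ := exists_hasCoords h
    exact (hasCoords_red_mapPt hS hσ h).ext (hφ _ _ _ h)

theorem eq_of_red_eq (hS : ¬ (q : ℤ) ∣ S.Δ) {N : ℕ} (hN : ¬ q ∣ N) {P Q : Points S QBar}
    (hP : N • P = 0) (hQ : N • Q = 0)
    (h : red (localRing hq h𝔮) P = red (localRing hq h𝔮) Q) : P = Q := by
  have hΔ := discr_residueField_ne_zero (hq := hq) (h𝔮 := h𝔮) hS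
  rw [← sub_eq_zero]
  refine eq_zero_of_red_eq_zero hΔ ?_ (n := N) (fun h => hN ((CharP.cast_eq_zero_iff _ q N).1 h))
    (by rw [smul_sub, hP, hQ, sub_zero])
  rw [← redHom_apply hΔ, map_sub, redHom_apply, redHom_apply, h, sub_self]

/-- Torsion points of order prime to `q` are unramified at `q`. -/
theorem mapPt_eq_of_mem_inertia (hq : q.Prime) (h𝔮 : IsPrimeAbove q 𝔮) (hS : ¬ (q : ℤ) ∣ S.Δ)
    {N : ℕ} (hN : ¬ q ∣ N) {σ : GQ} (hσ : σ ∈ 𝔮.inertia GQ) {P : Points S QBar} (hP : N • P = 0) :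
    mapPt (σ : QBar →+* QBar) P = P := by
  have hσ' : ∀ a : 𝓞 QBar, σ • a - a ^ 1 ∈ 𝔮 := fun a => by
    rw [pow_one]
    exact hσ a
  refine eq_of_red_eq (hq := hq) (h𝔮 := h𝔮) hS hN ?_ hP ?_
  · rw [← map_nsmul, hP, map_zero]
  · rw [red_mapPt hS one_ne_zero hσ' (φ := AddMonoidHom.id _) (fun P x y h => by
      rwa [pow_one, pow_one]), AddMonoidHom.id_apply]

theorem exists_red_eq (hS : ¬ (q : ℤ) ∣ S.Δ) {N : ℕ} (hN : ¬ q ∣ N)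
    {R : Points S (IsLocalRing.ResidueField (localRing hq h𝔮))} (hR : N • R = 0) :
    ∃ P : Points S QBar, N • P = 0 ∧ red (localRing hq h𝔮) P = R := by
  have hΔ := discr_residueField_ne_zero (hq := hq) (h𝔮 := h𝔮) hS
  have := isAlgClosed_residueField (localRing hq h𝔮)
  have hN0 : N ≠ 0 := by rintro rfl; simp at hN
  have hc₁ := natCard_torsion_QBar (S := S) (fun h => hS (h ▸ dvd_zero _)) hN0
  have hc₂ := card_torsion hΔ N (fun h => hN ((CharP.cast_eq_zero_iff _ q N).1 h))
  have : Finite {P : Points S (IsLocalRing.ResidueField (localRing hq h𝔮)) // N • P = 0} :=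
    Nat.finite_of_card_ne_zero (by rw [hc₂]; positivity)
  have : Finite {P : Points S QBar // N • P = 0} :=
    Nat.finite_of_card_ne_zero (by rw [hc₁]; positivity)
  let f : {P : Points S QBar // N • P = 0} →
      {P : Points S (IsLocalRing.ResidueField (localRing hq h𝔮)) // N • P = 0} := fun P =>
    ⟨redHom hΔ P.1, by rw [← map_nsmul, P.2, map_zero]⟩
  have hf : Function.Injective f := fun P Q h =>
    Subtype.ext (eq_of_red_eq hS hN P.2 Q.2 (congrArg Subtype.val h))
  obtain ⟨P, hP⟩ := (hf.bijective_of_nat_card_le (by rw [hc₁, hc₂])).2 ⟨R, hR⟩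
  exact ⟨P.1, P.2, congrArg Subtype.val hP⟩

/-- The action of a Frobenius element on torsion points of order prime to `q`: it is annihilated by
the characteristic polynomial of Frobenius, and if it is multiplication by `n` on the points of
order dividing `N`, then these points inject into the kernel of `n - φ`. -/
theorem frobenius_on_torsion (hq : q.Prime) (hq2 : Odd q) (hS : ¬ (q : ℤ) ∣ S.Δ) {σ : GQ}
    (hσ : IsFrobenius q σ) {β : ℤ} (hβ : β = q + 1 - numPoints S q) :
    (∀ N : ℕ, ¬ q ∣ N → ∀ P : Points S QBar, N • P = 0 →
      mapPt (σ : QBar →+* QBar) (mapPt (σ : QBar →+* QBar) P) -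
        β • mapPt (σ : QBar →+* QBar) P + (q : ℤ) • P = 0) ∧
    ∀ N : ℕ, ¬ q ∣ N → ∀ n : ℤ, ¬ (q : ℤ) ∣ n →
      (∀ P : Points S QBar, N • P = 0 → mapPt (σ : QBar →+* QBar) P = n • P) →
      (N : ℤ) ^ 2 ∣ n ^ 2 - β * n + q := by
  have : Fact q.Prime := ⟨hq⟩
  obtain ⟨𝔮, h𝔮, hσ⟩ := hσ
  have hΔ := discr_residueField_ne_zero (hq := hq) (h𝔮 := h𝔮) hS
  have := isAlgClosed_residueField (localRing hq h𝔮)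
  let K := IsLocalRing.ResidueField (localRing hq h𝔮)
  have hφ : ∀ (P : Points S K) x y, HasCoords P x y →
      HasCoords (mapPt (frobenius K q) P) (x ^ q) (y ^ q) := fun P x y h => h.mapPt _
  obtain ⟨β', hcard, hpoly⟩ := exists_frobenius_charpoly hΔ hq2 _ hφ
  have hββ : β' = β := by
    have h1 := hcard 1 (by
      intro h
      have := Int.eq_one_of_dvd_one (by positivity) h
      exact hq.one_lt.ne' (by exact_mod_cast this))
    rw [card_frobenius_fixed hΔ _ hφ] at h1
    rw [hβ, h1]
    ring
  subst hββ
  have hred := red_mapPt (hq := hq) (h𝔮 := h𝔮) hS hq.ne_zero hσ hφ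
  constructor
  · intro N hN P hP
    refine eq_of_red_eq (hq := hq) (h𝔮 := h𝔮) hS hN ?_ (smul_zero N) ?_
    · rw [smul_add, smul_sub, smul_comm N β', smul_comm N (q : ℤ), hP, ← map_nsmul, ← map_nsmul,
        hP]
      simp
    · rw [← redHom_apply hΔ, map_add, map_sub, map_zsmul, map_zsmul, redHom_apply, redHom_apply,
        redHom_apply, hred, hred, red_zero]
      exact hpoly _
  · intro N hN n hn h
    rw [← hcard n hn]
    have hker : Nat.card {P : Points S K // n • P = mapPt (frobenius K q) P} =
        Nat.card (n • AddMonoidHom.id _ - mapPt (frobenius K q) : Points S K →+ Points S K).ker :=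
      Nat.card_congr (Equiv.subtypeEquivRight fun P => by
        rw [AddMonoidHom.mem_ker, AddMonoidHom.sub_apply, AddMonoidHom.smul_apply,
          AddMonoidHom.id_apply, sub_eq_zero])
    have htor : Nat.card (N • AddMonoidHom.id _ : Points S K →+ Points S K).ker = N ^ 2 := by
      rw [← card_torsion hΔ N (fun h => hN ((CharP.cast_eq_zero_iff _ q N).1 h))]
      exact Nat.card_congr (Equiv.subtypeEquivRight fun P => by
        rw [AddMonoidHom.mem_ker, AddMonoidHom.smul_apply, AddMonoidHom.id_apply])
    rw [hker]
    norm_cast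
    rw [← htor]
    apply AddSubgroup.card_dvd_of_le
    intro R hR
    rw [AddMonoidHom.mem_ker, AddMonoidHom.smul_apply, AddMonoidHom.id_apply] at hR
    obtain ⟨P, hP, rfl⟩ := exists_red_eq hS hN hR
    rw [AddMonoidHom.mem_ker, AddMonoidHom.sub_apply, AddMonoidHom.smul_apply,
      AddMonoidHom.id_apply, sub_eq_zero, ← hred, h P hP, ← redHom_apply hΔ, ← redHom_apply hΔ,
      map_zsmul]

end Galois

end ShortWeierstrass

/-! ### Tate modules of rank two -/

namespace TateModule

section Structure

variable {M : Type} [AddCommGroup M] {p : ℕ}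

theorem nsmul_apply_add (t : tateModule M p) (n k : ℕ) : p ^ k • t.1 (n + k) = t.1 n := by
  induction k with
  | zero => simp
  | succ k ih => rw [pow_succ, mul_smul, ← add_assoc, (t.2 _).2, ih]

variable (hM : ∀ k : ℕ, Nat.card {P : M // p ^ k • P = 0} = (p ^ k) ^ 2)

section Prime

variable [hp : Fact p.Prime]
include hM

theorem finite_torsion (k : ℕ) : Finite {P : M // p ^ k • P = 0} :=
  Nat.finite_of_card_ne_zero (by rw [hM]; exact pow_ne_zero _ (pow_ne_zero _ hp.out.ne_zero))

theorem exists_smul_eq {k : ℕ} {P : M} (hP : p ^ k • P = 0) :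
    ∃ Q, p ^ (k + 1) • Q = 0 ∧ p • Q = P := by
  have := finite_torsion hM
  let T : ℕ → AddSubgroup M := fun k => (p ^ k • AddMonoidHom.id M).ker
  have hT : ∀ k Q, Q ∈ T k ↔ p ^ k • Q = 0 := fun k Q => by
    simp only [T]
    rw [AddMonoidHom.mem_ker, AddMonoidHom.smul_apply, AddMonoidHom.id_apply]
  have hcard : ∀ k, Nat.card (T k) = (p ^ k) ^ 2 := fun k => by
    rw [← hM]
    exact Nat.card_congr (Equiv.subtypeEquivRight (hT k))
  have hfin : ∀ k, Finite (T k) := fun k => Nat.finite_of_card_ne_zero (by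
    rw [hcard]; exact pow_ne_zero _ (pow_ne_zero _ hp.out.ne_zero))
  let f : T (k + 1) →+ T k := AddMonoidHom.mk' (fun Q => ⟨p • Q.1, by
    rw [hT, ← mul_smul, ← pow_succ]; exact (hT _ _).1 Q.2⟩) fun Q R => by
      ext; simp
  have hf : Function.Surjective f := by
    apply AddMonoidHom.surjective_of_card_ker_le_div
    have hpk : 0 < (p ^ k) ^ 2 := pow_pos (pow_pos hp.out.pos _) _
    have hker : Nat.card f.ker ≤ Nat.card (T 1) := by
      refine Nat.card_le_card_of_injective (fun Q => ⟨Q.1.1, ?_⟩) fun Q R h => ?_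
      · rw [hT, pow_one]
        exact congrArg Subtype.val (AddMonoidHom.mem_ker.1 Q.2)
      · exact Subtype.ext (Subtype.ext (by simpa using h))
    refine hker.trans (le_of_eq ?_)
    rw [hcard, hcard, hcard, pow_succ p k, mul_pow _ p, Nat.mul_div_cancel_left _ hpk, pow_one]
  obtain ⟨Q, hQ⟩ := hf ⟨P, (hT _ _).2 hP⟩
  exact ⟨Q.1, (hT _ _).1 Q.2, congrArg Subtype.val hQ⟩

/-- The projection of the Tate module to its `k`-th component is surjective. -/
theorem exists_apply_eq {k : ℕ} {P : M} (hP : p ^ k • P = 0) : ∃ t : tateModule M p, t.1 k = P := by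
  choose! d hd using fun (k : ℕ) (P : M) (h : p ^ k • P = 0) => exists_smul_eq hM h
  let g : ℕ → M := fun n => Nat.rec P (fun n Q => d (k + n) Q) n
  have hg : ∀ n, p ^ (k + n) • g n = 0 := by
    intro n
    induction n with
    | zero => exact hP
    | succ n ih => exact (hd (k + n) (g n) ih).1
  have hg' : ∀ n, p • g (n + 1) = g n := fun n => (hd (k + n) (g n) (hg n)).2
  have hgk : ∀ n, p ^ n • g n = P := by
    intro n
    induction n with
    | zero => simp [g]
    | succ n ih => rw [pow_succ, mul_smul, hg', ih]
  refine ⟨⟨fun n => p ^ k • g n, fun n => ⟨?_, ?_⟩⟩, hgk k⟩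
  · rw [← mul_smul, ← pow_add, add_comm, hg]
  · rw [smul_comm, hg']

/-- Lifts `x, y` of two independent elements `u, v` of `M[p]` are independent in each `M[p^k]`. -/
theorem exists_independent : ∃ x y : tateModule M p, ∀ (k : ℕ) (a b : ℤ),
    a • x.1 k + b • y.1 k = 0 → (p ^ k : ℤ) ∣ a ∧ (p ^ k : ℤ) ∣ b := by
  have hp' := Nat.prime_iff_prime_int.1 hp.out
  have hM1 := hM 1
  rw [pow_one] at hM1
  have := finite_torsion hM 1
  rw [pow_one] at this
  let : Fintype {P : M // p • P = 0} := Fintype.ofFinite _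
  -- in the module of the points killed by `p`, multiples only depend on the residue modulo `p`
  have hinv : ∀ (b : ℤ) (Q : M), p • Q = 0 → ¬ (p : ℤ) ∣ b → ∃ c : ℤ, Q = c • b • Q := by
    intro b Q hQ hb
    obtain ⟨u, v, e⟩ := (hp'.coprime_iff_not_dvd).2 hb
    refine ⟨v, ?_⟩
    rw [← natCast_zsmul] at hQ
    conv_lhs => rw [← one_smul ℤ Q, ← e, add_smul, mul_smul, hQ, smul_zero, zero_add, mul_smul]
  obtain ⟨⟨u, hu⟩, hu0⟩ : ∃ u : {P : M // p • P = 0}, u ≠ ⟨0, smul_zero p⟩ := by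
    by_contra! H
    have : Nat.card {P : M // p • P = 0} ≤ 1 := by
      rw [Nat.card_eq_fintype_card, Fintype.card_le_one_iff]
      intro a b
      rw [H a, H b]
    rw [hM1] at this
    have := hp.out.one_lt
    nlinarith
  obtain ⟨⟨v, hv⟩, hv0⟩ : ∃ v : {P : M // p • P = 0}, ∀ a : ℤ, v.1 ≠ a • u := by
    by_contra! H
    have hle : Nat.card {P : M // p • P = 0} ≤ Nat.card (Fin p) := by
      refine Nat.card_le_card_of_surjective
        (fun i : Fin p => (⟨(i : ℕ) • u, by rw [smul_comm, hu, smul_zero]⟩ :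
          {P : M // p • P = 0})) ?_
      rintro w
      obtain ⟨a, ha⟩ := H w
      refine ⟨⟨(a % p).toNat, ?_⟩, ?_⟩
      · have := Int.emod_lt_of_pos a (by exact_mod_cast hp.out.pos : (0 : ℤ) < p)
        have := Int.emod_nonneg a (by exact_mod_cast hp.out.ne_zero : (p : ℤ) ≠ 0)
        omega
      · apply Subtype.ext
        dsimp only
        rw [ha, ← natCast_zsmul, Int.toNat_of_nonneg
          (Int.emod_nonneg a (by exact_mod_cast hp.out.ne_zero : (p : ℤ) ≠ 0))]
        conv_rhs => rw [← Int.emod_add_mul_ediv a p, add_smul, mul_comm, mul_smul, natCast_zsmul,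
          hu, smul_zero, add_zero]
    rw [hM1, Nat.card_fin] at hle
    have := hp.out.one_lt
    nlinarith
  have hu0 : u ≠ 0 := fun h => hu0 (Subtype.ext h)
  obtain ⟨x, hx⟩ := exists_apply_eq hM (k := 1) (P := u) (by rwa [pow_one])
  obtain ⟨y, hy⟩ := exists_apply_eq hM (k := 1) (P := v) (by rwa [pow_one])
  refine ⟨x, y, fun k => ?_⟩
  have hone : ∀ a b : ℤ, a • u + b • v = 0 → (p : ℤ) ∣ a ∧ (p : ℤ) ∣ b := by
    intro a b h
    have hb : (p : ℤ) ∣ b := by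
      by_contra hb
      obtain ⟨c, hc⟩ := hinv b v hv hb
      refine hv0 (-(c * a)) (hc.trans ?_)
      rw [eq_neg_of_add_eq_zero_right h, neg_smul, mul_smul, smul_neg]
    refine ⟨?_, hb⟩
    by_contra ha
    obtain ⟨c, hc⟩ := hinv a u hu ha
    obtain ⟨b', rfl⟩ := hb
    rw [mul_comm, mul_smul, natCast_zsmul, hv, smul_zero, add_zero] at h
    rw [h, smul_zero] at hc
    exact hu0 hc
  induction k with
  | zero => intro a b _; simp
  | succ k ih =>
    intro a b h
    have h1 : a • u + b • v = 0 := by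
      have := congrArg (p ^ k • ·) h
      simp only [smul_add, smul_zero] at this
      rwa [smul_comm _ a, smul_comm _ b, add_comm k 1, nsmul_apply_add, nsmul_apply_add, hx,
        hy] at this
    obtain ⟨⟨a, rfl⟩, b, rfl⟩ := hone a b h1
    rw [mul_comm _ a, mul_comm _ b, mul_smul, mul_smul, natCast_zsmul, natCast_zsmul, (x.2 k).2,
      (y.2 k).2] at h
    obtain ⟨ha, hb⟩ := ih a b h
    rw [pow_succ']
    exact ⟨mul_dvd_mul_left _ ha, mul_dvd_mul_left _ hb⟩

theorem exists_eq_add {x y : tateModule M p} (hxy : ∀ (k : ℕ) (a b : ℤ),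
    a • x.1 k + b • y.1 k = 0 → (p ^ k : ℤ) ∣ a ∧ (p ^ k : ℤ) ∣ b) {k : ℕ} {P : M}
    (hP : p ^ k • P = 0) : ∃ a b : ℕ, P = a • x.1 k + b • y.1 k := by
  have := finite_torsion hM k
  let f : Fin (p ^ k) × Fin (p ^ k) → {P : M // p ^ k • P = 0} := fun c =>
    ⟨(c.1 : ℕ) • x.1 k + (c.2 : ℕ) • y.1 k, by
      rw [smul_add, smul_comm, smul_comm _ (c.2 : ℕ), (x.2 k).1, (y.2 k).1, smul_zero, smul_zero,
        add_zero]⟩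
  have hfin : ∀ i j : Fin (p ^ k), (p ^ k : ℤ) ∣ (i : ℤ) - (j : ℤ) → i = j := by
    intro i j h
    have := Int.eq_zero_of_abs_lt_dvd h (by
      have hi : ((i : ℕ) : ℤ) < (p ^ k : ℕ) := by exact_mod_cast i.2
      have hj : ((j : ℕ) : ℤ) < (p ^ k : ℕ) := by exact_mod_cast j.2
      push_cast at hi hj
      rw [abs_lt]
      constructor <;> linarith [Int.natCast_nonneg (i : ℕ), Int.natCast_nonneg (j : ℕ)])
    ext
    omega
  have hf : Function.Injective f := by
    rintro ⟨a, b⟩ ⟨a', b'⟩ h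
    have h' := congrArg Subtype.val h
    dsimp only [f] at h'
    obtain ⟨h1, h2⟩ := hxy k ((a : ℤ) - (a' : ℤ)) ((b : ℤ) - (b' : ℤ)) (by
      rw [sub_smul, sub_smul, natCast_zsmul, natCast_zsmul, natCast_zsmul, natCast_zsmul,
        sub_add_sub_comm, h', sub_self])
    exact Prod.ext (hfin _ _ h1) (hfin _ _ h2)
  obtain ⟨c, hc⟩ := (hf.bijective_of_nat_card_le (by
    rw [hM, Nat.card_prod, Nat.card_fin, sq])).2 ⟨P, hP⟩
  exact ⟨c.1, c.2, (congrArg Subtype.val hc).symm⟩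

end Prime

section Basis

variable [hp : Fact p.Prime]

include hM

/-- If `M[p^k]` has `p^(2k)` elements for all `k`, the Tate module is free of rank two. -/
theorem nonempty_basis : Nonempty (Module.Basis (Fin 2) ℤ_[p] (tateModule M p)) := by
  obtain ⟨x, y, hxy⟩ := exists_independent hM
  let L : (Fin 2 → ℤ_[p]) →ₗ[ℤ_[p]] tateModule M p := Fintype.linearCombination ℤ_[p] ![x, y]
  have hL : ∀ c k, (L c).1 k =
      (PadicInt.toZModPow k (c 0)).val • x.1 k + (PadicInt.toZModPow k (c 1)).val • y.1 k := by
    intro c k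
    simp only [L, Fintype.linearCombination_apply, Fin.sum_univ_two]
    rfl
  have hzero : ∀ (k n : ℕ), (p ^ k : ℤ) ∣ n → (n : ZMod (p ^ k)) = 0 := by
    intro k n h
    rw [ZMod.natCast_eq_zero_iff]
    exact_mod_cast h
  have hinj : Function.Injective L := by
    rw [← LinearMap.ker_eq_bot, LinearMap.ker_eq_bot']
    intro c hc
    have h : ∀ k, PadicInt.toZModPow k (c 0) = 0 ∧ PadicInt.toZModPow k (c 1) = 0 := by
      intro k
      have : NeZero (p ^ k) := ⟨pow_ne_zero k hp.out.ne_zero⟩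
      have h0 := hL c k
      rw [hc] at h0
      obtain ⟨h1, h2⟩ := hxy k (PadicInt.toZModPow k (c 0)).val (PadicInt.toZModPow k (c 1)).val
        (by rw [natCast_zsmul, natCast_zsmul]; exact h0.symm)
      exact ⟨by rw [← ZMod.natCast_zmod_val (PadicInt.toZModPow k (c 0)), hzero k _ h1],
        by rw [← ZMod.natCast_zmod_val (PadicInt.toZModPow k (c 1)), hzero k _ h2]⟩
    refine funext fun i => ?_
    fin_cases i
    · exact PadicInt.ext_of_toZModPow.1 fun k => (h k).1.trans (map_zero _).symm
    · exact PadicInt.ext_of_toZModPow.1 fun k => (h k).2.trans (map_zero _).symm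
  have hsurj : Function.Surjective L := by
    intro t
    choose a b hab using fun k => exists_eq_add hM hxy (t.2 k).1
    have hcompat : ∀ k, (p ^ k : ℤ) ∣ a (k + 1) - a k ∧ (p ^ k : ℤ) ∣ b (k + 1) - b k := by
      intro k
      apply hxy k
      have h := (t.2 k).2
      rw [hab, hab k, smul_add, smul_comm, smul_comm p (b (k + 1)), (x.2 k).2, (y.2 k).2] at h
      rw [sub_smul, sub_smul, natCast_zsmul, natCast_zsmul, natCast_zsmul, natCast_zsmul,
        sub_add_sub_comm, h, sub_self]
    obtain ⟨c, hc⟩ : ∃ c : ℤ_[p], ∀ k, PadicInt.toZModPow k c = a k :=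
      ⟨_, fun k => (PadicInt.toZModPow_ofIntSeq_of_pow_dvd_sub (fun k => (a k : ℤ)) p
        (fun k => (hcompat k).1) k).trans (Int.cast_natCast _)⟩
    obtain ⟨d, hd⟩ : ∃ d : ℤ_[p], ∀ k, PadicInt.toZModPow k d = b k :=
      ⟨_, fun k => (PadicInt.toZModPow_ofIntSeq_of_pow_dvd_sub (fun k => (b k : ℤ)) p
        (fun k => (hcompat k).2) k).trans (Int.cast_natCast _)⟩
    refine ⟨![c, d], Subtype.ext (funext fun k => ?_)⟩
    have : NeZero (p ^ k) := ⟨pow_ne_zero k hp.out.ne_zero⟩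
    rw [hL, hab k]
    congr 1
    · exact nsmul_eq_of_cast_eq (x.2 k).1 (by
        rw [ZMod.natCast_zmod_val]
        exact hc k)
    · exact nsmul_eq_of_cast_eq (y.2 k).1 (by
        rw [ZMod.natCast_zmod_val]
        exact hd k)
  exact ⟨Module.Basis.ofEquivFun (LinearEquiv.ofBijective L ⟨hinj, hsurj⟩).symm⟩

end Basis

end Structure

end TateModule

/-! ### Endomorphisms and group actions on Tate modules of rank two -/

namespace TateModule

variable {M : Type} [AddCommGroup M] {p : ℕ} [hp : Fact p.Prime]

section Trace

theorem intCast_smul_apply (n : ℤ) (t : tateModule M p) (k : ℕ) :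
    ((n : ℤ_[p]) • t).1 k = n • t.1 k := by
  rw [Int.cast_smul_eq_zsmul]
  rfl

theorem natCast_smul_apply (n : ℕ) (t : tateModule M p) (k : ℕ) :
    ((n : ℤ_[p]) • t).1 k = n • t.1 k := by
  rw [← Int.cast_natCast, intCast_smul_apply, natCast_zsmul]

/-- If a `p`-adic integer `r` satisfies `r ∈ p^k ℤ_p` for all `k`, it vanishes. -/
theorem eq_zero_of_forall_dvd {r : ℤ_[p]} (h : ∀ k : ℕ, (p : ℤ_[p]) ^ k ∣ r) : r = 0 := by
  apply PadicInt.ext_of_toZModPow.1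
  intro k
  rw [map_zero, ← RingHom.mem_ker, PadicInt.ker_toZModPow, Ideal.mem_span_singleton]
  exact h k

/-- Let `f` be an endomorphism of `M` which is annihilated on the `p`-power torsion by
`X² - β X + q`, and which can be multiplication by `n` on `M[p^k]` only if `p^(2k)` divides the
value of this polynomial at `n`. Then `β` is the trace of `f` on the Tate module. The second
condition serves when `f` is a scalar `l` on the Tate module: it shows that `l` is a double root. -/
theorem trace_eq (hM : ∀ k : ℕ, Nat.card {P : M // p ^ k • P = 0} = (p ^ k) ^ 2)
    (b : Module.Basis (Fin 2) ℤ_[p] (tateModule M p)) (f : M →+ M) {β : ℤ} {q : ℕ}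
    (hq : q.Prime) (hqp : q ≠ p)
    (h₁ : ∀ (k : ℕ) (P : M), p ^ k • P = 0 → f (f P) - β • f P + (q : ℤ) • P = 0)
    (h₂ : ∀ (k : ℕ) (n : ℤ), ¬ (q : ℤ) ∣ n → (∀ P : M, p ^ k • P = 0 → f P = n • P) →
      ((p ^ k : ℕ) : ℤ) ^ 2 ∣ n ^ 2 - β * n + q) :
    (LinearMap.toMatrix b b (tateMap p f)).trace = (β : ℤ_[p]) := by
  set B := LinearMap.toMatrix b b (tateMap p f) with hB
  have hT : tateMap p f * tateMap p f - (β : ℤ_[p]) • tateMap p f + (q : ℤ_[p]) • 1 = 0 := by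
    ext1 t
    refine Subtype.ext (funext fun k => ?_)
    have := h₁ k (t.1 k) (t.2 k).1
    rw [natCast_zsmul] at this
    change f (f (t.1 k)) - ((β : ℤ_[p]) • tateMap p f t).1 k + ((q : ℤ_[p]) • t).1 k = 0
    rw [intCast_smul_apply, natCast_smul_apply]
    exact this
  have hB2 : B * B - (β : ℤ_[p]) • B + (q : ℤ_[p]) • 1 = 0 := by
    have := congrArg (LinearMap.toMatrix b b) hT
    rw [map_add, map_sub, map_smul, map_smul, LinearMap.toMatrix_mul, LinearMap.toMatrix_one,
      map_zero] at this
    exact this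
  have e := fun i j => congrFun (congrFun hB2 i) j
  simp only [Matrix.add_apply, Matrix.sub_apply, Matrix.mul_apply, Fin.sum_univ_two,
    Matrix.smul_apply, smul_eq_mul, Matrix.zero_apply] at e
  have e00 := e 0 0
  have e01 := e 0 1
  have e10 := e 1 0
  have e11 := e 1 1
  rw [Matrix.one_apply_eq] at e00 e11
  rw [Matrix.one_apply_ne (by decide)] at e01 e10
  rw [Matrix.trace_fin_two]
  by_contra htr
  have htr' : B 0 0 + B 1 1 - β ≠ 0 := sub_ne_zero.2 htr
  -- By Cayley-Hamilton, `(tr B - β) B` is a scalar matrix, so `f` acts as a scalar `l`.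
  have h01 : B 0 1 = 0 := mul_right_cancel₀ htr' (by linear_combination e01)
  have h10 : B 1 0 = 0 := mul_right_cancel₀ htr' (by linear_combination e10)
  have h11 : B 1 1 = B 0 0 := by
    rw [← sub_eq_zero]
    exact mul_right_cancel₀ htr' (by linear_combination e11 - e00)
  obtain ⟨l, hl⟩ : ∃ l, l = B 0 0 := ⟨_, rfl⟩
  have hl2 : l ^ 2 - β * l + q = 0 := by
    rw [hl]
    linear_combination e00 - B 0 1 * h10
  have hscalar : ∀ t, tateMap p f t = l • t := by
    have : tateMap p f = l • LinearMap.id := by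
      apply (LinearMap.toMatrix b b).injective
      rw [← hB, map_smul, LinearMap.toMatrix_id]
      ext i j
      fin_cases i <;> fin_cases j <;> simp [h01, h10, h11, hl]
    intro t
    rw [this]
    rfl
  apply htr
  rw [h11, ← hl, ← sub_eq_zero]
  apply eq_zero_of_forall_dvd
  intro k
  -- choose `n` with `n ≡ l + p^k` modulo `p^(k+1)`, prime to `q`
  have hco : Nat.Coprime (p ^ (k + 1)) q :=
    Nat.Coprime.pow_left _ ((Nat.coprime_primes hp.out hq).2 hqp.symm)
  have : NeZero (p ^ (k + 1)) := ⟨pow_ne_zero _ hp.out.ne_zero⟩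
  obtain ⟨n, hn₁, hn₂⟩ := Nat.chineseRemainder hco
    (PadicInt.toZModPow (k + 1) (l + (p : ℤ_[p]) ^ k)).val 1
  obtain ⟨d, hd⟩ : ∃ d : ℤ_[p], (n : ℤ_[p]) = l + (p : ℤ_[p]) ^ k * (1 + p * d) := by
    have h : (n : ℤ_[p]) - (l + (p : ℤ_[p]) ^ k) ∈ RingHom.ker (PadicInt.toZModPow (k + 1)) := by
      rw [RingHom.mem_ker, map_sub, map_natCast, (ZMod.natCast_eq_natCast_iff _ _ _).2 hn₁,
        ZMod.natCast_zmod_val, sub_self]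
    rw [PadicInt.ker_toZModPow, Ideal.mem_span_singleton] at h
    obtain ⟨d, hd⟩ := h
    exact ⟨d, by linear_combination hd⟩
  have hunit : IsUnit (1 + p * d : ℤ_[p]) := by
    by_contra hu
    have h1 : (1 + p * d : ℤ_[p]) ∈ IsLocalRing.maximalIdeal ℤ_[p] :=
      (IsLocalRing.mem_maximalIdeal _).2 hu
    have h2 : (p * d : ℤ_[p]) ∈ IsLocalRing.maximalIdeal ℤ_[p] := by
      rw [PadicInt.maximalIdeal_eq_span_p]
      exact Ideal.mul_mem_right _ _ (Ideal.mem_span_singleton_self _)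
    exact (Ideal.ne_top_iff_one _).1 (IsLocalRing.maximalIdeal.isMaximal ℤ_[p]).ne_top
      (by simpa using sub_mem h1 h2)
  have hnq : ¬ (q : ℤ) ∣ n := by
    intro h
    have h1 := (Nat.modEq_zero_iff_dvd.2 (Int.natCast_dvd_natCast.1 h)).symm.trans hn₂
    have h2 := (Nat.modEq_zero_iff_dvd.1 h1.symm)
    exact hq.one_lt.ne' (Nat.dvd_one.1 h2)
  have hfn : ∀ P : M, p ^ k • P = 0 → f P = (n : ℤ) • P := by
    intro P hP
    obtain ⟨t, rfl⟩ := exists_apply_eq hM hP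
    have h1 := congrArg (fun t => t.1 k) (hscalar t)
    refine Eq.trans (b := (PadicInt.toZModPow k l).val • t.1 k) h1 ?_
    rw [natCast_zsmul]
    refine nsmul_eq_of_cast_eq hP ?_
    have : NeZero (p ^ k) := ⟨pow_ne_zero _ hp.out.ne_zero⟩
    rw [ZMod.natCast_zmod_val, ← map_natCast (PadicInt.toZModPow k) n, hd, map_add, map_mul,
      map_pow, map_natCast, ← Nat.cast_pow, ZMod.natCast_self, zero_mul, add_zero]
  -- with `n = l + p^k e` and `e` a unit, `n² - β n + q = p^k e (2 l - β) + p^(2k) e²`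
  obtain ⟨m, hm⟩ := h₂ k n hnq hfn
  have hm' := congrArg (Int.cast : ℤ → ℤ_[p]) hm
  push_cast at hm'
  have hpk : (p : ℤ_[p]) ^ k ≠ 0 := pow_ne_zero _ (by exact_mod_cast hp.out.ne_zero)
  have hdvd : (p : ℤ_[p]) ^ k ∣ (1 + p * d) * (l + l - β) := by
    refine ⟨m - (1 + p * d) ^ 2, mul_left_cancel₀ hpk ?_⟩
    rw [hd] at hm'
    linear_combination hm' - hl2
  exact (hunit.dvd_mul_left).1 hdvd

end Trace

section Continuity

theorem exists_eq_smul_of_apply_eq_zero {t : tateModule M p} {k : ℕ} (h : t.1 k = 0) :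
    ∃ s : tateModule M p, t = ((p : ℤ_[p]) ^ k) • s := by
  refine ⟨⟨fun n => t.1 (k + n), fun n => ⟨?_, ?_⟩⟩, Subtype.ext (funext fun n => ?_)⟩
  · rw [nsmul_apply_add, h]
  · exact (t.2 (k + n)).2
  · rw [← Nat.cast_pow, natCast_smul_apply]
    exact (nsmul_apply_add t n k).symm.trans (by rw [add_comm n k])

theorem toMatrix_sub_mem {b : Module.Basis (Fin 2) ℤ_[p] (tateModule M p)} {f g : M →+ M} {k : ℕ}
    {j : Fin 2} (h : f ((b j).1 k) = g ((b j).1 k)) (i : Fin 2) :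
    ‖LinearMap.toMatrix b b (tateMap p f) i j - LinearMap.toMatrix b b (tateMap p g) i j‖ ≤
      (p : ℝ) ^ (-k : ℤ) := by
  obtain ⟨s, hs⟩ := exists_eq_smul_of_apply_eq_zero (t := tateMap p f (b j) - tateMap p g (b j))
    (k := k) (sub_eq_zero.2 h)
  rw [PadicInt.norm_le_pow_iff_mem_span_pow, Ideal.mem_span_singleton, LinearMap.toMatrix_apply,
    LinearMap.toMatrix_apply]
  refine ⟨b.repr s i, ?_⟩
  have := congrArg (fun t => b.repr t i) hs
  simpa using this

variable {G : Type*} [Group G] [TopologicalSpace G]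

/-- A group acting on `M`, with open stabilizers, acts continuously on the Tate module. -/
theorem exists_continuous_representation (b : Module.Basis (Fin 2) ℤ_[p] (tateModule M p))
    [IsTopologicalGroup G] (act : G → M →+ M) (h_one : act 1 = AddMonoidHom.id M)
    (h_mul : ∀ σ τ, act (σ * τ) = (act σ).comp (act τ))
    (h_open : ∀ P, IsOpen {σ | act σ P = P}) :
    ∃ ρ : G →ₜ* GL (Fin 2) ℤ_[p], ∀ σ,
      (ρ σ : Matrix (Fin 2) (Fin 2) ℤ_[p]) = LinearMap.toMatrix b b (tateMap p (act σ)) := by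
  let F : G →* Matrix (Fin 2) (Fin 2) ℤ_[p] :=
    { toFun := fun σ => LinearMap.toMatrix b b (tateMap p (act σ))
      map_one' := by
        rw [h_one, ← LinearMap.toMatrix_one b]
        rfl
      map_mul' := fun σ τ => by
        rw [h_mul, ← LinearMap.toMatrix_mul]
        rfl }
  have hF : Continuous F := by
    refine continuous_matrix fun i j => ?_
    rw [Metric.continuous_iff']
    intro σ ε hε
    obtain ⟨k, hk⟩ := PadicInt.exists_pow_neg_lt p hε
    have hmem : {τ | act (σ⁻¹ * τ) ((b j).1 k) = (b j).1 k} ∈ nhds σ := by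
      have hcont : Continuous fun τ => σ⁻¹ * τ := continuous_const.mul continuous_id
      apply (h_open ((b j).1 k)).preimage hcont |>.mem_nhds
      change act (σ⁻¹ * σ) _ = _
      rw [inv_mul_cancel, h_one, AddMonoidHom.id_apply]
    filter_upwards [hmem] with τ hτ
    rw [dist_eq_norm]
    refine (toMatrix_sub_mem ?_ i).trans_lt hk
    rw [← mul_inv_cancel_left σ τ, h_mul, AddMonoidHom.comp_apply]
    exact congrArg (act σ) hτ
  refine ⟨⟨F.toHomUnits, ?_⟩, fun σ => rfl⟩
  exact Units.continuous_iff.2 ⟨hF, hF.comp continuous_inv⟩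

end Continuity

end TateModule

/-! ### Completing the square and the cube -/

namespace ShortWeierstrass

open WeierstrassCurve

/-- The short Weierstrass equation `y² = x³ - 27 c₄ x - 54 c₆` attached to `E`. It is isomorphic to
`E` wherever `6` is invertible, by `(x, y) ↦ (36x + 3b₂, 108(2y + a₁x + a₃))`. -/
def shortForm {R : Type*} [CommRing R] (E : WeierstrassCurve R) : WeierstrassCurve R :=
  ⟨0, 0, 0, -27 * E.c₄, -54 * E.c₆⟩

instance {R : Type*} [CommRing R] (E : WeierstrassCurve R) : (shortForm E).IsShortNF where
  a₁ := rfl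
  a₂ := rfl
  a₃ := rfl

theorem Δ_shortForm {R : Type*} [CommRing R] (E : WeierstrassCurve R) :
    (shortForm E).Δ = 6 ^ 12 * E.Δ := by
  simp only [shortForm, Δ, b₂, b₄, b₆, b₈, c₄, c₆]
  ring

section Field

variable {F : Type*} [Field F] {W W' : WeierstrassCurve.Affine F}

theorem equation_shortForm [WeierstrassCurve.IsShortNF W'] (h₄ : W'.a₄ = -27 * W.c₄)
    (h₆ : W'.a₆ = -54 * W.c₆) (h6 : (6 : F) ≠ 0) (x y : F) :
    W'.Equation (36 * x + 3 * W.b₂) (108 * (2 * y + W.a₁ * x + W.a₃)) ↔ W.Equation x y := by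
  rw [equation_short, Affine.equation_iff, h₄, h₆]
  simp only [b₂, b₄, b₆, c₄, c₆]
  refine ⟨fun h => mul_left_cancel₀ (pow_ne_zero 6 h6) ?_, fun h => ?_⟩
  · linear_combination h
  · linear_combination 6 ^ 6 * h

variable [DecidableEq F] [WeierstrassCurve.IsShortNF W']

/-- The isomorphism from `W` to its short Weierstrass form, as a map on points. -/
def toShort (h₄ : W'.a₄ = -27 * W.c₄) (h₆ : W'.a₆ = -54 * W.c₆) (h6 : (6 : F) ≠ 0)
    (hΔ : WeierstrassCurve.Δ W' ≠ 0) : W.Point → W'.Point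
  | .zero => 0
  | .some x y h => .some (36 * x + 3 * W.b₂) (108 * (2 * y + W.a₁ * x + W.a₃))
    ((Affine.equation_iff_nonsingular_of_Δ_ne_zero hΔ).1 ((equation_shortForm h₄ h₆ h6 x y).2 h.1))

variable (h₄ : W'.a₄ = -27 * W.c₄) (h₆ : W'.a₆ = -54 * W.c₆) (h6 : (6 : F) ≠ 0)
  (hΔ : WeierstrassCurve.Δ W' ≠ 0)

omit [DecidableEq F] in
theorem HasCoords.toShort {P : W.Point} {x y : F} (h : HasCoords P x y) :
    HasCoords (toShort h₄ h₆ h6 hΔ P) (36 * x + 3 * W.b₂)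
      (108 * (2 * y + W.a₁ * x + W.a₃)) := by
  obtain ⟨h, rfl⟩ := h
  exact ⟨_, rfl⟩

theorem toShort_add (P Q : W.Point) :
    toShort h₄ h₆ h6 hΔ (P + Q) = toShort h₄ h₆ h6 hΔ P + toShort h₄ h₆ h6 hΔ Q := by
  have h36 : (36 : F) ≠ 0 := by
    rw [show (36 : F) = 6 * 6 by norm_num]
    exact mul_ne_zero h6 h6
  have h216 : (216 : F) ≠ 0 := by
    rw [show (216 : F) = 36 * 6 by norm_num]
    exact mul_ne_zero h36 h6
  match P, Q with
  | .zero, Q => exact (congrArg _ (zero_add Q)).trans (zero_add _).symm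
  | P, .zero => exact (congrArg _ (add_zero P)).trans (add_zero _).symm
  | .some x₁ y₁ n₁, .some x₂ y₂ n₂ =>
    have c₁ : HasCoords (toShort h₄ h₆ h6 hΔ (.some x₁ y₁ n₁)) _ _ := ⟨_, rfl⟩
    have c₂ : HasCoords (toShort h₄ h₆ h6 hΔ (.some x₂ y₂ n₂)) _ _ := ⟨_, rfl⟩
    have e₁ := (Affine.equation_iff ..).1 n₁.1
    have e₂ := (Affine.equation_iff ..).1 n₂.1
    by_cases hxy : x₁ = x₂ ∧ y₁ = W.negY x₂ y₂
    · rw [Affine.Point.add_of_Y_eq hxy.1 hxy.2]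
      refine (c₁.add_eq_zero ?_).symm
      convert c₂ using 1
      · rw [hxy.1]
      · rw [hxy.1, hxy.2, Affine.negY]
        ring
    · rw [Affine.Point.add_some hxy]
      set l := W.slope x₁ x₂ y₁ y₂ with hl
      have key : l * (x₁ - x₂) = y₁ - y₂ ∧ l * (y₁ + y₂ + W.a₁ * x₁ + W.a₃) =
          x₁ ^ 2 + x₁ * x₂ + x₂ ^ 2 + W.a₂ * (x₁ + x₂) + W.a₄ - W.a₁ * y₂ := by
        by_cases hx : x₁ = x₂
        · subst hx
          have hy : y₁ ≠ W.negY x₁ y₂ := fun h => hxy ⟨rfl, h⟩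
          have hyy : y₁ = y₂ := (Affine.Y_eq_of_Y_ne n₁.1 n₂.1 rfl hy)
          subst hyy
          refine ⟨by simp, ?_⟩
          rw [Affine.slope_of_Y_ne rfl hy] at hl
          have := sub_ne_zero.2 hy
          rw [eq_div_iff this, Affine.negY] at hl
          linear_combination hl
        · rw [Affine.slope_of_X_ne hx] at hl
          have hx' := sub_ne_zero.2 hx
          rw [eq_div_iff hx'] at hl
          refine ⟨hl, mul_left_cancel₀ hx' ?_⟩
          linear_combination (y₁ + y₂ + W.a₁ * x₁ + W.a₃) * hl + e₁ - e₂
      obtain ⟨k₁, k₂⟩ := key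
      have hs : HasCoords (toShort h₄ h₆ h6 hΔ (.some _ _ (Affine.nonsingular_add n₁ n₂ hxy)))
        _ _ := ⟨_, rfl⟩
      refine hs.ext ?_
      have := c₁.add c₂ (l := 3 * (2 * l + W.a₁)) ?_ ?_ ?_
      · convert this using 1
        · rw [Affine.addX, b₂]
          ring
        · rw [Affine.addY, Affine.negY, Affine.negAddY, Affine.addX, b₂]
          ring
      · rintro ⟨hx, hy⟩
        have hx : x₁ = x₂ := mul_left_cancel₀ h36 (by linear_combination hx)
        refine hxy ⟨hx, mul_left_cancel₀ h216 ?_⟩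
        rw [Affine.negY]
        subst hx
        linear_combination hy
      · linear_combination 216 * k₁
      · rw [h₄]
        simp only [b₂, b₄, c₄]
        linear_combination 1296 * k₂ - 648 * W.a₁ * k₁

/-- The isomorphism from `W` to its short Weierstrass form, as an isomorphism of groups. -/
noncomputable def shortEquiv : W.Point ≃+ W'.Point :=
  AddEquiv.ofBijective
    (AddMonoidHom.mk' (toShort h₄ h₆ h6 hΔ) (toShort_add h₄ h₆ h6 hΔ)) <| by
  have h36 : (36 : F) ≠ 0 := by
    rw [show (36 : F) = 6 * 6 by norm_num]
    exact mul_ne_zero h6 h6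
  have h216 : (216 : F) ≠ 0 := by
    rw [show (216 : F) = 36 * 6 by norm_num]
    exact mul_ne_zero h36 h6
  constructor
  · rw [injective_iff_map_eq_zero]
    intro P hP
    by_contra h0
    obtain ⟨x, y, h⟩ := exists_hasCoords h0
    exact (h.toShort h₄ h₆ h6 hΔ).ne_zero hP
  · intro Q
    by_cases h0 : Q = 0
    · exact ⟨0, h0 ▸ rfl⟩
    obtain ⟨X, Y, h⟩ := exists_hasCoords h0
    have hE : W'.Equation X Y := h.choose.1
    obtain ⟨x, rfl⟩ : ∃ x, X = 36 * x + 3 * W.b₂ :=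
      ⟨(X - 3 * W.b₂) / 36, by field_simp; ring⟩
    obtain ⟨y, rfl⟩ : ∃ y, Y = 108 * (2 * y + W.a₁ * x + W.a₃) :=
      ⟨(Y - 108 * (W.a₁ * x + W.a₃)) / 216, by field_simp; ring⟩
    rw [equation_shortForm h₄ h₆ h6] at hE
    have hW : WeierstrassCurve.Δ W ≠ 0 := by
      intro h
      apply hΔ
      have := Δ_shortForm W
      rw [h, mul_zero] at this
      rw [← this]
      congr 1
      ext <;> simp [shortForm, h₄, h₆]
    obtain ⟨P, hP⟩ := exists_point_of_equation hW hE
    exact ⟨P, (hP.toShort h₄ h₆ h6 hΔ).ext h⟩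

theorem HasCoords.shortEquiv {P : W.Point} {x y : F} (h : HasCoords P x y) :
    HasCoords (shortEquiv h₄ h₆ h6 hΔ P) (36 * x + 3 * W.b₂)
      (108 * (2 * y + W.a₁ * x + W.a₃)) := h.toShort h₄ h₆ h6 hΔ

end Field

/-- The substitution `(x, y) ↦ (36x + 3b, 108(2y + ax + c))` is invertible. -/
def substEquiv {F : Type*} [Field F] (b a c : F) (h36 : (36 : F) ≠ 0) (h216 : (216 : F) ≠ 0) :
    F × F ≃ F × F where
  toFun P := (36 * P.1 + 3 * b, 108 * (2 * P.2 + a * P.1 + c))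
  invFun P := ((P.1 - 3 * b) / 36, (P.2 - 108 * (a * ((P.1 - 3 * b) / 36) + c)) / 216)
  left_inv P := by
    ext
    · field_simp
      ring
    · dsimp only
      rw [add_sub_cancel_right, mul_div_cancel_left₀ _ h36, div_eq_iff h216]
      ring
  right_inv P := by
    ext
    · field_simp
      ring
    · dsimp only
      linear_combination div_mul_cancel₀ (P.2 - 108 * (a * ((P.1 - 3 * b) / 36) + c)) h216

theorem six_ne_zero_zmod {q : ℕ} [Fact q.Prime] (hq : 3 < q) : (6 : ZMod q) ≠ 0 := by
  have h : ¬ q ∣ 2 * 3 := fun h => by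
    rcases (Fact.out : q.Prime).dvd_mul.1 h with h | h
    · exact absurd (Nat.le_of_dvd two_pos h) (by omega)
    · exact absurd (Nat.le_of_dvd three_pos h) (by omega)
  exact_mod_cast (ZMod.natCast_eq_zero_iff (2 * 3) q).not.2 h

theorem card_equation_shortForm {F : Type*} [Field F] {W W' : WeierstrassCurve.Affine F}
    [WeierstrassCurve.IsShortNF W'] (h₄ : W'.a₄ = -27 * W.c₄) (h₆ : W'.a₆ = -54 * W.c₆)
    (h6 : (6 : F) ≠ 0) :
    Nat.card {P : F × F // W'.Equation P.1 P.2} = Nat.card {P : F × F // W.Equation P.1 P.2} := by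
  have h36 : (36 : F) ≠ 0 := by
    rw [show (36 : F) = 6 * 6 by norm_num]
    exact mul_ne_zero h6 h6
  have h216 : (216 : F) ≠ 0 := by
    rw [show (216 : F) = 36 * 6 by norm_num]
    exact mul_ne_zero h36 h6
  exact (Nat.card_congr ((substEquiv W.b₂ W.a₁ W.a₃ h36 h216).subtypeEquiv fun P =>
    (equation_shortForm h₄ h₆ h6 P.1 P.2).symm)).symm

theorem numPoints_shortForm (E : WeierstrassCurve ℤ) {q : ℕ} [Fact q.Prime] (hq : 3 < q) :
    numPoints (shortForm E) q = numPoints E q := by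
  have : ((shortForm E).map (Int.castRingHom (ZMod q))).IsShortNF :=
    ⟨by simp [shortForm], by simp [shortForm], by simp [shortForm]⟩
  have h₄ : ((shortForm E).map (Int.castRingHom (ZMod q))).a₄ =
    -27 * (E.map (Int.castRingHom (ZMod q))).c₄ := by simp [shortForm]
  have h₆ : ((shortForm E).map (Int.castRingHom (ZMod q))).a₆ =
    -54 * (E.map (Int.castRingHom (ZMod q))).c₆ := by simp [shortForm]
  exact congrArg (· + 1) (card_equation_shortForm h₄ h₆ (six_ne_zero_zmod hq))

section Galois

variable (E : WeierstrassCurve ℤ) (hE : E.Δ ≠ 0)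

/-- The isomorphism between `E` and its short form on points over `ℚ̄`. -/
noncomputable def shortEquivQBar : PointsQBar E ≃+ Points (shortForm E) QBar :=
  shortEquiv (W := (overQ E).baseChange QBar) (W' := curve (shortForm E) QBar)
    (by simp [shortForm, WeierstrassCurve.baseChange])
    (by simp [shortForm, WeierstrassCurve.baseChange]) (by norm_num)
    (by rw [discr_eq, Δ_shortForm]; exact_mod_cast mul_ne_zero (by norm_num) hE)

theorem HasCoords.galPoint {P : PointsQBar E} {x y : QBar} (h : HasCoords P x y) (σ : GQ) :
    HasCoords (galPoint E σ P) (σ x) (σ y) := by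
  obtain ⟨h, rfl⟩ := h
  exact ⟨_, rfl⟩

theorem HasCoords.shortEquivQBar {P : PointsQBar E} {x y : QBar} (h : HasCoords P x y) :
    HasCoords (shortEquivQBar E hE P) (36 * x + 3 * (E.b₂ : QBar))
      (108 * (2 * y + (E.a₁ : QBar) * x + (E.a₃ : QBar))) := by
  have H : HasCoords (ShortWeierstrass.shortEquivQBar E hE P)
      (36 * x + 3 * ((overQ E).baseChange QBar).b₂) (108 * (2 * y +
        ((overQ E).baseChange QBar).a₁ * x + ((overQ E).baseChange QBar).a₃)) :=
    h.shortEquiv _ _ _ _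
  simpa [WeierstrassCurve.baseChange] using H

theorem shortEquivQBar_galPoint (σ : GQ) (P : PointsQBar E) :
    shortEquivQBar E hE (galPoint E σ P) =
      mapPt (σ : QBar →+* QBar) (shortEquivQBar E hE P) := by
  by_cases h0 : P = 0
  · subst h0
    simp only [map_zero]
  obtain ⟨x, y, h⟩ := exists_hasCoords h0
  refine HasCoords.ext ((h.galPoint E σ).shortEquivQBar E hE) ?_
  convert (h.shortEquivQBar E hE).mapPt (σ : QBar →+* QBar) using 1
  · simp [map_ofNat]
  · simp [map_ofNat]

theorem galPoint_one (P : PointsQBar E) : galPoint E 1 P = P := by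
  by_cases h0 : P = 0
  · subst h0
    exact map_zero _
  obtain ⟨x, y, h⟩ := exists_hasCoords h0
  exact (h.galPoint E 1).ext h

theorem galPoint_mul (σ τ : GQ) (P : PointsQBar E) :
    galPoint E (σ * τ) P = galPoint E σ (galPoint E τ P) := by
  by_cases h0 : P = 0
  · subst h0
    simp only [map_zero]
  obtain ⟨x, y, h⟩ := exists_hasCoords h0
  exact (h.galPoint E (σ * τ)).ext ((h.galPoint E τ).galPoint E σ)

theorem isOpen_stabilizer_galPoint (P : PointsQBar E) : IsOpen {σ : GQ | galPoint E σ P = P} := by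
  by_cases h0 : P = 0
  · subst h0
    simp only [map_zero]
    exact isOpen_const
  obtain ⟨x, y, h⟩ := exists_hasCoords h0
  have hx := stabilizer_isOpen_of_isIntegral (K := ℚ) x
  have hy := stabilizer_isOpen_of_isIntegral (K := ℚ) y
  convert hx.inter hy using 1
  ext σ
  constructor
  · intro hσ
    have h' := h.galPoint E σ
    rw [show galPoint E σ P = P from hσ] at h'
    exact ⟨(h'.unique h).1, (h'.unique h).2⟩
  · rintro ⟨h₁, h₂⟩
    have h' := h.galPoint E σ
    rw [show σ x = x from h₁, show σ y = y from h₂] at h'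
    exact h'.ext h

end Galois

end ShortWeierstrass

/-! ### The representation on the Tate module of an elliptic curve -/

open ShortWeierstrass

theorem Δ_ne_zero_of_isElliptic {E : WeierstrassCurve ℤ} (hE : (overQ E).IsElliptic) :
    E.Δ ≠ 0 := by
  have h := (overQ E).isUnit_Δ.ne_zero
  rw [WeierstrassCurve.map_Δ] at h
  exact fun h0 => h (by rw [h0, map_zero])

section TateRepresentation

variable {E : WeierstrassCurve ℤ} (hE : E.Δ ≠ 0) {p : ℕ} [hp : Fact p.Prime]

include hE in
theorem Δ_shortForm_ne_zero : (shortForm E).Δ ≠ 0 := by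
  rw [Δ_shortForm]
  exact mul_ne_zero (by norm_num) hE

include hE in
theorem natCard_torsion_pointsQBar (k : ℕ) :
    Nat.card {P : PointsQBar E // p ^ k • P = 0} = (p ^ k) ^ 2 := by
  rw [← natCard_torsion_QBar (Δ_shortForm_ne_zero hE) (pow_ne_zero k hp.out.ne_zero)]
  refine Nat.card_congr ((shortEquivQBar E hE).toEquiv.subtypeEquiv fun P => ?_)
  rw [AddEquiv.toEquiv_eq_coe, AddEquiv.coe_toEquiv, ← map_nsmul,
    EmbeddingLike.map_eq_zero_iff]

include hE in
theorem exists_isTateRep : ∃ ρ : GQ →ₜ* GL (Fin 2) ℤ_[p], IsTateRep E p ρ := by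
  obtain ⟨b⟩ := TateModule.nonempty_basis (natCard_torsion_pointsQBar hE (p := p))
  obtain ⟨ρ, hρ⟩ := TateModule.exists_continuous_representation b (galPoint E)
    (AddMonoidHom.ext (galPoint_one E)) (fun σ τ => AddMonoidHom.ext (galPoint_mul E σ τ))
    (isOpen_stabilizer_galPoint E)
  exact ⟨ρ, b, hρ⟩

variable {ρ : GQ →ₜ* GL (Fin 2) ℤ_[p]} {q : ℕ}

theorem not_dvd_Δ_shortForm (hq : q.Prime) (hq3 : 3 < q) (hqE : ¬(q : ℤ) ∣ E.Δ) :
    ¬(q : ℤ) ∣ (shortForm E).Δ := by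
  rw [Δ_shortForm, (Nat.prime_iff_prime_int.1 hq).dvd_mul, not_or]
  refine ⟨fun h => ?_, hqE⟩
  have h := (Nat.prime_iff_prime_int.1 hq).dvd_of_dvd_pow h
  have h : q ∣ 2 * 3 := by exact_mod_cast h
  rcases hq.dvd_mul.1 h with h | h
  · exact absurd (Nat.le_of_dvd two_pos h) (by omega)
  · exact absurd (Nat.le_of_dvd three_pos h) (by omega)

theorem not_dvd_prime_pow (hq : q.Prime) (hqp : q ≠ p) (k : ℕ) : ¬ q ∣ p ^ k := fun h =>
  hqp ((Nat.prime_dvd_prime_iff_eq hq hp.out).1 (hq.dvd_of_dvd_pow h))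

include hE in
theorem IsTateRep.isUnramifiedAtPrime (hρ : IsTateRep E p ρ) (hq : q.Prime) (hq3 : 3 < q)
    (hqp : q ≠ p) (hqE : ¬(q : ℤ) ∣ E.Δ) : IsUnramifiedAtPrime ρ q := by
  obtain ⟨b, hb⟩ := hρ
  intro 𝔮 h𝔮 σ hσ
  have hid : tateMap p (galPoint E σ) = LinearMap.id := by
    ext1 t
    refine Subtype.ext (funext fun k => ?_)
    change galPoint E σ (t.1 k) = t.1 k
    apply (shortEquivQBar E hE).injective
    rw [shortEquivQBar_galPoint]
    refine mapPt_eq_of_mem_inertia hq h𝔮 (not_dvd_Δ_shortForm hq hq3 hqE)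
      (not_dvd_prime_pow hq hqp k) hσ ?_
    rw [← map_nsmul, (t.2 k).1, map_zero]
  apply Units.ext
  rw [hb σ, hid, LinearMap.toMatrix_id]
  rfl

include hE in
theorem IsTateRep.trace_frobenius (hρ : IsTateRep E p ρ) (hq : q.Prime) (hq3 : 3 < q)
    (hqp : q ≠ p) (hqE : ¬(q : ℤ) ∣ E.Δ) {σ : GQ} (hσ : IsFrobenius q σ) :
    Matrix.trace (ρ σ : Matrix (Fin 2) (Fin 2) ℤ_[p]) =
      ((q + 1 - numPoints E q : ℤ) : ℤ_[p]) := by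
  have : Fact q.Prime := ⟨hq⟩
  obtain ⟨b, hb⟩ := hρ
  obtain ⟨h₁, h₂⟩ := frobenius_on_torsion hq (hq.odd_of_ne_two (by omega))
    (not_dvd_Δ_shortForm hq hq3 hqE) hσ (congrArg (fun n : ℕ => (q : ℤ) + 1 - n)
      (numPoints_shortForm E hq3).symm)
  let ψ := shortEquivQBar E hE
  have hψ : ∀ P, ψ (galPoint E σ P) = mapPt (σ : QBar →+* QBar) (ψ P) :=
    shortEquivQBar_galPoint E hE σ
  rw [hb σ]
  refine TateModule.trace_eq (natCard_torsion_pointsQBar hE) b _ hq hqp (fun k P hP => ?_)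
    fun k n hn hP => ?_
  · apply ψ.injective
    rw [map_add, map_sub, map_zsmul, map_zsmul, hψ, hψ, map_zero]
    exact h₁ _ (not_dvd_prime_pow hq hqp k) _ (by rw [← map_nsmul, hP, map_zero])
  · refine h₂ _ (not_dvd_prime_pow hq hqp k) n hn fun Q hQ => ?_
    obtain ⟨P, rfl⟩ := ψ.surjective Q
    rw [← map_nsmul, EmbeddingLike.map_eq_zero_iff] at hQ
    rw [← hψ, hP P hQ, map_zsmul]

end TateRepresentation

/-! ### Modularity of the curve and of its representations -/

/-- Outside this set the trace of Frobenius is the integer `q + 1 - #E(𝔽_q)`. -/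
def badPrimes (E : WeierstrassCurve ℤ) (p : ℕ) : Finset ℕ :=
  Finset.range 4 ∪ {p} ∪ E.Δ.natAbs.primeFactors

theorem of_notMem_badPrimes {E : WeierstrassCurve ℤ} (hE : E.Δ ≠ 0) {p q : ℕ} (hq : q.Prime)
    (h : q ∉ badPrimes E p) : 3 < q ∧ q ≠ p ∧ ¬(q : ℤ) ∣ E.Δ := by
  simp only [badPrimes, Finset.mem_union, Finset.mem_range, Finset.mem_singleton, not_or,
    Nat.mem_primeFactors, not_and] at h
  refine ⟨by omega, h.1.2, fun hd => h.2 hq (Int.natCast_dvd.1 hd) (Int.natAbs_ne_zero.2 hE)⟩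

/-- The kernel of `ι` meets `ℤ` in zero, and `𝓞 K` is a domain which is integral over `ℤ`. -/
theorem injective_of_integers {K : Type*} [Field K] [CharZero K] {A : Type*} [CommRing A]
    [CharZero A] (ι : 𝓞 K →+* A) : Function.Injective ι := by
  rw [RingHom.injective_iff_ker_eq_bot]
  refine Ideal.eq_bot_of_comap_eq_bot (R := ℤ) ?_
  rw [eq_bot_iff]
  intro n hn
  simpa using hn

theorem TateRepIsModular.isModularCurve {E : WeierstrassCurve ℤ} (hE : E.Δ ≠ 0) {p : ℕ}
    [Fact p.Prime] (h : TateRepIsModular E p) : IsModularCurve E := by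
  obtain ⟨ρ, hρ, f, A', _, j, ι, hj, S, hS⟩ := h
  have : CharZero A' := charZero_of_injective_ringHom hj
  refine ⟨f, S ∪ badPrimes E p, fun q hq hqS => ?_⟩
  rw [Finset.mem_union, not_or] at hqS
  obtain ⟨a, ha, -, htr⟩ := hS q hq hqS.1
  obtain ⟨hq3, hqp, hqE⟩ := of_notMem_badPrimes hE hq hqS.2
  obtain ⟨σ, hσ⟩ := exists_isFrobenius hq
  have h := htr σ hσ
  rw [hρ.trace_frobenius hE hq hq3 hqp hqE hσ, map_intCast, ← map_intCast ι] at h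
  rw [← ha, ← injective_of_integers ι h]
  simp

theorem IsModularCurve.tateRepIsModular {E : WeierstrassCurve ℤ} (hE : E.Δ ≠ 0)
    (h : IsModularCurve E) (p : ℕ) [Fact p.Prime] : TateRepIsModular E p := by
  obtain ⟨f, S, hS⟩ := h
  obtain ⟨ρ, hρ⟩ := exists_isTateRep hE (p := p)
  -- `ℤ_p` and the domain `𝓞_f`, which is algebraic over `ℤ`, both embed in an algebraic closure
  -- of `ℚ_p`
  let ι : f.integers →ₐ[ℤ] AlgebraicClosure ℚ_[p] := IsAlgClosed.lift
  refine ⟨ρ, hρ, f, AlgebraicClosure ℚ_[p], inferInstance,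
    (algebraMap ℚ_[p] (AlgebraicClosure ℚ_[p])).comp (algebraMap ℤ_[p] ℚ_[p]), ι,
    (algebraMap ℚ_[p] (AlgebraicClosure ℚ_[p])).injective.comp
      (IsFractionRing.injective ℤ_[p] ℚ_[p]),
    S ∪ badPrimes E p, fun q hq hqS => ?_⟩
  rw [Finset.mem_union, not_or] at hqS
  obtain ⟨hq3, hqp, hqE⟩ := of_notMem_badPrimes hE hq hqS.2
  refine ⟨((q + 1 - numPoints E q : ℤ) : f.integers), ?_,
    hρ.isUnramifiedAtPrime hE hq hq3 hqp hqE, fun σ hσ => ?_⟩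
  · rw [hS q hq hqS.1]
    simp
  · rw [hρ.trace_frobenius hE hq hq3 hqp hqE hσ, map_intCast, map_intCast]

theorem theorem3p1 (E : WeierstrassCurve ℤ) (hE : (overQ E).IsElliptic) :
    (IsModularCurve E ↔ ∀ (p : ℕ) [Fact p.Prime], TateRepIsModular E p) ∧
    ((∀ (p : ℕ) [Fact p.Prime], TateRepIsModular E p) ↔
      ∃ (p : ℕ) (_ : Fact p.Prime), TateRepIsModular E p) := by
  have hΔ := Δ_ne_zero_of_isElliptic hE
  have h₁₂ (h : IsModularCurve E) (p : ℕ) [Fact p.Prime] : TateRepIsModular E p :=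
    h.tateRepIsModular hΔ p
  have h₂₃ (h : ∀ (p : ℕ) [Fact p.Prime], TateRepIsModular E p) :
      ∃ (p : ℕ) (_ : Fact p.Prime), TateRepIsModular E p := ⟨2, ⟨Nat.prime_two⟩, h 2⟩
  have h₃₁ : (∃ (p : ℕ) (_ : Fact p.Prime), TateRepIsModular E p) → IsModularCurve E :=
    fun ⟨_, _, h⟩ => h.isModularCurve hΔ
  exact ⟨⟨h₁₂, fun h => h₃₁ (h₂₃ h)⟩, h₂₃, fun h => h₁₂ (h₃₁ h)⟩
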